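/- **Setting.** Let $\gamma$ be an admissible weight. That is, for some $c>0$ and $\frac{\pi}{2}<\alpha_0\le\pi$, the function $\gamma$ is analytic and non-vanishing in $\{s\ne -c:|\arg(s+c)|<\alpha_0\}$ and positive on $(-c,\infty)$; and, with $L(s)=\gamma(s)^{1/s}$ (defined by the branch of $\log\gamma$ that is real on $(-c,\infty)$), the function $\varepsilon(s)=sL'(s)/L(s)$ is positive and bounded on $(0,\infty)$ and satisfies - (A) $\int^\infty\frac{\varepsilon(\rho)}{\rho}\,d\rho=\infty$; - (B) $\varepsilon(\lambda\rho)\sim\varepsilon(\rho)$ as $\rho\to\infty$, locally uniformly for $\lambda\neq0$, $|\arg\lambda|<\alpha_0$; - (C) $\lim_{\rho\to\infty}\varepsilon(\rho)$ exists and is smaller than $2$; - (D) if this limit is $0$, then $\varepsilon$ is eventually decreasing on the positive ray and, for every $\delta>0$, there is $k_\delta>0$ with $|\varepsilon'(\rho)|\ge k_\delta e^{-\delta\rho}$ for all sufficiently large $\rho$. Write $\gamma_n=\gamma(n)$ and $\widehat\gamma_n=\sup_{\rho>0}\rho^n|\gamma(i\rho)|$. The sequence $\widehat\gamma$ is called analytic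 if $\limsup_{n\to\infty}(\widehat\gamma_n/n!)^{1/n}<\infty$. A positive sequence $M=(n!\,m_n)_{n\ge0}$ is called regular if $(m_n)$ is eventually log-convex, $(m_n^{1/n})$ is eventually non-decreasing, and there is $C>0$ with $m_{n+1}\le C\,m_n^{1+1/n}$ for all $n\ge1$. Denote by $M\gamma$ the sequence $(M_n\gamma_{n+1})_{n\ge0}$. **The classes $B$.** For $\mu>0$, positive sequences $M,N$ and $a>0$, the class $B_\mu(M,N;[0,a))$ consists of all complex-valued $f\in C^\infty([0,a))$ such that for every compact $J\subset[0,a)$ there is $C>0$ with $$|f^{(n)}(x)|\le C^{n+1}M_n\quad(x\in J,\ n\ge0),\qquad\left|\frac{d^n}{d\xi^n}f(e^\xi)\right|\le C\mu^nN_n\quad(e^\xi\in J,\ n\ge0).$$ $B_\mu(M,N;0_+)$ denotes the set of right germs at $0$ of members of $B_\mu(M,N;[0,a))$, $a>0$. **The classes $D$.** Put $$E(x)=\sum_{n\ge0}\frac{x^n}{\gamma_{n+1}},\qquad K(w)=\frac1{2\pi i}\int_{1-i\infty}^{1+i\infty}\gamma(s)\,w^{-s}\,ds,$$ where $K$ is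 considered at those $w\ne0$ (with $\arg w\in(-\pi,\pi]$ and the principal branch of $w^{-s}$) for which the integral converges absolutely; this condition depends only on $\arg w$. For $\eta>0$ let $\Omega_\eta(\gamma)$ be the set of all $z\neq0$ such that $K(t/z)$ is so defined for all $t>0$ and $\sup_{t>0}E(t\eta)\,|K(t/z)|<\infty$. For $\delta>0$, the class $D(M,\gamma;[0,\delta))$ consists of all functions $f$ such that for every $\eta>1/\delta$: $f$ is holomorphic in (a neighbourhood of each point of) $\Omega_\eta(\gamma)$; $f$ and all its derivatives extend continuously from $\Omega_\eta(\gamma)$ to the origin, with values denoted $f^{(k)}(0)$; and there is $C=C_\eta>0$ with $$\Bigl|f(z)-\sum_{0\le k<n}\frac{f^{(k)}(0)}{k!}z^k\Bigr|\le C^{n+1}\,\frac{M_n\gamma_{n+1}}{n!}\,|z|^n\qquad(z\in\Omega_\eta(\gamma),\ n\ge0).$$ **Lemma.** Let $\gamma$ be an admissible weight with analytic $\widehat\gamma$ and let $M$ be a regular sequence. Then for every $\eta>1$ $$B_{1/\eta}(M\gamma,\widehat\gamma;0_+)\subseteq\bigcup_{\delta>0}D\left(M,\gamma;[0,\delta)\right)\subseteq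 B_\eta(M\gamma,\widehat\gamma;0_+),$$ where a function in $D(M,\gamma;[0,\delta))$ is identified with the right germ at $0$ of its restriction to the half-line $[0,\infty)$. -/

import Mathlib

open Filter Topology Set
open scoped ContDiff Nat

noncomputable section

/-! ### Admissible weights

A weight is a function `γ : ℂ → ℂ`; only its values on a sector
`{s : |arg (s + c)| < α₀}` with `c > 0` and `α₀ > π / 2` are relevant. -/

/-- The open sector `{s : |arg (s + c)| < α₀}` with vertex `-c` (the vertex is excluded). -/
def sectorAt (c α₀ : ℝ) : Set ℂ := {s : ℂ | s + c ≠ 0 ∧ |Complex.arg (s + c)| < α₀}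

/-- The analytic branch of `log γ`, obtained by integrating `γ' / γ` along the segment from `0`
to `s`. The sectors `sectorAt c α₀` with `c > 0` and `α₀ ≤ π` are star-shaped about `0`. -/
def logBranch (γ : ℂ → ℂ) (s : ℂ) : ℂ :=
  Complex.log (γ 0) + s * ∫ u in (0 : ℝ)..1, logDeriv γ (u * s)

/-- `L(s) = γ(s) ^ (1 / s)`. -/
def weightL (γ : ℂ → ℂ) (s : ℂ) : ℂ := Complex.exp (logBranch γ s / s)

/-- `ε(s) = s * L'(s) / L(s)`. -/
def weightEps (γ : ℂ → ℂ) (s : ℂ) : ℂ := s * deriv (weightL γ) s / weightL γ s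

/-- `ε` on the real axis, where it is real-valued for the weights considered. -/
def weightEpsReal (γ : ℂ → ℂ) (ρ : ℝ) : ℝ := (weightEps γ (ρ : ℂ)).re

/-- Admissible weights. -/
def IsAdmissible (γ : ℂ → ℂ) : Prop :=
  ∃ c α₀ : ℝ, 0 < c ∧ Real.pi / 2 < α₀ ∧ α₀ ≤ Real.pi ∧
    AnalyticOnNhd ℂ γ (sectorAt c α₀) ∧
    (∀ s ∈ sectorAt c α₀, γ s ≠ 0) ∧
    (∀ x : ℝ, -c < x → 0 < (γ (x : ℂ)).re ∧ (γ (x : ℂ)).im = 0) ∧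
    -- `ε` is positive and bounded on the positive ray
    (∀ ρ : ℝ, 0 < ρ → 0 < weightEpsReal γ ρ) ∧
    (∃ B : ℝ, ∀ ρ : ℝ, 0 < ρ → weightEpsReal γ ρ ≤ B) ∧
    -- (A) the integral of `ε(ρ) / ρ` diverges at infinity
    Tendsto (fun R : ℝ => ∫ ρ in (1 : ℝ)..R, weightEpsReal γ ρ / ρ) atTop atTop ∧
    -- (B) `ε(lam * ρ) ∼ ε(ρ)`, locally uniformly in `lam`
    TendstoLocallyUniformlyOn
      (fun (ρ : ℝ) (lam : ℂ) => weightEps γ (lam * ρ) / weightEps γ ρ) (fun _ => 1) atTop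
      (sectorAt 0 α₀) ∧
    -- (C) `ε` has a limit smaller than `2`
    (∃ l : ℝ, l < 2 ∧ Tendsto (weightEpsReal γ) atTop (𝓝 l)) ∧
    -- (D) if the limit is `0`, then `ε` is eventually decreasing and `ε'` is not too small
    (Tendsto (weightEpsReal γ) atTop (𝓝 0) →
      (∃ ρ₀ : ℝ, AntitoneOn (weightEpsReal γ) (Ici ρ₀)) ∧
      ∀ δ : ℝ, 0 < δ → ∃ k : ℝ, 0 < k ∧
        ∀ᶠ ρ : ℝ in atTop, k * Real.exp (-δ * ρ) ≤ |deriv (weightEpsReal γ) ρ|)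

/-- The sequence `γ_n = γ(n)`. -/
def weightSeq (γ : ℂ → ℂ) (n : ℕ) : ℝ := (γ (n : ℂ)).re

/-- `γ̂_n = sup_{ρ > 0} ρ ^ n * |γ(i ρ)|`. -/
def gammaHat (γ : ℂ → ℂ) (n : ℕ) : ℝ :=
  ⨆ ρ : Ioi (0 : ℝ), (ρ : ℝ) ^ n * ‖γ (Complex.I * ((ρ : ℝ) : ℂ))‖

/-- A sequence `N` is analytic if `limsup (N_n / n!) ^ (1 / n) < ∞`. -/
def IsAnalyticSeq (N : ℕ → ℝ) : Prop :=
  IsBoundedUnder (· ≤ ·) atTop fun n : ℕ => (N n / (n ! : ℝ)) ^ (1 / (n : ℝ))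

/-- `M = (n! * m_n)` is regular: it is positive, `m` is eventually log-convex, `m_n ^ (1 / n)` is
eventually non-decreasing, and `m_{n+1} ≤ C * m_n ^ (1 + 1 / n)`. -/
def IsRegularSeq (M : ℕ → ℝ) : Prop :=
  (∀ n, 0 < M n) ∧
    ∃ m : ℕ → ℝ, (∀ n, M n = (n ! : ℝ) * m n) ∧
      (∀ᶠ n : ℕ in atTop, m (n + 1) ^ 2 ≤ m n * m (n + 2)) ∧
      (∀ᶠ n : ℕ in atTop, m n ^ (1 / (n : ℝ)) ≤ m (n + 1) ^ (1 / ((n : ℝ) + 1))) ∧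
      ∃ C : ℝ, 0 < C ∧ ∀ n : ℕ, 1 ≤ n → m (n + 1) ≤ C * m n ^ (1 + 1 / (n : ℝ))

/-! ### The functions `E` and `K` and the domains `Ω_η(γ)` -/

/-- `E(x) = ∑ x ^ n / γ_{n+1}`; only positive arguments occur below. -/
def weightE (γ : ℂ → ℂ) (x : ℝ) : ℝ := ∑' n : ℕ, x ^ n / weightSeq γ (n + 1)

/-- The integrand `γ(1 + i y) * w ^ (-(1 + i y))` of the inverse Mellin transform of `γ`. -/
def kernelIntegrand (γ : ℂ → ℂ) (w : ℂ) (y : ℝ) : ℂ :=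
  γ (1 + y * Complex.I) * w ^ (-(1 + y * Complex.I))

/-- The inverse Mellin transform
`K(w) = (2 π i)⁻¹ * ∫_{Re s = 1} γ(s) * w ^ (-s) ds`, whose moments are
`∫_0^∞ t ^ n * K(t) dt = γ_{n+1}`. It is holomorphic in the sector about the positive ray in which
the integral converges absolutely. -/
def weightK (γ : ℂ → ℂ) (w : ℂ) : ℂ :=
  (1 / (2 * Real.pi : ℝ) : ℂ) * ∫ y : ℝ, kernelIntegrand γ w y

/-- `Ω_η(γ) = {z ≠ 0 : sup_{t > 0} E(t η) |K(t / z)| < ∞}`. The point `z` is admitted only if the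
integral defining `K(t / z)` converges absolutely. -/
def domainOmega (γ : ℂ → ℂ) (η : ℝ) : Set ℂ :=
  {z : ℂ | z ≠ 0 ∧ (∀ t : ℝ, 0 < t → MeasureTheory.Integrable (kernelIntegrand γ (t / z))) ∧
    ∃ B : ℝ, ∀ t : ℝ, 0 < t → weightE γ (t * η) * ‖weightK γ (t / z)‖ ≤ B}

/-! ### The classes `B` and `D` -/

/-- The class `B_η(M, N; I)` of an interval `I ⊆ [0, ∞)`. -/
def classB (η : ℝ) (M N : ℕ → ℝ) (I : Set ℝ) : Set (ℝ → ℂ) :=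
  {f | ContDiffOn ℝ ∞ f I ∧
    ∀ J : Set ℝ, IsCompact J → J ⊆ I → ∃ C : ℝ, 0 < C ∧
      (∀ n : ℕ, ∀ x ∈ J, ‖iteratedDerivWithin n f I x‖ ≤ C ^ (n + 1) * M n) ∧
      (∀ n : ℕ, ∀ ξ : ℝ, Real.exp ξ ∈ J →
        ‖iteratedDerivWithin n (fun v : ℝ => f (Real.exp v)) (Real.exp ⁻¹' I) ξ‖
          ≤ C * η ^ n * N n)}

/-- Right germs at `0` of complex-valued functions on `[0, ∞)`. -/
abbrev RightGerm : Type := Germ (𝓝[≥] (0 : ℝ)) ℂ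

/-- The class `B_η(M, N; 0₊)` of right germs at the origin: germs of members of
`B_η(M, N; [0, a))`, for some `a > 0`. -/
def germsB (η : ℝ) (M N : ℕ → ℝ) : Set RightGerm :=
  ⋃ a > (0 : ℝ), (fun f : ℝ → ℂ => (f : RightGerm)) '' classB η M N (Ico 0 a)

/-- `c` is the sequence of derivatives at `0` of a function `f` on `{0} ∪ S`, all of whose
derivatives extend continuously from `S` to the origin. -/
def IsJetAtZero (f : ℂ → ℂ) (S : Set ℂ) (c : ℕ → ℂ) : Prop :=
  f 0 = c 0 ∧ ∀ k : ℕ, Tendsto (iteratedDeriv k f) (𝓝[S] 0) (𝓝 (c k))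

/-- The class `D(M, γ; [0, a))`: functions that, for every `η > 1 / a`, are holomorphic in
`Ω_η(γ)`, smooth up to the origin, and whose Taylor remainders at the origin satisfy
`|R_n(z, f)| ≤ C ^ (n + 1) * M_n * γ_{n+1} / n! * |z| ^ n` in `Ω_η(γ)`, with `C` depending on `η`
and `f`. -/
def classD (M : ℕ → ℝ) (γ : ℂ → ℂ) (a : ℝ) : Set (ℂ → ℂ) :=
  {f | ∀ η : ℝ, 1 / a < η →
    AnalyticOnNhd ℂ f (domainOmega γ η) ∧
    ∃ c : ℕ → ℂ, IsJetAtZero f (domainOmega γ η) c ∧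
      ∃ C : ℝ, 0 < C ∧ ∀ n : ℕ, ∀ z ∈ domainOmega γ η,
        ‖f z - ∑ k ∈ Finset.range n, c k / (k ! : ℂ) * z ^ k‖
          ≤ C ^ (n + 1) * (M n * weightSeq γ (n + 1) / (n ! : ℝ)) * ‖z‖ ^ n}

/-- The right germs at `0` of the restrictions to the half-line of the members of
`D(M, γ; [0, a))`. -/
def germsD (M : ℕ → ℝ) (γ : ℂ → ℂ) (a : ℝ) : Set RightGerm :=
  (fun F : ℂ → ℂ => ((fun x : ℝ => F (x : ℂ)) : RightGerm)) '' classD M γ a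

/-- The sequence `M γ`, with terms `M_n * γ_{n+1}`. -/
def weightedSeq (M : ℕ → ℝ) (γ : ℂ → ℂ) (n : ℕ) : ℝ := M n * weightSeq γ (n + 1)

end

/-!
Two facts about an admissible weight with analytic `γ̂` carry the proof. Let `l < 2` be the limit of `ε`.
Analyticity of `γ̂` forces `l > 0` (`lim_pos`), and integrating `ε` along circular arcs shows that
`|γ(σ + i y)|` behaves like `exp (-(π l / 2 ± o(1)) |y|)` (`exists_norm_le`, `exists_le_norm`).

* Hence `γ̂_n` is `n! / (π l / 2) ^ n` up to factors `(1 + o(1)) ^ n`, and the second condition in the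
  class `B_{1/η}` (or `B_η`) says, in essence, that `f (exp ξ)` is holomorphic in the strip of half-width
  `η π l / 2` (or `π l / (2 η)`).
* Moreover `Ω_η(γ)` is close to the sector `|arg z| < π l / 2` in a disc of radius comparable to
  `1 / η`. It contains a neighbourhood of `0` in every smaller sector, by shifting the line of
  integration for `K` (`exists_sector_subset_domainOmega`). It is contained in the closed sector,
  since `K` does not converge absolutely outside it, and in the disc `|z| ≤ D / η`, since the moments
  of `K` along a ray are `γ_{n+1} z ^ (n + 1)` (`exists_norm_le_of_mem_domainOmega`).

So, for `η > 1`, a function of class `D` restricts to a germ of class `B_η` by Cauchy's estimates in a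
slightly smaller sector (`germsD_subset_germsB`).

Conversely, a germ of class `B_{1/η}` extends to a bounded holomorphic function `F` in a sector of
half-opening greater than `π l / 2` (`exists_sector_extension`), and its Taylor remainders on the
half-line satisfy the required bounds. These propagate to smaller sectors
(`exists_norm_sub_sum_le_of_sector`): in the variable `log z` the remainder of order `N` is bounded in
a half-strip and decays like `exp (N Re ζ)` on its axis, so by the two-constants theorem
(`norm_le_of_halfStrip`) it decays like a proportionally smaller power of `|z|` off the axis. Taking
`N` to be a large fixed multiple of the order wanted makes up for the loss, because the roots
`(M_n γ_{n+1} / n!) ^ (1 / n)` change only by bounded factors when `n` is multiplied by a constant;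
this is where the regularity of `M` enters (`exists_root`). The continuity of the derivatives at the
origin is then a consequence of Cauchy's estimates.
-/

/-! ### Derivatives of real and imaginary parts -/

theorem HasDerivAt.complex_im {f : ℝ → ℂ} {f' : ℂ} {x : ℝ} (h : HasDerivAt f f' x) :
    HasDerivAt (fun y => (f y).im) f'.im x :=
  Complex.imCLM.hasFDerivAt.comp_hasDerivAt x h

theorem HasDerivAt.complex_re {f : ℝ → ℂ} {f' : ℂ} {x : ℝ} (h : HasDerivAt f f' x) :
    HasDerivAt (fun y => (f y).re) f'.re x :=
  Complex.reCLM.hasFDerivAt.comp_hasDerivAt x h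

/-! ### The logarithm of the weight in a half-plane -/

/-- The branch `logBranch γ` is a primitive of `γ' / γ` in the half-plane `Re s > -c`. -/
theorem hasDerivAt_logBranch {γ : ℂ → ℂ} {c : ℝ} (hc : 0 < c)
    (hd : DifferentiableOn ℂ γ {s | -c < s.re}) (h0 : ∀ s : ℂ, -c < s.re → γ s ≠ 0)
    {s : ℂ} (hs : -c < s.re) : HasDerivAt (logBranch γ) (logDeriv γ s) s := by
  have hopen : IsOpen {s : ℂ | -c < s.re} := isOpen_lt continuous_const Complex.continuous_re
  -- a ball inside the half-plane that contains both `0` and `s`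
  obtain ⟨R, hR0, hRs⟩ : ∃ R : ℝ, 0 < R ∧ s ∈ Metric.ball (R : ℂ) (R + c) := by
    have hden : 0 < s.re + c := by linarith
    refine ⟨(‖s‖ ^ 2 + 1) / (2 * (s.re + c)), by positivity, ?_⟩
    set R := (‖s‖ ^ 2 + 1) / (2 * (s.re + c)) with hRdef
    have hR0 : 0 < R := by positivity
    have hRe : R * (2 * (s.re + c)) = ‖s‖ ^ 2 + 1 := by rw [hRdef]; field_simp
    rw [Metric.mem_ball, dist_eq_norm]
    refine lt_of_pow_lt_pow_left₀ 2 (by positivity) ?_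
    have e1 : ‖s - (R : ℂ)‖ ^ 2 = ‖s‖ ^ 2 - 2 * R * s.re + R ^ 2 := by
      rw [← Complex.normSq_eq_norm_sq, ← Complex.normSq_eq_norm_sq, Complex.normSq_apply,
        Complex.normSq_apply]
      simp
      ring
    rw [e1]
    nlinarith
  have hball : Metric.ball (R : ℂ) (R + c) ⊆ {s | -c < s.re} := by
    intro z hz
    rw [Metric.mem_ball, dist_eq_norm] at hz
    have h1 := Complex.abs_re_le_norm (z - R)
    have h2 := abs_le.1 h1
    simp at h2 ⊢
    linarith [h2.1]
  have h0mem : (0 : ℂ) ∈ Metric.ball (R : ℂ) (R + c) := by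
    rw [Metric.mem_ball, dist_eq_norm]
    simp [abs_of_pos hR0, hc]
  have hlog : DifferentiableOn ℂ (logDeriv γ) (Metric.ball (R : ℂ) (R + c)) := by
    refine DifferentiableOn.mono ?_ hball
    exact (hd.deriv hopen).div hd fun z hz => h0 z hz
  obtain ⟨P, hP⟩ := hlog.isExactOn_ball
  have key : ∀ w ∈ Metric.ball (R : ℂ) (R + c),
      logBranch γ w = Complex.log (γ 0) + (P w - P 0) := by
    intro w hw
    have hseg : ∀ u ∈ Icc (0 : ℝ) 1, (u : ℂ) * w ∈ Metric.ball (R : ℂ) (R + c) := by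
      intro u hu
      have := (convex_ball (R : ℂ) (R + c)).starConvex h0mem |>.smul_mem hw hu.1 hu.2
      simpa using this
    have hint : ∫ u in (0 : ℝ)..1, w * logDeriv γ (u * w) = P w - P 0 := by
      have := intervalIntegral.integral_eq_sub_of_hasDerivAt
        (f := fun u : ℝ => P (u * w)) (f' := fun u : ℝ => w * logDeriv γ (u * w)) (a := 0) (b := 1)
        ?_ ?_
      · simpa using this
      · intro u hu
        rw [uIcc_of_le zero_le_one] at hu
        have h1 := hP _ (hseg u hu)
        have h2 : HasDerivAt (fun u : ℂ => u * w) w (u : ℂ) := by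
          simpa using (hasDerivAt_id (u : ℂ)).mul_const w
        have := (h1.comp (u : ℂ) h2).comp_ofReal
        rw [mul_comm]
        exact this
      · apply ContinuousOn.intervalIntegrable
        rw [uIcc_of_le zero_le_one]
        refine continuousOn_const.mul ?_
        exact hlog.continuousOn.comp (by fun_prop) fun u hu => hseg u hu
    rw [logBranch, ← hint, intervalIntegral.integral_const_mul]
  have hev : logBranch γ =ᶠ[𝓝 s] fun w => Complex.log (γ 0) + (P w - P 0) := by
    filter_upwards [Metric.isOpen_ball.mem_nhds hRs] with w hw using key w hw
  refine HasDerivAt.congr_of_eventuallyEq ?_ hev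
  exact ((hP s hRs).sub_const _).const_add _

theorem logBranch_zero (γ : ℂ → ℂ) : logBranch γ 0 = Complex.log (γ 0) := by simp [logBranch]

theorem exp_logBranch {γ : ℂ → ℂ} {c : ℝ} (hc : 0 < c)
    (hd : DifferentiableOn ℂ γ {s | -c < s.re}) (h0 : ∀ s : ℂ, -c < s.re → γ s ≠ 0)
    {s : ℂ} (hs : -c < s.re) : Complex.exp (logBranch γ s) = γ s := by
  have hopen : IsOpen {s : ℂ | -c < s.re} := isOpen_lt continuous_const Complex.continuous_re
  have hconv : Convex ℝ {s : ℂ | -c < s.re} := convex_halfSpace_re_gt (-c)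
  have hder : ∀ w ∈ {s : ℂ | -c < s.re},
      HasDerivWithinAt (fun w => γ w * Complex.exp (-logBranch γ w)) 0 {s : ℂ | -c < s.re} w := by
    intro w hw
    have h1 := (hd.differentiableAt (hopen.mem_nhds hw)).hasDerivAt
    have h2 := (hasDerivAt_logBranch hc hd h0 hw).neg.cexp
    have h3 := h1.mul h2
    refine HasDerivAt.hasDerivWithinAt ?_
    refine h3.congr_deriv ?_
    rw [logDeriv_apply]
    have := h0 w hw
    field_simp
    ring
  have hconst := hconv.is_const_of_fderivWithin_eq_zero (𝕜 := ℂ)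
    (f := fun w => γ w * Complex.exp (-logBranch γ w))
    (fun w hw => (hder w hw).differentiableWithinAt)
    (fun w hw => by
      have := (hder w hw).hasFDerivWithinAt.fderivWithin (hopen.uniqueDiffWithinAt hw)
      rw [this]; ext; simp) (x := s) (y := 0) hs (by simpa using hc)
  have hz : γ 0 ≠ 0 := h0 0 (by simpa using hc)
  simp only [logBranch_zero, Complex.exp_neg, Complex.exp_log hz, mul_inv_cancel₀ hz] at hconst
  field_simp at hconst
  exact hconst.symm

/-- `logBranch γ` is the real logarithm on the real axis. -/
theorem logBranch_ofReal {γ : ℂ → ℂ} {c : ℝ} (hc : 0 < c)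
    (hd : DifferentiableOn ℂ γ {s | -c < s.re}) (h0 : ∀ s : ℂ, -c < s.re → γ s ≠ 0)
    (hreal : ∀ x : ℝ, -c < x → 0 < (γ (x : ℂ)).re ∧ (γ (x : ℂ)).im = 0)
    {x : ℝ} (hx : -c < x) : logBranch γ x = (Real.log (γ x).re : ℝ) := by
  have hopen : IsOpen {s : ℂ | -c < s.re} := isOpen_lt continuous_const Complex.continuous_re
  have hder : ∀ y ∈ Ioi (-c), HasDerivAt (fun y : ℝ => (logBranch γ y).im) 0 y := by
    intro y hy
    have hy' : -c < (y : ℂ).re := by simpa using hy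
    have h1 := ((hd.differentiableAt (hopen.mem_nhds hy')).hasDerivAt).comp_ofReal
    have h1i : HasDerivAt (fun y : ℝ => (γ y).im) (deriv γ y).im y := h1.complex_im
    have h1z : HasDerivAt (fun y : ℝ => (γ y).im) 0 y := by
      refine (hasDerivAt_const y (0 : ℝ)).congr_of_eventuallyEq ?_
      filter_upwards [isOpen_Ioi.mem_nhds hy] with u hu using (hreal u hu).2
    have him := h1i.unique h1z
    have h2 := (hasDerivAt_logBranch hc hd h0 hy').comp_ofReal
    have h2i : HasDerivAt (fun y : ℝ => (logBranch γ y).im) (logDeriv γ y).im y := h2.complex_im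
    refine h2i.congr_deriv ?_
    rw [logDeriv_apply, Complex.div_im, him, (hreal y hy).2]
    simp
  have him : (logBranch γ x).im = 0 := by
    have := (convex_Ioi (-c)).is_const_of_fderivWithin_eq_zero (𝕜 := ℝ)
      (f := fun y : ℝ => (logBranch γ y).im)
      (fun w hw => (hder w hw).differentiableAt.differentiableWithinAt)
      (fun w hw => by
        have := (hder w hw).hasDerivWithinAt.hasFDerivWithinAt.fderivWithin
          (isOpen_Ioi.uniqueDiffWithinAt hw)
        rw [this]; ext; simp) (x := x) (y := 0) hx (by simpa using hc)
    rw [this]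
    have hγ0 : γ 0 = ((γ 0).re : ℝ) := Complex.ext rfl (by simpa using (hreal 0 (by linarith)).2)
    rw [Complex.ofReal_zero, logBranch_zero, Complex.log_im, hγ0, Complex.arg_ofReal_of_nonneg]
    simpa using (hreal 0 (by linarith)).1.le
  have hex := exp_logBranch hc hd h0 (s := (x : ℂ)) (by simpa using hx)
  have hL : logBranch γ x = ((logBranch γ x).re : ℝ) := Complex.ext rfl (by simpa using him)
  rw [hL, ← Complex.ofReal_exp] at hex
  rw [← hex, Complex.ofReal_re, Real.log_exp, ← hL]

theorem hasDerivAt_logBranch_div {γ : ℂ → ℂ} {c : ℝ} (hc : 0 < c)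
    (hd : DifferentiableOn ℂ γ {s | -c < s.re}) (h0 : ∀ s : ℂ, -c < s.re → γ s ≠ 0)
    {s : ℂ} (hs : -c < s.re) (hs0 : s ≠ 0) :
    HasDerivAt (fun s => logBranch γ s / s) (weightEps γ s / s) s := by
  have h1 : DifferentiableAt ℂ (fun s => logBranch γ s / s) s :=
    (hasDerivAt_logBranch hc hd h0 hs).differentiableAt.div differentiableAt_id hs0
  have h2 : HasDerivAt (weightL γ) _ s := h1.hasDerivAt.cexp
  refine h1.hasDerivAt.congr_deriv ?_
  have := Complex.exp_ne_zero (logBranch γ s / s)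
  simp only [weightEps, h2.deriv, weightL]
  field_simp

/-! ### Asymptotics of the weight in the right half-plane -/

/-- The properties of an admissible weight that the proof uses, restricted to a half-plane
`Re s > -c`; here `B` is an upper bound and `l` the limit of `ε` on the positive ray, and `unif` says
that `ε` is asymptotic to its value on the positive ray, uniformly on right half-circles. The
constant in `doubling` stands for any number less than `2`; only the case `l = 0` uses it. -/
structure IsHalfPlaneWeight (γ : ℂ → ℂ) (c B l : ℝ) : Prop where
  pos : 0 < c
  diff : DifferentiableOn ℂ γ {s | -c < s.re}
  ne_zero : ∀ s : ℂ, -c < s.re → γ s ≠ 0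
  real : ∀ x : ℝ, -c < x → 0 < (γ (x : ℂ)).re ∧ (γ (x : ℂ)).im = 0
  eps_pos : ∀ ρ : ℝ, 0 < ρ → 0 < weightEpsReal γ ρ
  eps_le : ∀ ρ : ℝ, 0 < ρ → weightEpsReal γ ρ ≤ B
  integral : Tendsto (fun R : ℝ => ∫ ρ in (1 : ℝ)..R, weightEpsReal γ ρ / ρ) atTop atTop
  unif : ∀ κ : ℝ, 0 < κ → ∃ ρ₀ : ℝ, 0 < ρ₀ ∧ ∀ ρ ≥ ρ₀, ∀ ψ : ℝ, |ψ| ≤ Real.pi / 2 →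
    ‖weightEps γ (ρ * Complex.exp (ψ * Complex.I)) - weightEpsReal γ ρ‖ ≤ κ * weightEpsReal γ ρ
  doubling : ∀ᶠ ρ : ℝ in atTop, weightEpsReal γ ρ ≤ √2 * weightEpsReal γ (2 * ρ)
  lim : Tendsto (weightEpsReal γ) atTop (𝓝 l)
  lt_two : l < 2
  anti : l = 0 → ∃ ρ₀ : ℝ, AntitoneOn (weightEpsReal γ) (Ici ρ₀)

/-- On the positive ray `ε` is real. -/
theorem weightEps_ofReal {γ : ℂ → ℂ} {c : ℝ} (hc : 0 < c)
    (hd : DifferentiableOn ℂ γ {s | -c < s.re}) (h0 : ∀ s : ℂ, -c < s.re → γ s ≠ 0)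
    (hreal : ∀ x : ℝ, -c < x → 0 < (γ (x : ℂ)).re ∧ (γ (x : ℂ)).im = 0)
    {x : ℝ} (hx : 0 < x) : weightEps γ x = weightEpsReal γ x := by
  have h1 := (hasDerivAt_logBranch_div hc hd h0 (s := (x : ℂ))
    (by simp; linarith) (by exact_mod_cast hx.ne')).comp_ofReal.complex_im
  have h2 : HasDerivAt (fun y : ℝ => (logBranch γ y / y).im) 0 x := by
    refine (hasDerivAt_const x (0 : ℝ)).congr_of_eventuallyEq ?_
    filter_upwards [isOpen_Ioi.mem_nhds hx] with u hu
    have hu' : 0 < u := hu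
    rw [logBranch_ofReal hc hd h0 hreal (by linarith), ← Complex.ofReal_div, Complex.ofReal_im]
  have h3 := h1.unique h2
  rw [Complex.div_ofReal_im] at h3
  have h4 : (weightEps γ x).im = 0 := by
    rcases div_eq_zero_iff.1 h3 with h | h
    · exact h
    · exact absurd h hx.ne'
  exact Complex.ext rfl (by simpa using h4)

theorem IsAdmissible.exists_halfPlaneWeight {γ : ℂ → ℂ} (hγ : IsAdmissible γ) :
    ∃ c B l, IsHalfPlaneWeight γ c B l := by
  obtain ⟨c, α, hc, hα, -, han, hne, hreal, hpos, ⟨B, hB⟩, hA, hun, ⟨l, hl2, hl⟩, hD⟩ := hγ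
  have hsec : ∀ s : ℂ, -c < s.re → s ∈ sectorAt c α := by
    intro s hs
    have hre : 0 < (s + c).re := by simp; linarith
    refine ⟨fun h => by simp [h] at hre, ?_⟩
    exact (Complex.abs_arg_lt_pi_div_two_iff.2 (Or.inl hre)).trans hα
  have hd : DifferentiableOn ℂ γ {s | -c < s.re} := fun s hs =>
    (han s (hsec s hs)).differentiableAt.differentiableWithinAt
  have hn : ∀ s : ℂ, -c < s.re → γ s ≠ 0 := fun s hs => hne s (hsec s hs)
  refine ⟨c, B, l, hc, hd, hn, hreal, hpos, hB, hA, ?_, ?_, hl, hl2, ?_⟩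
  · intro κ hκ
    set S : Set ℂ := (fun ψ : ℝ => Complex.exp (ψ * Complex.I)) ''
      Icc (-(Real.pi / 2)) (Real.pi / 2) with hS
    have hScomp : IsCompact S := isCompact_Icc.image (by fun_prop)
    have hSsub : S ⊆ sectorAt 0 α := by
      rintro _ ⟨ψ, hψ, rfl⟩
      refine ⟨by simp, ?_⟩
      have hpi := Real.pi_pos
      simp only [Complex.ofReal_zero, add_zero]
      rw [Complex.arg_exp_mul_I, toIocMod_eq_self _ |>.2]
      · exact (abs_le.2 hψ).trans_lt hα
      · constructor <;> linarith [hψ.1, hψ.2]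
    have hU := (tendstoLocallyUniformlyOn_iff_tendstoUniformlyOn_of_compact hScomp).1
      (hun.mono hSsub)
    rw [Metric.tendstoUniformlyOn_iff] at hU
    obtain ⟨ρ₀, hρ₀⟩ := eventually_atTop.1 (hU κ hκ)
    refine ⟨max ρ₀ 1, by positivity, fun ρ hρ ψ hψ => ?_⟩
    have hρ0 : 0 < ρ := lt_of_lt_of_le one_pos ((le_max_right _ _).trans hρ)
    have h1 := hρ₀ ρ ((le_max_left _ _).trans hρ) (Complex.exp (ψ * Complex.I))
      ⟨ψ, abs_le.1 hψ, rfl⟩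
    rw [weightEps_ofReal hc hd hn hreal hρ0, dist_comm, dist_eq_norm, mul_comm] at h1
    have he := hpos ρ hρ0
    have he' : (weightEpsReal γ ρ : ℂ) ≠ 0 := by exact_mod_cast he.ne'
    have h2 : weightEps γ (ρ * Complex.exp (ψ * Complex.I)) - weightEpsReal γ ρ =
        (weightEps γ (ρ * Complex.exp (ψ * Complex.I)) / weightEpsReal γ ρ - 1) *
          weightEpsReal γ ρ := by field_simp
    rw [h2, norm_mul, Complex.norm_real, Real.norm_of_nonneg he.le]
    exact mul_le_mul_of_nonneg_right h1.le he.le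
  · have h2 : (2 : ℂ) ∈ sectorAt 0 α := by
      refine ⟨by norm_num, ?_⟩
      have : (2 : ℂ) + (0 : ℝ) = ((2 : ℝ) : ℂ) := by simp
      rw [this, Complex.arg_ofReal_of_nonneg (by norm_num)]
      simp only [abs_zero]
      linarith [Real.pi_pos]
    have hlt : 1 - (√2)⁻¹ > 0 := by
      rw [gt_iff_lt, sub_pos]
      exact inv_lt_one_of_one_lt₀ (Real.lt_sqrt_of_sq_lt (by norm_num))
    have h3 := Metric.tendsto_nhds.1 (hun.tendsto_at h2) _ hlt
    filter_upwards [h3, eventually_gt_atTop 0] with ρ hρ hρ0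
    have e1 : (2 : ℂ) * ρ = ((2 * ρ : ℝ) : ℂ) := by push_cast; ring
    rw [e1, weightEps_ofReal hc hd hn hreal hρ0, weightEps_ofReal hc hd hn hreal (by positivity),
      ← Complex.ofReal_div, ← Complex.ofReal_one, dist_eq_norm, ← Complex.ofReal_sub,
      Complex.norm_real, Real.norm_eq_abs] at hρ
    have h4 := (abs_lt.1 hρ).1
    have h5 : (√2)⁻¹ ≤ weightEpsReal γ (2 * ρ) / weightEpsReal γ ρ := by linarith
    rw [le_div_iff₀ (hpos ρ hρ0)] at h5
    have h6 := mul_le_mul_of_nonneg_left h5 (Real.sqrt_nonneg 2)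
    rwa [← mul_assoc, mul_inv_cancel₀ (by positivity), one_mul] at h6
  · intro hl0
    exact (hD (hl0 ▸ hl)).1

namespace IsHalfPlaneWeight

variable {γ : ℂ → ℂ} {c B l : ℝ}

/-- The function `log γ(x) / x` on the positive ray. -/
noncomputable def logRatio (γ : ℂ → ℂ) (x : ℝ) : ℝ := Real.log (γ (x : ℂ)).re / x

theorem logBranch_div_ofReal (H : IsHalfPlaneWeight γ c B l) {x : ℝ} (hx : 0 < x) :
    logBranch γ x / x = logRatio γ x := by
  rw [logBranch_ofReal H.pos H.diff H.ne_zero H.real (by linarith [H.pos]), logRatio,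
    Complex.ofReal_div]

theorem hasDerivAt_logRatio (H : IsHalfPlaneWeight γ c B l) {x : ℝ} (hx : 0 < x) :
    HasDerivAt (logRatio γ) (weightEpsReal γ x / x) x := by
  have hc := H.pos
  have h1 := (hasDerivAt_logBranch_div H.pos H.diff H.ne_zero (s := (x : ℂ))
    (by simp; linarith) (by exact_mod_cast hx.ne')).comp_ofReal.complex_re
  rw [Complex.div_ofReal_re] at h1
  refine h1.congr_of_eventuallyEq ?_
  filter_upwards [isOpen_Ioi.mem_nhds hx] with u hu
  have hu' : 0 < u := hu
  rw [H.logBranch_div_ofReal hu', Complex.ofReal_re]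

theorem logRatio_mono (H : IsHalfPlaneWeight γ c B l) {x y : ℝ} (hx : 0 < x) (hxy : x ≤ y) :
    logRatio γ x ≤ logRatio γ y := by
  refine monotoneOn_of_hasDerivWithinAt_nonneg (convex_Ioi (0 : ℝ)) (f := logRatio γ)
    (f' := fun x => weightEpsReal γ x / x)
    (fun z hz => (H.hasDerivAt_logRatio hz).continuousAt.continuousWithinAt) ?_ ?_ hx
    (lt_of_lt_of_le hx hxy) hxy
  · intro z hz
    rw [interior_Ioi] at hz
    exact (H.hasDerivAt_logRatio hz).hasDerivWithinAt
  · intro z hz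
    rw [interior_Ioi] at hz
    exact div_nonneg (H.eps_pos z hz).le (le_of_lt hz)

theorem logRatio_sub_le (H : IsHalfPlaneWeight γ c B l) {x y : ℝ} (hx : 0 < x) (hxy : x ≤ y) :
    logRatio γ y - logRatio γ x ≤ B * (Real.log y - Real.log x) := by
  have hd : ∀ z : ℝ, 0 < z → HasDerivAt (fun z => B * Real.log z - logRatio γ z)
      (B * z⁻¹ - weightEpsReal γ z / z) z := fun z hz =>
    ((Real.hasDerivAt_log hz.ne').const_mul B).sub (H.hasDerivAt_logRatio hz)
  have := monotoneOn_of_hasDerivWithinAt_nonneg (convex_Ioi (0 : ℝ))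
    (f := fun z => B * Real.log z - logRatio γ z)
    (f' := fun z => B * z⁻¹ - weightEpsReal γ z / z)
    (fun z hz => (hd z hz).continuousAt.continuousWithinAt) ?_ ?_ hx
    (lt_of_lt_of_le hx hxy) hxy
  · simp only at this
    linarith
  · intro z hz
    rw [interior_Ioi] at hz
    exact (hd z hz).hasDerivWithinAt
  · intro z hz
    rw [interior_Ioi] at hz
    have hz' : 0 < z := hz
    have := H.eps_le z hz
    rw [← div_eq_mul_inv, ← sub_div]
    exact div_nonneg (by linarith) hz'.le

theorem B_pos (H : IsHalfPlaneWeight γ c B l) : 0 < B :=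
  (H.eps_pos 1 one_pos).trans_le (H.eps_le 1 one_pos)

theorem tendsto_logRatio (H : IsHalfPlaneWeight γ c B l) :
    Tendsto (logRatio γ) atTop atTop := by
  have h := tendsto_atTop_add_const_right atTop (logRatio γ 1) H.integral
  refine h.congr' ?_
  filter_upwards [eventually_ge_atTop 1] with R hR
  have hpos : ∀ x ∈ uIcc 1 R, 0 < x := by
    intro x hx
    rw [uIcc_of_le hR] at hx
    linarith [hx.1]
  rw [intervalIntegral.integral_eq_sub_of_hasDerivAt
    (fun x hx => H.hasDerivAt_logRatio (hpos x hx))]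
  · ring
  · refine intervalIntegral.intervalIntegrable_deriv_of_nonneg
      (fun x hx => (H.hasDerivAt_logRatio (hpos x hx)).continuousAt.continuousWithinAt)
      (fun x hx => H.hasDerivAt_logRatio ?_) fun x hx => ?_
    all_goals
      rw [min_eq_left hR, max_eq_right hR] at hx
      have hx0 : 0 < x := by linarith [hx.1]
    · exact hx0
    · exact div_nonneg (H.eps_pos x hx0).le hx0.le

theorem lim_nonneg (H : IsHalfPlaneWeight γ c B l) : 0 ≤ l :=
  ge_of_tendsto H.lim (by
    filter_upwards [eventually_gt_atTop 0] with x hx using (H.eps_pos x hx).le)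

theorem norm_eq_exp (H : IsHalfPlaneWeight γ c B l) {s : ℂ} (hs : -c < s.re) :
    ‖γ s‖ = Real.exp (logBranch γ s).re := by
  rw [← exp_logBranch H.pos H.diff H.ne_zero hs, Complex.norm_exp]

/-- Comparison of `log γ(s) / s` with its value at `|s|`, by integrating `ε` along an arc. -/
theorem norm_logBranch_div_sub_le (H : IsHalfPlaneWeight γ c B l) {ρ τ κ : ℝ} {e : ℂ}
    (hρ : 0 < ρ) (hτ : |τ| ≤ Real.pi / 2)
    (he : ∀ ψ : ℝ, |ψ| ≤ Real.pi / 2 →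
      ‖weightEps γ (ρ * Complex.exp (ψ * Complex.I)) - e‖ ≤ κ) :
    ‖logBranch γ (ρ * Complex.exp (τ * Complex.I)) / (ρ * Complex.exp (τ * Complex.I)) -
      logRatio γ ρ - τ * Complex.I * e‖ ≤ κ * |τ| := by
  set p : ℝ → ℂ := fun ψ => ρ * Complex.exp (ψ * Complex.I) with hp
  have hρ' : (ρ : ℂ) ≠ 0 := by exact_mod_cast hρ.ne'
  have hp0 : ∀ ψ, p ψ ≠ 0 := fun ψ => mul_ne_zero hρ' (Complex.exp_ne_zero _)
  have hre : ∀ ψ ∈ Icc (-(Real.pi / 2)) (Real.pi / 2), -c < (p ψ).re := by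
    intro ψ hψ
    have : (p ψ).re = ρ * Real.cos ψ := by
      simp [hp, Complex.exp_ofReal_mul_I_re]
    rw [this]
    have := mul_nonneg hρ.le (Real.cos_nonneg_of_mem_Icc hψ)
    linarith [H.pos]
  have hpd : ∀ ψ, HasDerivAt p (p ψ * Complex.I) ψ := by
    intro ψ
    have h1 : HasDerivAt (fun z : ℂ => (ρ : ℂ) * Complex.exp (z * Complex.I))
        (ρ * (Complex.exp (ψ * Complex.I) * (1 * Complex.I))) (ψ : ℂ) :=
      (((hasDerivAt_id (ψ : ℂ)).mul_const Complex.I).cexp).const_mul _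
    refine h1.comp_ofReal.congr_deriv ?_
    simp only [hp]; ring
  have hder : ∀ ψ ∈ Icc (-(Real.pi / 2)) (Real.pi / 2),
      HasDerivWithinAt (fun ψ => logBranch γ (p ψ) / p ψ - ψ * Complex.I * e)
        (Complex.I * (weightEps γ (p ψ) - e)) (Icc (-(Real.pi / 2)) (Real.pi / 2)) ψ := by
    intro ψ hψ
    have h1 := (hasDerivAt_logBranch_div H.pos H.diff H.ne_zero (hre ψ hψ) (hp0 ψ))
    have h2 := h1.comp ψ (hpd ψ)
    have h3 : HasDerivAt (fun ψ : ℝ => (ψ : ℂ) * Complex.I * e) (1 * Complex.I * e) ψ :=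
      (((hasDerivAt_id (ψ : ℂ)).mul_const Complex.I).mul_const e).comp_ofReal
    refine ((h2.sub h3).congr_deriv ?_).hasDerivWithinAt
    have := hp0 ψ
    field_simp
  have hmem : (0 : ℝ) ∈ Icc (-(Real.pi / 2)) (Real.pi / 2) := by
    have := Real.pi_pos
    constructor <;> linarith
  have := (convex_Icc (-(Real.pi / 2)) (Real.pi / 2)).norm_image_sub_le_of_norm_hasDerivWithin_le
    hder (C := κ) (fun ψ hψ => by
      rw [norm_mul, Complex.norm_I, one_mul]; exact he ψ (abs_le.2 hψ)) hmem (abs_le.1 hτ)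
  simp only [hp, Complex.ofReal_zero, zero_mul, Complex.exp_zero, mul_one, sub_zero,
    H.logBranch_div_ofReal hρ, Real.norm_eq_abs] at this
  rw [sub_right_comm]
  exact this

/-- The modulus of `γ` in the closed right half-plane, in terms of its values on the positive
ray: `log |γ(s)| ≈ Re s * log γ(|s|) / |s| - Im s * arg s * e` if `ε ≈ e` on the half-circle
through `s`. -/
theorem abs_log_norm_sub_le (H : IsHalfPlaneWeight γ c B l) {s : ℂ} {κ e : ℝ}
    (hs : 0 ≤ s.re) (hs0 : s ≠ 0)
    (he : ∀ ψ : ℝ, |ψ| ≤ Real.pi / 2 →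
      ‖weightEps γ (‖s‖ * Complex.exp (ψ * Complex.I)) - e‖ ≤ κ) :
    |Real.log ‖γ s‖ - (s.re * logRatio γ ‖s‖ - s.im * Complex.arg s * e)|
      ≤ ‖s‖ * (κ * |Complex.arg s|) := by
  have h1 := H.norm_logBranch_div_sub_le (norm_pos_iff.2 hs0)
    (Complex.abs_arg_le_pi_div_two_iff.2 hs) he
  rw [Complex.norm_mul_exp_arg_mul_I] at h1
  set r := logBranch γ s / s - logRatio γ ‖s‖ - Complex.arg s * Complex.I * e with hr
  have h2 : logBranch γ s = s * (logRatio γ ‖s‖ + Complex.arg s * Complex.I * e) + s * r := by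
    rw [hr]; field_simp; ring
  rw [H.norm_eq_exp (by linarith [H.pos]), Real.log_exp, h2]
  have h3 : (s * (logRatio γ ‖s‖ + Complex.arg s * Complex.I * e) + s * r).re -
      (s.re * logRatio γ ‖s‖ - s.im * Complex.arg s * e) = (s * r).re := by
    simp [Complex.add_re, Complex.mul_re, Complex.mul_im]
    ring
  rw [h3]
  calc |(s * r).re| ≤ ‖s * r‖ := Complex.abs_re_le_norm _
    _ = ‖s‖ * ‖r‖ := norm_mul _ _
    _ ≤ _ := by gcongr

theorem eps_near (H : IsHalfPlaneWeight γ c B l) {κ : ℝ} (hκ : 0 < κ) :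
    ∃ ρ₀ : ℝ, 0 < ρ₀ ∧ ∀ ρ ≥ ρ₀, ∀ ψ : ℝ, |ψ| ≤ Real.pi / 2 →
      ‖weightEps γ (ρ * Complex.exp (ψ * Complex.I)) - (l : ℝ)‖ ≤ κ := by
  have hB := H.B_pos
  obtain ⟨ρ₁, hρ₁, h1⟩ := H.unif (κ / (2 * B)) (by positivity)
  obtain ⟨ρ₂, h2⟩ := eventually_atTop.1 ((Metric.tendsto_nhds.1 H.lim) (κ / 2) (by positivity))
  refine ⟨max ρ₁ ρ₂, lt_max_of_lt_left hρ₁, fun ρ hρ ψ hψ => ?_⟩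
  have hρ0 : 0 < ρ := hρ₁.trans_le ((le_max_left _ _).trans hρ)
  have h3 := h1 ρ ((le_max_left _ _).trans hρ) ψ hψ
  have h4 := h2 ρ ((le_max_right _ _).trans hρ)
  have h5 : κ / (2 * B) * weightEpsReal γ ρ ≤ κ / 2 := by
    calc κ / (2 * B) * weightEpsReal γ ρ ≤ κ / (2 * B) * B := by gcongr; exact H.eps_le ρ hρ0
      _ = κ / 2 := by field_simp
  have h6 : ‖(weightEpsReal γ ρ : ℂ) - (l : ℝ)‖ ≤ κ / 2 := by
    rw [← Complex.ofReal_sub, Complex.norm_real, ← dist_eq_norm]; exact h4.le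
  have h7 := norm_sub_le_norm_sub_add_norm_sub
    (weightEps γ (ρ * Complex.exp (ψ * Complex.I))) (weightEpsReal γ ρ) (l : ℂ)
  linarith

theorem continuousOn_norm (H : IsHalfPlaneWeight γ c B l) :
    ContinuousOn (fun s => ‖γ s‖) {s | -c < s.re} := H.diff.continuousOn.norm

theorem exists_log_norm_near (H : IsHalfPlaneWeight γ c B l) {κ : ℝ} (hκ : 0 < κ) :
    ∃ ρ₀ : ℝ, 1 ≤ ρ₀ ∧ ∀ s : ℂ, 0 ≤ s.re → ρ₀ ≤ ‖s‖ →
      |Real.log ‖γ s‖ - (s.re * logRatio γ ‖s‖ - |s.im| * |Complex.arg s| * l)|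
      ≤ κ * (s.re + |s.im|) := by
  have hpi := Real.pi_pos
  obtain ⟨ρ₁, hρ₁, h1⟩ := H.eps_near (κ := κ / 2) (by positivity)
  refine ⟨max ρ₁ 1, le_max_right _ _, fun s hs hρ => ?_⟩
  have hs0 : s ≠ 0 := norm_pos_iff.1 (one_pos.trans_le ((le_max_right _ _).trans hρ))
  have h2 := H.abs_log_norm_sub_le hs hs0 (h1 _ ((le_max_left _ _).trans hρ))
  have h3 : s.im * Complex.arg s = |s.im| * |Complex.arg s| := by
    rw [← abs_mul, abs_of_nonneg]
    rcases le_total 0 s.im with h | h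
    · exact mul_nonneg h (Complex.arg_nonneg_iff.2 h)
    · rcases h.lt_or_eq with h | h
      · exact mul_nonneg_of_nonpos_of_nonpos h.le (Complex.arg_neg_iff.2 h).le
      · simp [h]
  rw [h3] at h2
  refine h2.trans ?_
  have h4 := Complex.norm_le_abs_re_add_abs_im s
  rw [abs_of_nonneg hs] at h4
  have h5 := Complex.abs_arg_le_pi_div_two_iff.2 hs
  have h6 : |Complex.arg s| ≤ 2 := by linarith [Real.pi_lt_four]
  calc ‖s‖ * (κ / 2 * |s.arg|) ≤ (s.re + |s.im|) * (κ / 2 * 2) := by gcongr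
    _ = _ := by ring

/-- Lower bound for `γ` on the strip `0 ≤ Re s ≤ 1`. -/
theorem exists_le_norm (H : IsHalfPlaneWeight γ c B l) {β : ℝ} (hβ : Real.pi / 2 * l < β) :
    ∃ C : ℝ, 0 < C ∧ ∀ s : ℂ, 0 ≤ s.re → s.re ≤ 1 → C * Real.exp (-β * |s.im|) ≤ ‖γ s‖ := by
  have hl := H.lim_nonneg
  have hpi := Real.pi_pos
  set κ := β - Real.pi / 2 * l with hκd
  have hκ : 0 < κ := by linarith
  have hβ0 : 0 ≤ β := by nlinarith [mul_nonneg hpi.le hl]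
  obtain ⟨ρ₀, hρ₀, h1⟩ := H.exists_log_norm_near hκ
  set K : Set ℂ := Metric.closedBall 0 ρ₀ ∩ {s : ℂ | 0 ≤ s.re} with hK
  have hKc : IsCompact K := (isCompact_closedBall 0 ρ₀).inter_right
    (isClosed_le continuous_const Complex.continuous_re)
  have hKsub : K ⊆ {s | -c < s.re} := fun s hs =>
    lt_of_lt_of_le (neg_lt_zero.2 H.pos) hs.2
  have hKne : K.Nonempty := ⟨0, by simp [hK]; linarith⟩
  obtain ⟨s₀, hs₀, hmin⟩ := hKc.exists_isMinOn hKne (H.continuousOn_norm.mono hKsub)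
  have hC1 : 0 < ‖γ s₀‖ := norm_pos_iff.2 (H.ne_zero s₀ (hKsub hs₀))
  refine ⟨min ‖γ s₀‖ (Real.exp (-|logRatio γ 1| - κ)), lt_min hC1 (Real.exp_pos _),
    fun s hs hs1 => ?_⟩
  rcases le_total ‖s‖ ρ₀ with h | h
  · have h2 : ‖γ s₀‖ ≤ ‖γ s‖ := hmin ⟨by simpa using h, hs⟩
    have h3 : Real.exp (-β * |s.im|) ≤ 1 := Real.exp_le_one_iff.2 (by
      have := mul_nonneg hβ0 (abs_nonneg s.im); linarith)
    calc _ ≤ ‖γ s₀‖ * 1 := by gcongr; exact min_le_left _ _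
      _ ≤ _ := by simpa using h2
  · have hne : γ s ≠ 0 := H.ne_zero s (lt_of_lt_of_le (neg_lt_zero.2 H.pos) hs)
    have h2 := (abs_le.1 (h1 s hs h)).1
    have h3 := H.logRatio_mono one_pos (hρ₀.trans h)
    have h4 := Complex.abs_arg_le_pi_div_two_iff.2 hs
    have h5 : -|logRatio γ 1| ≤ s.re * logRatio γ ‖s‖ := by
      have h6 := neg_abs_le (logRatio γ 1)
      have h7 := abs_nonneg (logRatio γ 1)
      nlinarith
    have h6 : |s.im| * |Complex.arg s| * l ≤ |s.im| * (Real.pi / 2) * l := by gcongr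
    calc _ ≤ Real.exp (-|logRatio γ 1| - κ) * Real.exp (-β * |s.im|) := by
          gcongr; exact min_le_right _ _
      _ = Real.exp (-|logRatio γ 1| - κ - β * |s.im|) := by rw [← Real.exp_add]; ring_nf
      _ ≤ Real.exp (Real.log ‖γ s‖) := by
          refine Real.exp_le_exp.2 ?_
          have : β = κ + Real.pi / 2 * l := by rw [hκd]; ring
          rw [this]
          nlinarith
      _ = _ := Real.exp_log (norm_pos_iff.2 hne)

theorem log_weight_eq {x : ℝ} (hx : 0 < x) : Real.log (γ (x : ℂ)).re = x * logRatio γ x := by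
  rw [logRatio]; field_simp

theorem weight_eq_exp (H : IsHalfPlaneWeight γ c B l) {x : ℝ} (hx : 0 < x) :
    (γ (x : ℂ)).re = Real.exp (x * logRatio γ x) := by
  rw [← log_weight_eq hx, Real.exp_log (H.real x (by linarith [H.pos])).1]

/-- The elementary inequality `b * cos b ≤ sin b`, with `b` the angle between `s` and the imaginary
axis. -/
theorem pi_div_two_sub_abs_arg_mul_le {s : ℂ} (hs : 0 ≤ s.re) :
    (Real.pi / 2 - |Complex.arg s|) * |s.im| ≤ s.re := by
  rcases eq_or_ne s 0 with rfl | hs0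
  · simp
  have ha := Complex.abs_arg_le_pi_div_two_iff.2 hs
  set b := Real.pi / 2 - |Complex.arg s| with hb
  have hb0 : 0 ≤ b := by linarith
  have hbpi : b ≤ Real.pi / 2 := by linarith [abs_nonneg (Complex.arg s)]
  have h1 : |s.im| = ‖s‖ * Real.cos b := by
    rw [hb, Real.cos_pi_div_two_sub, ← Complex.norm_mul_sin_arg, abs_mul,
      abs_of_nonneg (norm_nonneg s), Real.abs_sin_eq_sin_abs_of_abs_le_pi]
    linarith [Real.pi_pos]
  have h2 : s.re = ‖s‖ * Real.sin b := by
    rw [hb, Real.sin_pi_div_two_sub, Real.cos_abs, Complex.norm_mul_cos_arg]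
  have h3 : b * Real.cos b ≤ Real.sin b := by
    rcases hbpi.lt_or_eq with h | h
    · have hc := Real.cos_pos_of_mem_Ioo ⟨by linarith [Real.pi_pos], h⟩
      have := Real.le_tan hb0 h
      rwa [Real.tan_eq_sin_div_cos, le_div_iff₀ hc] at this
    · rw [h]; simp
  rw [h1, h2]
  calc b * (‖s‖ * Real.cos b) = ‖s‖ * (b * Real.cos b) := by ring
    _ ≤ _ := by gcongr

/-- Upper bound for `γ` on vertical lines in the right half-plane, relative to its values on the
positive ray. The factor `log γ(|s|) / |s|` in `log |γ(s)|` is replaced by its value at `Re s + 1`,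
which costs at most `B * log (|s| / (Re s + 1))`; by concavity of the logarithm this is absorbed
by an arbitrarily small multiple of `|Im s|` and a large multiple of `Re s`. -/
theorem exists_norm_le (H : IsHalfPlaneWeight γ c B l) {θ : ℝ} (hθ0 : 0 ≤ θ)
    (hθ : θ < Real.pi / 2 * l) :
    ∃ C A : ℝ, 0 < C ∧ 0 < A ∧ ∀ s : ℂ, 0 ≤ s.re →
      ‖γ s‖ ≤ C * Real.exp (A * s.re) * (γ ((s.re + 1 : ℝ) : ℂ)).re *
        Real.exp (-θ * |s.im|) := by
  have hl := H.lim_nonneg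
  have hB := H.B_pos
  have hpi := Real.pi_pos
  set κ := (Real.pi / 2 * l - θ) / (B + 1) with hκd
  have hκ : 0 < κ := div_pos (by linarith) (by linarith)
  have hκB : κ * (B + 1) = Real.pi / 2 * l - θ := by rw [hκd]; field_simp
  obtain ⟨ρ₀, hρ₀, h1⟩ := H.exists_log_norm_near hκ
  set K : Set ℂ := Metric.closedBall 0 ρ₀ ∩ {s : ℂ | 0 ≤ s.re} with hK
  have hKc : IsCompact K := (isCompact_closedBall 0 ρ₀).inter_right
    (isClosed_le continuous_const Complex.continuous_re)
  have hKsub : K ⊆ {s | -c < s.re} := fun s hs =>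
    lt_of_lt_of_le (neg_lt_zero.2 H.pos) hs.2
  obtain ⟨C₁, hC₁⟩ := hKc.exists_bound_of_continuousOn (H.continuousOn_norm.mono hKsub)
  set q := |logRatio γ 1| with hq
  have hq0 : 0 ≤ q := abs_nonneg _
  set D := |κ - 1 - Real.log κ| with hD
  have hD0 : 0 ≤ D := abs_nonneg _
  refine ⟨max (|C₁| * Real.exp (q * (ρ₀ + 1) + θ * ρ₀)) (Real.exp q), B * D + l + κ + 1,
    lt_max_of_lt_right (Real.exp_pos _), by positivity, fun s hs => ?_⟩
  have hσ1 : 0 < s.re + 1 := by linarith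
  have hlow := H.logRatio_mono one_pos (show 1 ≤ s.re + 1 by linarith)
  have hqle : -q ≤ logRatio γ 1 := neg_abs_le _
  rw [H.weight_eq_exp hσ1]
  rcases le_total ‖s‖ ρ₀ with h | h
  · have h2 : ‖γ s‖ ≤ |C₁| := by
      have := hC₁ s ⟨by simpa using h, hs⟩
      rw [norm_norm] at this
      exact this.trans (le_abs_self _)
    have hre : s.re ≤ ρ₀ := (Complex.re_le_norm s).trans h
    have him : |s.im| ≤ ρ₀ := (Complex.abs_im_le_norm s).trans h
    have hA : 0 ≤ (B * D + l + κ + 1) * s.re := by positivity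
    calc ‖γ s‖ ≤ |C₁| * 1 := by simpa using h2
      _ ≤ |C₁| * Real.exp (q * (ρ₀ + 1) + θ * ρ₀ + (B * D + l + κ + 1) * s.re +
          (s.re + 1) * logRatio γ (s.re + 1) + -θ * |s.im|) := by
        gcongr
        rw [Real.one_le_exp_iff]
        have e1 : θ * |s.im| ≤ θ * ρ₀ := by gcongr
        have e2 : -(q * (ρ₀ + 1)) ≤ (s.re + 1) * logRatio γ (s.re + 1) := by
          have : q * (s.re + 1) ≤ q * (ρ₀ + 1) := by gcongr
          nlinarith
        linarith
      _ = |C₁| * Real.exp (q * (ρ₀ + 1) + θ * ρ₀) * Real.exp ((B * D + l + κ + 1) * s.re) *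
          Real.exp ((s.re + 1) * logRatio γ (s.re + 1)) * Real.exp (-θ * |s.im|) := by
        simp only [Real.exp_add]; ring
      _ ≤ _ := by gcongr; exact le_max_left _ _
  · have hne : γ s ≠ 0 := H.ne_zero s (lt_of_lt_of_le (neg_lt_zero.2 H.pos) hs)
    have hsn : 0 < ‖s‖ := by linarith
    have h2 := (abs_le.1 (h1 s hs h)).2
    have h3 : Real.pi / 2 * |s.im| - s.re ≤ |s.im| * |Complex.arg s| := by
      have := pi_div_two_sub_abs_arg_mul_le hs
      linarith
    have h4 : Real.pi / 2 * l * |s.im| - l * s.re ≤ |s.im| * |Complex.arg s| * l := by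
      have := mul_le_mul_of_nonneg_right h3 hl
      linarith
    have h5 : s.re * (logRatio γ ‖s‖ - logRatio γ (s.re + 1)) ≤ B * (κ * |s.im| + D * s.re) := by
      rcases le_total ‖s‖ (s.re + 1) with h6 | h6
      · have := H.logRatio_mono hsn h6
        have h7 : s.re * (logRatio γ ‖s‖ - logRatio γ (s.re + 1)) ≤ 0 :=
          mul_nonpos_of_nonneg_of_nonpos hs (by linarith)
        have : 0 ≤ B * (κ * |s.im| + D * s.re) := by positivity
        linarith
      · have h7 := H.logRatio_sub_le hσ1 h6
        -- `log u ≤ κ u - 1 - log κ`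
        have h8 : Real.log ‖s‖ - Real.log (s.re + 1) ≤ κ * (|s.im| / (s.re + 1)) + D := by
          rw [← Real.log_div hsn.ne' hσ1.ne']
          have e1 : ‖s‖ / (s.re + 1) ≤ 1 + |s.im| / (s.re + 1) := by
            have e2 := Complex.norm_le_abs_re_add_abs_im s
            rw [abs_of_nonneg hs] at e2
            rw [div_le_iff₀ hσ1]
            field_simp
            linarith
          have e3 := Real.log_le_sub_one_of_pos (x := κ * (‖s‖ / (s.re + 1))) (by positivity)
          rw [Real.log_mul hκ.ne' (by positivity)] at e3
          have e4 := mul_le_mul_of_nonneg_left e1 hκ.le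
          have e5 := le_abs_self (κ - 1 - Real.log κ)
          linarith
        have h9 : s.re * (|s.im| / (s.re + 1)) ≤ |s.im| := by
          rw [mul_div_assoc', div_le_iff₀ hσ1]
          nlinarith [abs_nonneg s.im]
        calc s.re * (logRatio γ ‖s‖ - logRatio γ (s.re + 1))
            ≤ s.re * (B * (κ * (|s.im| / (s.re + 1)) + D)) := by
              gcongr
              exact h7.trans (by gcongr)
          _ = B * (κ * (s.re * (|s.im| / (s.re + 1))) + D * s.re) := by ring
          _ ≤ _ := by gcongr
    calc ‖γ s‖ = Real.exp (Real.log ‖γ s‖) := (Real.exp_log (norm_pos_iff.2 hne)).symm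
      _ ≤ Real.exp (q + (B * D + l + κ + 1) * s.re + (s.re + 1) * logRatio γ (s.re + 1)
          + -θ * |s.im|) := by
        refine Real.exp_le_exp.2 ?_
        have hθe : θ = Real.pi / 2 * l - κ * (B + 1) := by rw [hκB]; ring
        rw [hθe]
        nlinarith [abs_nonneg s.im]
      _ = Real.exp q * Real.exp ((B * D + l + κ + 1) * s.re) *
          Real.exp ((s.re + 1) * logRatio γ (s.re + 1)) * Real.exp (-θ * |s.im|) := by
        simp only [Real.exp_add]
      _ ≤ _ := by gcongr; exact le_max_right _ _

end IsHalfPlaneWeight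

/-! ### The sequence `gammaHat` -/

theorem Real.pow_mul_exp_neg_mul_le (n : ℕ) {θ x : ℝ} (hθ : 0 < θ) (hx : 0 ≤ x) :
    x ^ n * Real.exp (-θ * x) ≤ n ! / θ ^ n := by
  have h := Real.pow_div_factorial_le_exp (θ * x) (by positivity) n
  rw [neg_mul, Real.exp_neg, le_div_iff₀ (by positivity), ← div_eq_mul_inv, div_mul_eq_mul_div,
    div_le_iff₀ (Real.exp_pos _), ← mul_pow, mul_comm x]
  rw [div_le_iff₀ (by positivity)] at h
  linarith

namespace IsHalfPlaneWeight

variable {γ : ℂ → ℂ} {c B l : ℝ}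

/-- If `ε` tends to `0`, it does so slowly: since `√ρ * ε(ρ)` does not decrease when `ρ` is doubled,
`ε(ρ)` is at least a multiple of `ρ ^ (-1 / 2)`. -/
theorem exists_le_eps (H : IsHalfPlaneWeight γ c B l) (hl : l = 0) :
    ∃ r ρ₀ : ℝ, 0 < r ∧ 0 < ρ₀ ∧ ∀ ρ ≥ ρ₀, r * √ρ ≤ ρ * weightEpsReal γ ρ := by
  obtain ⟨ρ₁, h1⟩ := H.anti hl
  obtain ⟨ρ₂, h2⟩ := eventually_atTop.1 H.doubling
  set ρ₀ := max 1 (max ρ₁ ρ₂) with hρ₀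
  have hpos : 0 < ρ₀ := lt_max_of_lt_left one_pos
  have hstep : ∀ k : ℕ, √ρ₀ * weightEpsReal γ ρ₀ ≤
      √(2 ^ k * ρ₀) * weightEpsReal γ (2 ^ k * ρ₀) := by
    intro k
    induction k with
    | zero => simp
    | succ k ih =>
      refine ih.trans ?_
      have h3 : ρ₂ ≤ 2 ^ k * ρ₀ := by
        have : ρ₂ ≤ ρ₀ := (le_max_right _ _).trans (le_max_right _ _)
        have h4 : (1 : ℝ) ≤ 2 ^ k := one_le_pow₀ (by norm_num)
        nlinarith
      have h4 := h2 _ h3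
      have e1 : (2 : ℝ) ^ (k + 1) * ρ₀ = 2 * (2 ^ k * ρ₀) := by ring
      rw [e1, Real.sqrt_mul (show (0 : ℝ) ≤ 2 by norm_num)]
      calc _ ≤ √(2 ^ k * ρ₀) * (√2 * weightEpsReal γ (2 * (2 ^ k * ρ₀))) := by gcongr
        _ = _ := by ring
  refine ⟨√ρ₀ * weightEpsReal γ ρ₀ / √2, ρ₀,
    by have := H.eps_pos ρ₀ hpos; positivity, hpos, fun ρ hρ => ?_⟩
  have hρ0 : 0 < ρ := hpos.trans_le hρ
  obtain ⟨k, hk1, hk2⟩ := exists_nat_pow_near (show 1 ≤ ρ / ρ₀ by rwa [one_le_div hpos])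
    (show (1 : ℝ) < 2 by norm_num)
  rw [le_div_iff₀ hpos] at hk1
  rw [div_lt_iff₀ hpos] at hk2
  have hge : ρ₁ ≤ ρ := ((le_max_left _ _).trans (le_max_right _ _)).trans hρ
  have h3 := h1 hge (hge.trans hk2.le) hk2.le
  have h4 := hstep (k + 1)
  have h5 : √(2 ^ (k + 1) * ρ₀) ≤ √2 * √ρ := by
    rw [← Real.sqrt_mul (by norm_num)]
    apply Real.sqrt_le_sqrt
    rw [pow_succ]; linarith
  have h6 := (H.eps_pos ρ hρ0).le
  have h7 : √ρ₀ * weightEpsReal γ ρ₀ ≤ √2 * √ρ * weightEpsReal γ ρ :=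
    h4.trans (mul_le_mul h5 h3 (H.eps_pos _ (by positivity)).le (by positivity))
  rw [div_mul_eq_mul_div, div_le_iff₀ (by positivity)]
  calc √ρ₀ * weightEpsReal γ ρ₀ * √ρ ≤ √2 * √ρ * weightEpsReal γ ρ * √ρ := by gcongr
    _ = (√ρ * √ρ) * weightEpsReal γ ρ * √2 := by ring
    _ = _ := by rw [Real.mul_self_sqrt hρ0.le]

theorem norm_I_mul_le (H : IsHalfPlaneWeight γ c B l) {θ : ℝ} (hθ0 : 0 ≤ θ)
    (hθ : θ < Real.pi / 2 * l) :
    ∃ C : ℝ, 0 < C ∧ ∀ ρ : ℝ, 0 < ρ → ‖γ (Complex.I * ρ)‖ ≤ C * Real.exp (-θ * ρ) := by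
  obtain ⟨C, A, hC, -, h⟩ := H.exists_norm_le hθ0 hθ
  refine ⟨C * (γ ((1 : ℝ) : ℂ)).re,
    mul_pos hC (H.real 1 (by linarith [H.pos])).1, fun ρ hρ => ?_⟩
  have := h (Complex.I * ρ) (by simp)
  simpa [abs_of_pos hρ] using this

/-- The supremum defining `gammaHat` is finite: on the imaginary axis `γ` decays exponentially if
`l > 0`, and at least like `exp (-a * √ρ)` if `l = 0`. -/
theorem bddAbove_gammaHat (H : IsHalfPlaneWeight γ c B l) (n : ℕ) :
    BddAbove (range fun ρ : Ioi (0 : ℝ) => (ρ : ℝ) ^ n * ‖γ (Complex.I * ((ρ : ℝ) : ℂ))‖) := by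
  have hpi := Real.pi_pos
  rcases H.lim_nonneg.eq_or_lt with hl | hl
  · obtain ⟨r, ρ₁, hr, hρ₁, h1⟩ := H.exists_le_eps hl.symm
    obtain ⟨ρ₂, hρ₂, h2⟩ := H.unif (1 / 2) (by norm_num)
    set ρ₀ := max ρ₁ ρ₂ with hρ₀
    have hKc : IsCompact (Icc 0 ρ₀) := isCompact_Icc
    obtain ⟨C₁, hC₁⟩ := hKc.exists_bound_of_continuousOn
      (f := fun ρ : ℝ => (ρ : ℝ) ^ n * ‖γ (Complex.I * (ρ : ℂ))‖) (by
        refine (by fun_prop : ContinuousOn (fun ρ : ℝ => ρ ^ n) _).mul ?_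
        refine H.continuousOn_norm.comp (by fun_prop) fun ρ _ => ?_
        simpa using H.pos)
    set a := Real.pi / 4 * r with ha
    refine ⟨max C₁ ((2 * n) ! / a ^ (2 * n)), ?_⟩
    rintro _ ⟨⟨ρ, hρ⟩, rfl⟩
    have hρ' : 0 < ρ := hρ
    simp only
    rcases le_total ρ ρ₀ with h | h
    · exact ((le_abs_self _).trans (hC₁ ρ ⟨hρ'.le, h⟩)).trans (le_max_left _ _)
    · refine le_trans ?_ (le_max_right _ _)
      have hnorm : ‖Complex.I * (ρ : ℂ)‖ = ρ := by simp [abs_of_pos hρ']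
      have harg : Complex.arg (Complex.I * ρ) = Real.pi / 2 := by
        rw [mul_comm, Complex.arg_real_mul _ hρ', Complex.arg_I]
      have h3 := H.abs_log_norm_sub_le (s := Complex.I * ρ) (by simp)
        (by simpa using hρ'.ne') (e := weightEpsReal γ ρ) (by
          rw [hnorm]; exact h2 ρ ((le_max_right _ _).trans h))
      rw [hnorm, harg] at h3
      have h4 := (abs_le.1 h3).2
      have h5 := h1 ρ ((le_max_left _ _).trans h)
      rw [abs_of_pos (by positivity : 0 < Real.pi / 2)] at h4
      simp at h4
      have hne : γ (Complex.I * ρ) ≠ 0 := H.ne_zero _ (by simpa using H.pos)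
      have h6 : ‖γ (Complex.I * ρ)‖ ≤ Real.exp (-a * √ρ) := by
        rw [← Real.exp_log (norm_pos_iff.2 hne)]
        refine Real.exp_le_exp.2 ?_
        have := mul_le_mul_of_nonneg_left h5 (by positivity : 0 ≤ Real.pi / 4)
        rw [ha]
        linarith
      calc ρ ^ n * ‖γ (Complex.I * ρ)‖ ≤ ρ ^ n * Real.exp (-a * √ρ) := by gcongr
        _ = √ρ ^ (2 * n) * Real.exp (-a * √ρ) := by rw [pow_mul, Real.sq_sqrt hρ'.le]
        _ ≤ _ := Real.pow_mul_exp_neg_mul_le _ (by positivity) (Real.sqrt_nonneg _)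
  · obtain ⟨C, hC, h⟩ := H.norm_I_mul_le (θ := Real.pi / 4 * l) (by positivity) (by nlinarith)
    refine ⟨C * (n ! / (Real.pi / 4 * l) ^ n), ?_⟩
    rintro _ ⟨⟨ρ, hρ⟩, rfl⟩
    have hρ' : 0 < ρ := hρ
    calc ρ ^ n * ‖γ (Complex.I * ρ)‖ ≤ ρ ^ n * (C * Real.exp (-(Real.pi / 4 * l) * ρ)) := by
          gcongr; exact h ρ hρ
      _ = C * (ρ ^ n * Real.exp (-(Real.pi / 4 * l) * ρ)) := by ring
      _ ≤ _ := by gcongr; exact Real.pow_mul_exp_neg_mul_le _ (by positivity) hρ'.le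

theorem le_gammaHat (H : IsHalfPlaneWeight γ c B l) (n : ℕ) {ρ : ℝ} (hρ : 0 < ρ) :
    ρ ^ n * ‖γ (Complex.I * ρ)‖ ≤ gammaHat γ n :=
  le_ciSup (H.bddAbove_gammaHat n) (⟨ρ, hρ⟩ : Ioi (0 : ℝ))

/-- Analyticity of `gammaHat` forces the limit of `ε` to be positive. If the limit were `0`, then
`|γ(iρ)|` would decay slower than any exponential, and `ρ ^ n * |γ(iρ)|` at `ρ = C * e * n` would
exceed `C ^ n * n ^ n`. -/
theorem lim_pos (H : IsHalfPlaneWeight γ c B l) (han : IsAnalyticSeq (gammaHat γ)) : 0 < l := by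
  refine H.lim_nonneg.lt_of_ne fun hl => ?_
  obtain ⟨C₀, hC₀⟩ := han
  rw [eventually_map] at hC₀
  set C := max C₀ 1 with hC
  have hC1 : 1 ≤ C := le_max_right _ _
  have hCe : 0 < C * Real.exp 1 := by positivity
  obtain ⟨q, hq, hlow⟩ := H.exists_le_norm (β := 1 / (2 * (C * Real.exp 1))) (by
    rw [← hl]; simp only [mul_zero]; positivity)
  have hev : ∀ᶠ n : ℕ in atTop, q * Real.exp ((n : ℝ) / 2) ≤ 1 := by
    filter_upwards [hC₀, eventually_ge_atTop 1] with n hn hn1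
    have hn0 : (0 : ℝ) < n := by exact_mod_cast hn1
    have hhat0 : 0 ≤ gammaHat γ n := le_trans (by positivity) (H.le_gammaHat n one_pos)
    have h1 : gammaHat γ n / n ! ≤ C ^ n := by
      have h2 : (gammaHat γ n / n !) ^ (1 / (n : ℝ)) ≤ C := hn.trans (le_max_left _ _)
      have h3 := pow_le_pow_left₀ (Real.rpow_nonneg (by positivity) _) h2 n
      rwa [← Real.rpow_natCast, ← Real.rpow_mul (by positivity), one_div_mul_cancel hn0.ne',
        Real.rpow_one] at h3
    rw [div_le_iff₀ (by positivity)] at h1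
    have hfac : (n ! : ℝ) ≤ (n : ℝ) ^ n := by exact_mod_cast Nat.factorial_le_pow n
    set ρ := C * Real.exp 1 * n with hρ
    have hρ0 : 0 < ρ := by positivity
    have h2 := H.le_gammaHat n hρ0
    have h3 := hlow (Complex.I * ρ) (by simp) (by simp)
    have e1 : -(1 / (2 * (C * Real.exp 1))) * |(Complex.I * (ρ : ℂ)).im| = -((n : ℝ) / 2) := by
      simp only [Complex.mul_im, Complex.I_re, Complex.ofReal_im, Complex.I_im, Complex.ofReal_re,
        zero_mul, one_mul, zero_add, abs_of_pos hρ0]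
      rw [hρ]; field_simp
    rw [e1] at h3
    have h4 : ρ ^ n * (q * Real.exp (-((n : ℝ) / 2))) ≤ C ^ n * (n : ℝ) ^ n :=
      calc _ ≤ ρ ^ n * ‖γ (Complex.I * ρ)‖ := by gcongr
        _ ≤ _ := h2.trans (h1.trans (by gcongr))
    have e2 : ρ ^ n = C ^ n * (n : ℝ) ^ n * Real.exp n := by
      rw [hρ, mul_pow, mul_pow, ← Real.exp_nat_mul, mul_one]; ring
    have e3 : Real.exp (n : ℝ) * Real.exp (-((n : ℝ) / 2)) = Real.exp ((n : ℝ) / 2) := by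
      rw [← Real.exp_add]; ring_nf
    have h5 : C ^ n * (n : ℝ) ^ n * (q * Real.exp ((n : ℝ) / 2)) ≤ C ^ n * (n : ℝ) ^ n * 1 := by
      rw [mul_one, ← e3]
      calc _ = ρ ^ n * (q * Real.exp (-((n : ℝ) / 2))) := by rw [e2]; ring
        _ ≤ _ := h4
    exact le_of_mul_le_mul_left h5 (by positivity)
  have ht : Tendsto (fun n : ℕ => q * Real.exp ((n : ℝ) / 2)) atTop atTop :=
    (Real.tendsto_exp_atTop.comp
      (tendsto_natCast_atTop_atTop.atTop_div_const (by norm_num))).const_mul_atTop hq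
  obtain ⟨n, h1, h2⟩ := (hev.and (ht.eventually_gt_atTop 1)).exists
  linarith

/-- Together with `exists_le_gammaHat`: up to factors `(1 + o(1)) ^ n`, `gammaHat γ n` is
`n! / (π l / 2) ^ n`. -/
theorem exists_gammaHat_le (H : IsHalfPlaneWeight γ c B l) {θ : ℝ} (hθ0 : 0 < θ)
    (hθ : θ < Real.pi / 2 * l) :
    ∃ C : ℝ, 0 < C ∧ ∀ n : ℕ, gammaHat γ n ≤ C * (n ! / θ ^ n) := by
  obtain ⟨C, hC, h⟩ := H.norm_I_mul_le hθ0.le hθ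
  refine ⟨C, hC, fun n => ?_⟩
  have : Nonempty (Ioi (0 : ℝ)) := ⟨⟨1, mem_Ioi.2 one_pos⟩⟩
  refine ciSup_le fun ρ => ?_
  have hρ : (0 : ℝ) < ρ := ρ.2
  calc (ρ : ℝ) ^ n * ‖γ (Complex.I * ((ρ : ℝ) : ℂ))‖ ≤ ρ ^ n * (C * Real.exp (-θ * ρ)) := by
        gcongr; exact h ρ hρ
    _ = C * (ρ ^ n * Real.exp (-θ * ρ)) := by ring
    _ ≤ _ := by gcongr; exact Real.pow_mul_exp_neg_mul_le _ hθ0 hρ.le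

theorem exists_le_gammaHat (H : IsHalfPlaneWeight γ c B l) {β : ℝ}
    (hβ : Real.pi / 2 * l < β) :
    ∃ C : ℝ, 0 < C ∧ ∀ n : ℕ, n ! / β ^ n ≤ C * gammaHat γ n := by
  obtain ⟨β₁, hb1, hb2⟩ := exists_between hβ
  have hl := H.lim_nonneg
  have hpi := Real.pi_pos
  have hβ10 : 0 < β₁ := lt_of_le_of_lt (by positivity) hb1
  have hβ0 : 0 < β := hβ10.trans hb2
  obtain ⟨q, hq, hlow⟩ := H.exists_le_norm hb1
  refine ⟨β / (q * (β - β₁)), div_pos hβ0 (mul_pos hq (by linarith)), fun n => ?_⟩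
  have hd : 0 < β - β₁ := by linarith
  -- compare the integrals of `ρ ^ n * exp (-β * ρ)` and `exp (-(β - β₁) * ρ)`
  have hpt : ∀ ρ ∈ Ioi (0 : ℝ), ρ ^ ((n + 1 : ℝ) - 1) * Real.exp (-(β * ρ)) ≤
      gammaHat γ n / q * (ρ ^ ((1 : ℝ) - 1) * Real.exp (-((β - β₁) * ρ))) := by
    intro ρ hρ
    have hρ' : 0 < ρ := hρ
    have h3 := hlow (Complex.I * ρ) (by simp) (by simp)
    simp only [Complex.mul_im, Complex.I_re, Complex.ofReal_im, Complex.I_im, Complex.ofReal_re,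
        zero_mul, one_mul, zero_add, abs_of_pos hρ'] at h3
    have h4 : ρ ^ n * (q * Real.exp (-β₁ * ρ)) ≤ gammaHat γ n :=
      le_trans (by gcongr) (H.le_gammaHat n hρ')
    have e1 : Real.exp (-(β * ρ)) = Real.exp (-β₁ * ρ) * Real.exp (-((β - β₁) * ρ)) := by
      rw [← Real.exp_add]; ring_nf
    rw [add_sub_cancel_right, Real.rpow_natCast, sub_self, Real.rpow_zero, one_mul, e1,
      ← mul_assoc]
    gcongr
    rw [le_div_iff₀ hq]
    linarith
  have hint1 : MeasureTheory.IntegrableOn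
      (fun ρ : ℝ => ρ ^ ((n + 1 : ℝ) - 1) * Real.exp (-(β * ρ))) (Ioi 0) := by
    have := integrableOn_rpow_mul_exp_neg_mul_rpow (s := (n + 1 : ℝ) - 1) (p := 1) (b := β)
      (by linarith [(Nat.cast_nonneg n : (0 : ℝ) ≤ n)]) one_pos hβ0
    simpa using this
  have hint2 : MeasureTheory.IntegrableOn
      (fun ρ : ℝ => ρ ^ ((1 : ℝ) - 1) * Real.exp (-((β - β₁) * ρ))) (Ioi 0) := by
    have := integrableOn_rpow_mul_exp_neg_mul_rpow (s := (1 : ℝ) - 1) (p := 1) (b := β - β₁)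
      (by norm_num) one_pos hd
    simpa only [Real.rpow_one, neg_mul] using this
  have hI := MeasureTheory.setIntegral_mono_on hint1 (hint2.const_mul (gammaHat γ n / q))
    measurableSet_Ioi hpt
  rw [MeasureTheory.integral_const_mul,
    Real.integral_rpow_mul_exp_neg_mul_Ioi (by positivity) hβ0,
    Real.integral_rpow_mul_exp_neg_mul_Ioi one_pos hd, Real.Gamma_nat_eq_factorial,
    Real.Gamma_one, Real.rpow_one, Real.rpow_add_one (by positivity), Real.rpow_natCast] at hI
  have e2 : (n ! : ℝ) / β ^ n = β * ((1 / β) ^ n * (1 / β) * n !) := by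
    rw [one_div_pow]
    field_simp
  rw [e2]
  calc _ ≤ β * (gammaHat γ n / q * (1 / (β - β₁) * 1)) := by gcongr
    _ = _ := by field_simp

end IsHalfPlaneWeight

/-! ### The kernel `K` on sectors: contour shifts -/

theorem integrable_exp_neg_mul_abs {κ : ℝ} (hκ : 0 < κ) :
    MeasureTheory.Integrable fun y : ℝ => Real.exp (-κ * |y|) := by
  refine (integrable_inv_one_add_sq.const_mul (1 + 2 / κ ^ 2)).mono'
    (by fun_prop) (Eventually.of_forall fun y => ?_)
  rw [Real.norm_of_nonneg (Real.exp_pos _).le, ← div_eq_mul_inv, le_div_iff₀ (by positivity)]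
  have h1 := Real.pow_mul_exp_neg_mul_le 2 hκ (abs_nonneg y)
  have h2 : Real.exp (-κ * |y|) ≤ 1 := Real.exp_le_one_iff.2 (by
    have := mul_nonneg hκ.le (abs_nonneg y); linarith)
  rw [sq_abs] at h1
  norm_num [Nat.factorial] at h1
  rw [mul_add, mul_one]
  simp only [neg_mul] at h2 ⊢
  linarith

/-- Cauchy's theorem for a vertical strip. -/
theorem integral_vertical_line_eq {f : ℂ → ℂ} {a b Q κ : ℝ} (hκ : 0 < κ) (hab : a ≤ b)
    (hd : DifferentiableOn ℂ f {s | a ≤ s.re})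
    (hb : ∀ s : ℂ, a ≤ s.re → s.re ≤ b → ‖f s‖ ≤ Q * Real.exp (-κ * |s.im|)) :
    ∫ y : ℝ, f (a + y * Complex.I) = ∫ y : ℝ, f (b + y * Complex.I) := by
  have hline : ∀ σ : ℝ, a ≤ σ → σ ≤ b →
      MeasureTheory.Integrable fun y : ℝ => f (σ + y * Complex.I) := by
    intro σ h1 h2
    have hcont : Continuous fun y : ℝ => f (σ + y * Complex.I) := by
      rw [← continuousOn_univ]
      exact hd.continuousOn.comp (by fun_prop) fun y _ => by simpa using h1
    refine ((integrable_exp_neg_mul_abs hκ).const_mul Q).mono' hcont.aestronglyMeasurable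
      (Eventually.of_forall fun y => ?_)
    simpa using hb (σ + y * Complex.I) (by simpa using h1) (by simpa using h2)
  have hlim : ∀ σ : ℝ, a ≤ σ → σ ≤ b →
      Tendsto (fun T : ℝ => ∫ y in (-T)..T, f (σ + y * Complex.I)) atTop
        (𝓝 (∫ y : ℝ, f (σ + y * Complex.I))) := fun σ h1 h2 =>
    MeasureTheory.intervalIntegral_tendsto_integral (hline σ h1 h2) tendsto_neg_atTop_atBot
      tendsto_id
  have hrect : ∀ T : ℝ, (∫ x : ℝ in a..b, f (x + (-T : ℝ) * Complex.I)) -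
      (∫ x : ℝ in a..b, f (x + T * Complex.I)) +
      Complex.I • (∫ y : ℝ in (-T)..T, f (b + y * Complex.I)) -
      Complex.I • (∫ y : ℝ in (-T)..T, f (a + y * Complex.I)) = 0 := by
    intro T
    have := Complex.integral_boundary_rect_eq_zero_of_differentiableOn f
      (a + (-T : ℝ) * Complex.I) (b + T * Complex.I) (hd.mono ?_)
    · simpa using this
    · intro s hs
      have h1 := hs.1
      simp only [Complex.add_re, Complex.ofReal_re, Complex.mul_re, Complex.I_re, mul_zero,
        Complex.ofReal_im, Complex.I_im, mul_one, sub_self, add_zero] at h1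
      rw [mem_preimage, uIcc_of_le hab] at h1
      exact h1.1
  have hhor : ∀ g : ℝ → ℝ, (∀ T, |g T| = |T|) →
      Tendsto (fun T : ℝ => ∫ x : ℝ in a..b, f (x + g T * Complex.I)) atTop (𝓝 0) := by
    intro g hg
    have hz : Tendsto (fun T : ℝ => Q * Real.exp (-κ * |T|) * |b - a|) atTop (𝓝 0) := by
      have h1 : Tendsto (fun T : ℝ => Real.exp (-κ * |T|)) atTop (𝓝 0) := by
        refine Real.tendsto_exp_atBot.comp ?_
        exact tendsto_abs_atTop_atTop.const_mul_atTop_of_neg (by linarith)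
      simpa using (h1.const_mul Q).mul_const |b - a|
    refine squeeze_zero_norm (fun T => ?_) hz
    refine intervalIntegral.norm_integral_le_of_norm_le_const fun x hx => ?_
    rw [uIoc_of_le hab] at hx
    have := hb (x + g T * Complex.I) (by simpa using hx.1.le) (by simpa using hx.2)
    simpa [hg] using this
  have h0 := (((hhor (fun T => -T) (fun T => abs_neg T)).sub (hhor id (fun T => rfl))).add
    ((hlim b hab le_rfl).const_smul Complex.I)).sub ((hlim a le_rfl hab).const_smul Complex.I)
  have h1 := tendsto_nhds_unique (h0.congr fun T => hrect T) tendsto_const_nhds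
  rw [sub_self, zero_add, ← smul_sub, smul_eq_zero, sub_eq_zero] at h1
  exact (h1.resolve_left Complex.I_ne_zero).symm

namespace IsHalfPlaneWeight

variable {γ : ℂ → ℂ} {c B l : ℝ}

theorem weightSeq_pos (H : IsHalfPlaneWeight γ c B l) (n : ℕ) : 0 < weightSeq γ n := by
  have := (H.real n (by have := (Nat.cast_nonneg n : (0 : ℝ) ≤ n); linarith [H.pos])).1
  simpa [weightSeq] using this

theorem weightSeq_succ (n : ℕ) : weightSeq γ (n + 1) = (γ (((n : ℝ) + 1 : ℝ) : ℂ)).re := by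
  simp [weightSeq]

theorem weightSeq_succ_eq_exp (H : IsHalfPlaneWeight γ c B l) (n : ℕ) :
    weightSeq γ (n + 1) = Real.exp ((n + 1) * logRatio γ (n + 1)) := by
  rw [weightSeq_succ, H.weight_eq_exp (by positivity)]

theorem summable_weightE (H : IsHalfPlaneWeight γ c B l) {x : ℝ} (hx : 0 ≤ x) :
    Summable fun n : ℕ => x ^ n / weightSeq γ (n + 1) := by
  have hlim : Tendsto (fun n : ℕ => logRatio γ ((n : ℝ) + 1)) atTop atTop :=
    H.tendsto_logRatio.comp (tendsto_atTop_add_const_right _ _ tendsto_natCast_atTop_atTop)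
  refine Summable.of_norm_bounded_eventually_nat
    (g := fun n => ((1 / 2 : ℝ)) ^ n) (summable_geometric_of_lt_one (by norm_num) (by norm_num)) ?_
  filter_upwards [hlim.eventually_ge_atTop (Real.log (2 * x + 1))] with n hn
  have hpos := H.weightSeq_pos (n + 1)
  rw [Real.norm_of_nonneg (by positivity), div_le_iff₀ hpos, H.weightSeq_succ_eq_exp]
  have h1 : (2 * x + 1) ^ (n + 1) ≤ Real.exp ((n + 1) * logRatio γ (n + 1)) := by
    rw [← Real.exp_log (show 0 < 2 * x + 1 by positivity), ← Real.exp_nat_mul]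
    refine Real.exp_le_exp.2 ?_
    push_cast
    gcongr
  calc x ^ n = (1 / 2) ^ n * (2 * x) ^ n := by rw [← mul_pow]; ring_nf
    _ ≤ (1 / 2) ^ n * (2 * x + 1) ^ (n + 1) := by
      gcongr
      calc (2 * x) ^ n ≤ (2 * x + 1) ^ n := by gcongr; linarith
        _ ≤ _ := pow_le_pow_right₀ (by linarith) (by lia)
    _ ≤ _ := by gcongr

theorem weightE_nonneg (H : IsHalfPlaneWeight γ c B l) {x : ℝ} (hx : 0 ≤ x) : 0 ≤ weightE γ x :=
  tsum_nonneg fun n => div_nonneg (by positivity) (H.weightSeq_pos _).le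

theorem pow_le_mul_weightE (H : IsHalfPlaneWeight γ c B l) {x : ℝ} (hx : 0 ≤ x) (n : ℕ) :
    x ^ n ≤ weightSeq γ (n + 1) * weightE γ x := by
  have h := (H.summable_weightE hx).le_tsum n fun j _ =>
    div_nonneg (by positivity) (H.weightSeq_pos _).le
  rw [div_le_iff₀ (H.weightSeq_pos _)] at h
  rw [mul_comm]
  exact h

theorem norm_kernelIntegrand {w : ℂ} (hw : w ≠ 0) (s : ℂ) :
    ‖γ s * w ^ (-s)‖ = ‖γ s‖ * (‖w‖ ^ (-s.re) * Real.exp (Complex.arg w * s.im)) := by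
  rw [norm_mul, Complex.norm_cpow_of_ne_zero hw, Complex.neg_re, Complex.neg_im, mul_neg,
    Real.exp_neg, div_inv_eq_mul]

/-- Bounds for `K` in sectors strictly inside the sector of convergence, obtained by moving the
line of integration to `Re s = n`. -/
theorem exists_norm_weightK_le (H : IsHalfPlaneWeight γ c B l) {θ : ℝ} (hθ0 : 0 ≤ θ)
    (hθ : θ < Real.pi / 2 * l) :
    ∃ C A : ℝ, 0 < C ∧ 0 < A ∧ ∀ w : ℂ, w ≠ 0 → |Complex.arg w| ≤ θ →
      MeasureTheory.Integrable (kernelIntegrand γ w) ∧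
      ∀ n : ℕ, ‖weightK γ w‖ * ‖w‖ ^ n ≤ C * A ^ n * weightSeq γ (n + 1) := by
  have hc := H.pos
  obtain ⟨θ₁, h1, h2⟩ := exists_between hθ
  obtain ⟨C, A, hC, hA, hle⟩ := H.exists_norm_le (hθ0.trans h1.le) h2
  set κ := θ₁ - θ with hκd
  have hκ : 0 < κ := by linarith
  set I := ∫ y : ℝ, Real.exp (-κ * |y|) with hI
  have hI0 : 0 ≤ I := MeasureTheory.integral_nonneg fun y => (Real.exp_pos _).le
  refine ⟨C * (I + 1), Real.exp A, by positivity, Real.exp_pos _, fun w hw harg => ?_⟩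
  set f : ℂ → ℂ := fun s => γ s * w ^ (-s) with hf
  have hfd : DifferentiableOn ℂ f {s : ℂ | (0 : ℝ) ≤ s.re} := by
    refine (H.diff.mono fun s hs => ?_).mul fun s _ => ?_
    · have : 0 ≤ s.re := hs
      change -c < s.re
      linarith
    · exact ((differentiableAt_id.neg).const_cpow (Or.inl hw)).differentiableWithinAt
  have hfb : ∀ s : ℂ, 0 ≤ s.re → ‖f s‖ ≤ C * Real.exp (A * s.re) *
      (γ ((s.re + 1 : ℝ) : ℂ)).re * ‖w‖ ^ (-s.re) * Real.exp (-κ * |s.im|) := by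
    intro s hs
    have hg : 0 < (γ ((s.re + 1 : ℝ) : ℂ)).re := (H.real _ (by linarith)).1
    rw [hf, norm_kernelIntegrand hw]
    have h3 : Complex.arg w * s.im ≤ θ * |s.im| := by
      calc _ ≤ |Complex.arg w * s.im| := le_abs_self _
        _ = |Complex.arg w| * |s.im| := abs_mul _ _
        _ ≤ _ := by gcongr
    calc _ ≤ (C * Real.exp (A * s.re) * (γ ((s.re + 1 : ℝ) : ℂ)).re * Real.exp (-θ₁ * |s.im|)) *
          (‖w‖ ^ (-s.re) * Real.exp (θ * |s.im|)) := by gcongr; exact hle s hs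
      _ = C * Real.exp (A * s.re) * (γ ((s.re + 1 : ℝ) : ℂ)).re * ‖w‖ ^ (-s.re) *
          (Real.exp (-θ₁ * |s.im|) * Real.exp (θ * |s.im|)) := by ring
      _ = _ := by rw [← Real.exp_add, hκd]; ring_nf
  have hshift : ∀ b : ℝ, 0 ≤ b →
      ∫ y : ℝ, f ((0 : ℝ) + y * Complex.I) = ∫ y : ℝ, f (b + y * Complex.I) := by
    intro b hb
    have hcont : ContinuousOn (fun σ : ℝ => C * Real.exp (A * σ) *
        (γ ((σ + 1 : ℝ) : ℂ)).re * ‖w‖ ^ (-σ)) (Icc 0 b) := by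
      refine ((by fun_prop : ContinuousOn (fun σ : ℝ => C * Real.exp (A * σ)) _).mul ?_).mul ?_
      · refine Complex.continuous_re.comp_continuousOn
          (H.diff.continuousOn.comp (by fun_prop) fun σ hσ => ?_)
        have := hσ.1
        simp
        linarith
      · exact (Continuous.rpow continuous_const continuous_neg
          fun _ => Or.inl (norm_ne_zero_iff.2 hw)).continuousOn
    obtain ⟨Q, hQ⟩ := isCompact_Icc.exists_bound_of_continuousOn hcont
    refine integral_vertical_line_eq hκ hb hfd (Q := Q) fun s hs hsb => (hfb s hs).trans ?_
    gcongr
    exact (le_abs_self _).trans (hQ s.re ⟨hs, hsb⟩)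
  have hline : ∀ σ : ℝ, 0 ≤ σ → ‖∫ y : ℝ, f (σ + y * Complex.I)‖ ≤
      C * Real.exp (A * σ) * (γ ((σ + 1 : ℝ) : ℂ)).re * ‖w‖ ^ (-σ) * I := by
    intro σ hσ
    rw [hI, ← MeasureTheory.integral_const_mul]
    refine MeasureTheory.norm_integral_le_of_norm_le
      ((integrable_exp_neg_mul_abs hκ).const_mul _) (Eventually.of_forall fun y => ?_)
    simpa using hfb (σ + y * Complex.I) (by simpa using hσ)
  constructor
  · have hcont : Continuous fun y : ℝ => f ((1 : ℝ) + y * Complex.I) := by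
      rw [← continuousOn_univ]
      exact hfd.continuousOn.comp (by fun_prop) fun y _ => by simp
    have : MeasureTheory.Integrable fun y : ℝ => f ((1 : ℝ) + y * Complex.I) := by
      refine ((integrable_exp_neg_mul_abs hκ).const_mul _).mono' hcont.aestronglyMeasurable
        (Eventually.of_forall fun y => by
          simpa using hfb ((1 : ℝ) + y * Complex.I) (by simp))
    have hk : kernelIntegrand γ w = fun y : ℝ => f ((1 : ℝ) + y * Complex.I) := by
      ext y
      simp [hf, kernelIntegrand]
    rwa [hk]
  · intro n
    have h3 : weightK γ w = (1 / (2 * Real.pi : ℝ) : ℂ) *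
        ∫ y : ℝ, f ((n : ℝ) + y * Complex.I) := by
      rw [weightK, ← hshift n (Nat.cast_nonneg n), hshift 1 zero_le_one]
      simp [hf, kernelIntegrand]
    have h4 : ‖(1 / (2 * Real.pi : ℝ) : ℂ)‖ ≤ 1 := by
      rw [norm_div, Complex.norm_real, norm_one, Real.norm_of_nonneg (by positivity)]
      rw [div_le_one (by positivity)]
      linarith [Real.pi_gt_three]
    have hg : 0 < (γ (((n : ℝ) + 1 : ℝ) : ℂ)).re :=
      (H.real _ (by have := (Nat.cast_nonneg n : (0 : ℝ) ≤ n); linarith)).1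
    have hwn : 0 < ‖w‖ := norm_pos_iff.2 hw
    have h5 := hline n (Nat.cast_nonneg n)
    rw [Real.rpow_neg hwn.le, Real.rpow_natCast] at h5
    rw [h3, norm_mul, weightSeq_succ]
    calc _ ≤ 1 * (C * Real.exp (A * n) * (γ (((n : ℝ) + 1 : ℝ) : ℂ)).re * (‖w‖ ^ n)⁻¹ * I) *
          ‖w‖ ^ n := by gcongr
      _ = C * I * Real.exp (A * n) * (γ (((n : ℝ) + 1 : ℝ) : ℂ)).re := by
          field_simp
      _ ≤ C * (I + 1) * Real.exp (A * n) * (γ (((n : ℝ) + 1 : ℝ) : ℂ)).re := by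
          gcongr; linarith
      _ = _ := by rw [mul_comm A, Real.exp_nat_mul]

theorem arg_ofReal_div {t : ℝ} (ht : 0 < t) (z : ℂ) :
    Complex.arg ((t : ℂ) / z) = Complex.arg z⁻¹ := by
  rw [div_eq_mul_inv, Complex.arg_real_mul _ ht]

/-- `Ω_η(γ)` contains all sectors of small radius and of opening strictly less than `π l`. -/
theorem exists_sector_subset_domainOmega (H : IsHalfPlaneWeight γ c B l) {θ : ℝ} (hθ0 : 0 ≤ θ)
    (hθ : θ < Real.pi / 2 * l) {η : ℝ} (hη : 0 < η) :
    ∃ r : ℝ, 0 < r ∧ ∀ z : ℂ, z ≠ 0 → |Complex.arg z| ≤ θ → ‖z‖ ≤ r →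
      z ∈ domainOmega γ η := by
  obtain ⟨C, A, hC, hA, h⟩ := H.exists_norm_weightK_le hθ0 hθ
  refine ⟨1 / (2 * A * η), by positivity, fun z hz harg hr => ?_⟩
  have hw : ∀ t : ℝ, 0 < t → (t : ℂ) / z ≠ 0 := fun t ht =>
    div_ne_zero (by exact_mod_cast ht.ne') hz
  have hwa : ∀ t : ℝ, 0 < t → |Complex.arg ((t : ℂ) / z)| ≤ θ := fun t ht => by
    rwa [arg_ofReal_div ht, Complex.abs_arg_inv]
  refine ⟨hz, fun t ht => (h _ (hw t ht) (hwa t ht)).1, C * 2, fun t ht => ?_⟩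
  have hz0 : 0 < ‖z‖ := norm_pos_iff.2 hz
  have hn := (h _ (hw t ht) (hwa t ht)).2
  rw [weightE, ← tsum_mul_right]
  refine Real.tsum_le_of_sum_range_le (fun n => mul_nonneg
    (div_nonneg (by positivity) (H.weightSeq_pos _).le) (norm_nonneg _)) fun N => ?_
  have hterm : ∀ n ∈ Finset.range N, (t * η) ^ n / weightSeq γ (n + 1) * ‖weightK γ (t / z)‖ ≤
      C * (1 / 2) ^ n := by
    intro n _
    have h1 := hn n
    rw [norm_div, Complex.norm_real, Real.norm_of_nonneg ht.le, div_pow, ← mul_div_assoc,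
      div_le_iff₀ (by positivity)] at h1
    have hs := H.weightSeq_pos (n + 1)
    rw [div_mul_eq_mul_div, div_le_iff₀ hs]
    calc (t * η) ^ n * ‖weightK γ (t / z)‖ = η ^ n * (‖weightK γ (t / z)‖ * t ^ n) := by
          rw [mul_pow]; ring
      _ ≤ η ^ n * (C * A ^ n * weightSeq γ (n + 1) * ‖z‖ ^ n) := by gcongr
      _ = C * (A * η * ‖z‖) ^ n * weightSeq γ (n + 1) := by rw [mul_pow, mul_pow]; ring
      _ ≤ _ := by
        gcongr
        rw [le_div_iff₀ (by positivity)] at hr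
        linarith
  refine (Finset.sum_le_sum hterm).trans ?_
  rw [← Finset.mul_sum]
  gcongr
  have := (summable_geometric_of_lt_one (r := (1 / 2 : ℝ)) (by norm_num) (by norm_num)).sum_le_tsum
    (Finset.range N) fun n _ => by positivity
  rwa [tsum_geometric_two] at this

end IsHalfPlaneWeight

/-! ### The size of `Ω_η(γ)` -/

section Mellin

open MeasureTheory
open scoped FourierTransform

theorem mellinInv_exp_neg (f : ℂ → ℂ) (σ u : ℝ) :
    Real.exp (-σ * u) • mellinInv σ f (Real.exp (-u)) =
      𝓕⁻ (fun y : ℝ => f (σ + 2 * Real.pi * y * Complex.I)) u := by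
  rw [mellinInv_eq_fourierInv _ _ (Real.exp_pos _), Real.log_exp, neg_neg, ← Complex.ofReal_neg,
    ← Complex.ofReal_cpow (Real.exp_pos _).le, ← Real.exp_mul, Complex.real_smul, smul_eq_mul,
    ← mul_assoc, ← Complex.ofReal_mul, ← Real.exp_add]
  rw [show -σ * u + -u * -σ = 0 by ring]
  simp

theorem continuous_exp_smul_mellinInv {f : ℂ → ℂ} {σ : ℝ}
    (hint : Integrable fun y : ℝ => f (σ + y * Complex.I)) :
    Continuous fun u : ℝ => Real.exp (-σ * u) • mellinInv σ f (Real.exp (-u)) := by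
  have hgi : Integrable fun y : ℝ => f (σ + 2 * Real.pi * y * Complex.I) := by
    simpa using hint.comp_mul_left' (by positivity : (2 * Real.pi) ≠ 0)
  simp only [mellinInv_exp_neg, Real.fourierInv_eq_fourier_neg,
    Real.fourier_real_eq_integral_exp_smul]
  refine continuous_of_dominated (fun u => ?_) (fun u => Eventually.of_forall fun v => ?_)
    hgi.norm (Eventually.of_forall fun v => by fun_prop)
  · exact (by fun_prop : Continuous fun v : ℝ =>
      Complex.exp (((-2 * Real.pi * v * -u : ℝ) : ℂ) * Complex.I)).aestronglyMeasurable.smul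
        hgi.aestronglyMeasurable
  · rw [norm_smul, Complex.norm_exp_ofReal_mul_I, one_mul]

/-- Mellin inversion, starting on the side of the vertical line. -/
theorem mellin_mellinInv {f : ℂ → ℂ} {σ : ℝ} (hcont : Continuous fun y : ℝ => f (σ + y * Complex.I))
    (hint : Integrable fun y : ℝ => f (σ + y * Complex.I))
    (hint' : Integrable fun u : ℝ => Real.exp (-σ * u) • mellinInv σ f (Real.exp (-u)))
    (y : ℝ) : mellin (mellinInv σ f) (σ + y * Complex.I) = f (σ + y * Complex.I) := by
  have hpi : (2 * Real.pi) ≠ 0 := by positivity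
  set g : ℝ → ℂ := fun y : ℝ => f (σ + 2 * Real.pi * y * Complex.I) with hg
  have hgc : Continuous g := by
    have := hcont.comp (continuous_const.mul continuous_id : Continuous fun y : ℝ => 2 * Real.pi * y)
    simpa [hg, Function.comp_def] using this
  have hgi : Integrable g := by
    have := hint.comp_mul_left' hpi
    simpa [hg] using this
  have hfun : (fun u : ℝ => Real.exp (-σ * u) • mellinInv σ f (Real.exp (-u))) = 𝓕⁻ g :=
    funext fun u => mellinInv_exp_neg f σ u
  rw [hfun] at hint'
  have hgi' : Integrable (𝓕 g) := by
    have : 𝓕⁻ g = fun x => 𝓕 g (-x) := funext fun x => Real.fourierInv_eq_fourier_neg g x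
    rw [this] at hint'
    simpa using hint'.comp_neg
  rw [mellin_eq_fourier]
  have hre : ((σ : ℂ) + y * Complex.I).re = σ := by simp
  have him : ((σ : ℂ) + y * Complex.I).im = y := by simp
  rw [hre, him, hfun, hgc.fourier_fourierInv_eq hgi hgi', hg]
  push_cast
  field_simp

end Mellin

theorem not_integrable_of_le_norm {f : ℝ → ℂ} {S : Set ℝ} {q : ℝ} (hq : 0 < q)
    (hS : MeasurableSet S) (hvol : MeasureTheory.volume S = ⊤) (h : ∀ y ∈ S, q ≤ ‖f y‖) :
    ¬ MeasureTheory.Integrable f := by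
  intro hf
  have h1 : MeasureTheory.IntegrableOn (fun _ => q) S := by
    refine MeasureTheory.Integrable.mono (hf.integrableOn (s := S))
      MeasureTheory.aestronglyMeasurable_const ?_
    filter_upwards [MeasureTheory.ae_restrict_mem hS] with y hy
    rw [Real.norm_of_nonneg hq.le]
    exact h y hy
  rw [MeasureTheory.integrableOn_const_iff] at h1
  rcases h1 with h1 | h1
  · exact hq.ne' (by simpa using h1)
  · rw [hvol] at h1
    exact lt_irrefl _ h1

namespace IsHalfPlaneWeight

variable {γ : ℂ → ℂ} {c B l : ℝ}

theorem kernelIntegrand_eq (w : ℂ) (y : ℝ) : kernelIntegrand γ w y =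
    γ (1 + y * Complex.I) * w ^ (-(1 + y * Complex.I)) := rfl

/-- The integral defining `K` converges absolutely only in the sector `|arg w| ≤ π l / 2`. -/
theorem abs_arg_le_of_integrable (H : IsHalfPlaneWeight γ c B l) {w : ℂ} (hw : w ≠ 0)
    (hint : MeasureTheory.Integrable (kernelIntegrand γ w)) :
    |Complex.arg w| ≤ Real.pi / 2 * l := by
  by_contra! hlt
  obtain ⟨β, h1, h2⟩ := exists_between hlt
  obtain ⟨q, hq, hlow⟩ := H.exists_le_norm h1
  have hwn : 0 < ‖w‖ := norm_pos_iff.2 hw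
  have hbound : ∀ y : ℝ, 0 ≤ Complex.arg w * y → q * ‖w‖ ^ (-(1 : ℝ)) ≤
      ‖kernelIntegrand γ w y‖ := by
    intro y hy
    have h3 := hlow (1 + y * Complex.I) (by simp) (by simp)
    rw [kernelIntegrand_eq, norm_kernelIntegrand hw]
    simp only [Complex.add_im, Complex.one_im, Complex.mul_im, Complex.ofReal_re, Complex.I_im,
      mul_one, Complex.ofReal_im, Complex.I_re, mul_zero, add_zero, zero_add, Complex.add_re,
      Complex.one_re, Complex.mul_re, sub_self] at h3 ⊢
    have h4 : 1 ≤ Real.exp (-β * |y|) * Real.exp (Complex.arg w * y) := by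
      rw [← Real.exp_add, Real.one_le_exp_iff, ← abs_of_nonneg hy, abs_mul]
      nlinarith [abs_nonneg y]
    calc q * ‖w‖ ^ (-(1 : ℝ)) = q * ‖w‖ ^ (-(1 : ℝ)) * 1 := by ring
      _ ≤ q * ‖w‖ ^ (-(1 : ℝ)) * (Real.exp (-β * |y|) * Real.exp (Complex.arg w * y)) := by gcongr
      _ = q * Real.exp (-β * |y|) * (‖w‖ ^ (-(1 : ℝ)) * Real.exp (Complex.arg w * y)) := by ring
      _ ≤ _ := by gcongr
  rcases le_total 0 (Complex.arg w) with h | h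
  · exact not_integrable_of_le_norm (by positivity) measurableSet_Ioi Real.volume_Ioi
      (S := Ioi 0) (fun y hy => hbound y (mul_nonneg h (le_of_lt hy))) hint
  · exact not_integrable_of_le_norm (by positivity) measurableSet_Iio Real.volume_Iio
      (S := Iio 0) (fun y hy => hbound y (mul_nonneg_of_nonpos_of_nonpos h (le_of_lt hy))) hint

theorem abs_arg_le_of_mem_domainOmega (H : IsHalfPlaneWeight γ c B l) {η : ℝ} {z : ℂ}
    (hz : z ∈ domainOmega γ η) : |Complex.arg z| ≤ Real.pi / 2 * l := by
  have h := H.abs_arg_le_of_integrable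
    (div_ne_zero (by norm_num) hz.1 : ((1 : ℝ) : ℂ) / z ≠ 0) (hz.2.1 1 one_pos)
  rwa [arg_ofReal_div one_pos, Complex.abs_arg_inv] at h

theorem weightSeq_add_three_le (H : IsHalfPlaneWeight γ c B l) :
    ∃ D : ℝ, 1 ≤ D ∧ ∀ n : ℕ, weightSeq γ (n + 3) ≤ D ^ (n + 1) * weightSeq γ (n + 1) := by
  have hB := H.B_pos
  set q := |logRatio γ 1| with hq
  have hq0 : 0 ≤ q := abs_nonneg _
  refine ⟨Real.exp (6 * B + 2 * q), Real.one_le_exp (by positivity), fun n => ?_⟩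
  have hn : (0 : ℝ) ≤ n := Nat.cast_nonneg n
  rw [H.weightSeq_succ_eq_exp (n + 2), H.weightSeq_succ_eq_exp, ← Real.exp_nat_mul, ← Real.exp_add]
  refine Real.exp_le_exp.2 ?_
  push_cast
  have e1 : (n : ℝ) + 2 + 1 = n + 3 := by ring
  rw [e1]
  have h1 := H.logRatio_sub_le (x := n + 1) (y := n + 3) (by positivity) (by linarith)
  have h2 := H.logRatio_sub_le (x := 1) (y := n + 3) one_pos (by linarith)
  have h3 : Real.log (n + 3) - Real.log (n + 1) ≤ 2 / (n + 1) := by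
    rw [← Real.log_div (by positivity) (by positivity)]
    refine (Real.log_le_sub_one_of_pos (by positivity)).trans (le_of_eq ?_)
    field_simp
    ring
  have h4 : Real.log (n + 3) ≤ n + 2 := by
    have := Real.log_le_sub_one_of_pos (show (0 : ℝ) < n + 3 by positivity)
    linarith
  rw [Real.log_one, sub_zero] at h2
  have h5 : ((n : ℝ) + 1) * (logRatio γ (n + 3) - logRatio γ (n + 1)) ≤ B * 2 := by
    calc _ ≤ ((n : ℝ) + 1) * (B * (2 / (n + 1))) := by
          gcongr
          exact h1.trans (by gcongr)
      _ = _ := by field_simp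
  have h6 : logRatio γ (n + 3) ≤ q + B * (n + 2) := by
    have : B * Real.log (n + 3) ≤ B * (n + 2) := by gcongr
    have := le_abs_self (logRatio γ 1)
    linarith
  nlinarith [mul_nonneg hn hB.le, mul_nonneg hn hq0]

/-- The moments of `K` along a ray in the sector of convergence. Mellin inversion on the line
`Re s = 1` gives the Mellin transform of `t ↦ K(t / z)` there, and the identity theorem extends the
formula to `Re s > 0`, where the transform is holomorphic by the definition of `Ω_η(γ)`. -/
theorem mellin_weightK (H : IsHalfPlaneWeight γ c B l) {η : ℝ} (hη : 0 < η) {z : ℂ}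
    (hz : z ∈ domainOmega γ η) (n : ℕ) :
    mellin (fun t : ℝ => weightK γ (t / z)) ((n : ℂ) + 1) = γ ((n : ℂ) + 1) * z ^ (n + 1) := by
  have hc := H.pos
  have hpi := Real.pi_pos
  have harg : Complex.arg z ≠ Real.pi := by
    intro h
    have h1 := H.abs_arg_le_of_mem_domainOmega hz
    rw [h, abs_of_pos hpi] at h1
    nlinarith [H.lt_two]
  obtain ⟨hz0, hint, b, hb⟩ := hz
  -- `K(t / z)` is the inverse Mellin transform of `f`
  set f : ℂ → ℂ := fun s => γ s * z ^ s with hf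
  have hker : ∀ t : ℝ, 0 < t → ∀ s : ℂ, ((t : ℂ) / z) ^ (-s) = (t : ℂ) ^ (-s) * z ^ s := by
    intro t ht s
    have ht0 : (t : ℂ) ≠ 0 := by exact_mod_cast ht.ne'
    rw [Complex.cpow_def_of_ne_zero (div_ne_zero ht0 hz0), Complex.cpow_def_of_ne_zero ht0,
      Complex.cpow_def_of_ne_zero hz0, ← Complex.exp_add, div_eq_mul_inv,
      Complex.log_ofReal_mul ht (inv_ne_zero hz0), Complex.log_inv _ harg,
      Complex.ofReal_log ht.le]
    ring_nf
  set k : ℝ → ℂ := fun t => weightK γ (t / z) with hk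
  have hkinv : ∀ t : ℝ, 0 < t → k t = mellinInv 1 f t := by
    intro t ht
    simp only [hk, weightK, mellinInv, kernelIntegrand, hker t ht, hf, smul_eq_mul]
    rw [Complex.real_smul]
    push_cast
    congr 2
    ext y
    ring
  -- bounds for `K(t / z)` from the definition of the domain
  have hkb : ∀ (j : ℕ) (t : ℝ), 0 < t → (t * η) ^ j * ‖k t‖ ≤ weightSeq γ (j + 1) * b := by
    intro j t ht
    have h1 := H.pow_le_mul_weightE (mul_pos ht hη).le j
    have hs := H.weightSeq_pos (j + 1)
    calc _ ≤ weightSeq γ (j + 1) * weightE γ (t * η) * ‖k t‖ := by gcongr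
      _ = weightSeq γ (j + 1) * (weightE γ (t * η) * ‖k t‖) := by ring
      _ ≤ _ := by gcongr; exact hb t ht
  have hfd : DifferentiableOn ℂ f {s : ℂ | 0 < s.re} := by
    refine (H.diff.mono fun s hs => ?_).mul fun s _ => ?_
    · have : 0 < s.re := hs
      change -c < s.re
      linarith
    · exact (differentiableAt_id.const_cpow (Or.inl hz0)).differentiableWithinAt
  have hfc : Continuous fun y : ℝ => f ((1 : ℝ) + y * Complex.I) := by
    rw [← continuousOn_univ]
    exact hfd.continuousOn.comp (by fun_prop) fun y _ => by simp
  have hfi : MeasureTheory.Integrable fun y : ℝ => f ((1 : ℝ) + y * Complex.I) := by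
    have h1 : (fun y : ℝ => f ((1 : ℝ) + y * Complex.I)) =
        kernelIntegrand γ (((1 : ℝ) : ℂ) / z) := by
      ext y
      rw [kernelIntegrand_eq, hker 1 one_pos, hf]
      simp
    rw [h1]
    exact hint 1 one_pos
  have hcontk := continuous_exp_smul_mellinInv hfi
  have hki : MeasureTheory.Integrable
      fun u : ℝ => Real.exp (-1 * u) • mellinInv 1 f (Real.exp (-u)) := by
    refine ((integrable_exp_neg_mul_abs one_pos).const_mul
      (weightSeq γ 1 * b + weightSeq γ 3 * b / η ^ 2)).mono' hcontk.aestronglyMeasurable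
      (Eventually.of_forall fun u => ?_)
    rw [← hkinv _ (Real.exp_pos _), norm_smul, Real.norm_of_nonneg (Real.exp_pos _).le]
    have h0 := hkb 0 _ (Real.exp_pos (-u))
    have h2 := hkb 2 _ (Real.exp_pos (-u))
    simp only [pow_zero, one_mul, zero_add] at h0 h2
    have h2' : Real.exp (-u) ^ 2 * ‖k (Real.exp (-u))‖ ≤ weightSeq γ 3 * b / η ^ 2 := by
      rw [le_div_iff₀ (by positivity)]
      linarith [h2, show (Real.exp (-u) * η) ^ 2 * ‖k (Real.exp (-u))‖ =
        Real.exp (-u) ^ 2 * ‖k (Real.exp (-u))‖ * η ^ 2 by ring]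
    have h0p : 0 ≤ weightSeq γ 1 * b := (norm_nonneg _).trans h0
    have h2p : 0 ≤ weightSeq γ 3 * b / η ^ 2 := le_trans (by positivity) h2'
    rcases le_total 0 u with hu | hu
    · rw [abs_of_nonneg hu, mul_comm]
      gcongr
      linarith
    · rw [abs_of_nonpos hu]
      have e1 : Real.exp (-1 * u) * ‖k (Real.exp (-u))‖ =
          Real.exp (-u) ^ 2 * ‖k (Real.exp (-u))‖ * Real.exp (-1 * -u) := by
        rw [sq, ← Real.exp_add, mul_right_comm, ← Real.exp_add]
        ring_nf
      rw [e1]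
      gcongr
      linarith
  have hline : ∀ y : ℝ, mellin k ((1 : ℝ) + y * Complex.I) = f ((1 : ℝ) + y * Complex.I) := by
    intro y
    rw [← mellin_mellinInv hfc hfi hki y]
    refine MeasureTheory.setIntegral_congr_fun measurableSet_Ioi fun t ht => ?_
    simp only [hkinv t ht]
  have hkc : ContinuousOn k (Ioi 0) := by
    have h1 : ContinuousOn (fun t : ℝ => t⁻¹ •
        (Real.exp (-1 * -Real.log t) • mellinInv 1 f (Real.exp (-(-Real.log t))))) (Ioi 0) :=
      (continuousOn_inv₀.mono fun t ht => ne_of_gt ht).smul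
        (hcontk.comp_continuousOn (Real.continuousOn_log.mono fun t ht => ne_of_gt ht).neg)
    refine h1.congr fun t ht => ?_
    have ht' : 0 < t := ht
    simp only [neg_mul, one_mul, neg_neg, Real.exp_log ht', smul_smul, inv_mul_cancel₀ ht'.ne',
      one_smul]
    exact hkinv t ht'
  have hmd : DifferentiableOn ℂ (mellin k) {s : ℂ | 0 < s.re} := by
    intro s hs
    obtain ⟨j, hj⟩ := exists_nat_gt s.re
    refine (mellin_differentiableAt_of_isBigO_rpow (a := j) (b := 0)
      (hkc.locallyIntegrableOn measurableSet_Ioi) ?_ hj ?_ hs).differentiableWithinAt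
    · refine Asymptotics.IsBigO.of_bound (weightSeq γ (j + 1) * b / η ^ j) ?_
      filter_upwards [eventually_gt_atTop 0] with t ht
      rw [Real.norm_of_nonneg (Real.rpow_nonneg ht.le _), Real.rpow_neg ht.le, Real.rpow_natCast,
        ← div_eq_mul_inv, le_div_iff₀ (by positivity), le_div_iff₀ (by positivity)]
      have := hkb j t ht
      rw [mul_pow] at this
      linarith
    · refine Asymptotics.IsBigO.of_bound (weightSeq γ 1 * b) ?_
      filter_upwards [self_mem_nhdsWithin] with t ht
      simpa using hkb 0 t ht
  have hopen : IsOpen {s : ℂ | 0 < s.re} := isOpen_lt continuous_const Complex.continuous_re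
  have heq : EqOn (mellin k) f {s : ℂ | 0 < s.re} := by
    refine (hmd.analyticOnNhd hopen).eqOn_of_preconnected_of_frequently_eq
      (hfd.analyticOnNhd hopen) (convex_halfSpace_re_gt 0).isPreconnected
      (z₀ := 1) (by simp) ?_
    have ht : Tendsto (fun y : ℝ => ((1 : ℝ) : ℂ) + y * Complex.I) (𝓝[≠] 0) (𝓝[≠] 1) := by
      refine tendsto_nhdsWithin_iff.2 ⟨?_, ?_⟩
      · refine Tendsto.mono_left ?_ nhdsWithin_le_nhds
        have : Continuous fun y : ℝ => ((1 : ℝ) : ℂ) + y * Complex.I := by fun_prop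
        simpa using this.tendsto 0
      · filter_upwards [self_mem_nhdsWithin] with y hy
        simpa using hy
    exact ht.frequently (Eventually.of_forall hline).frequently
  have := heq (show (n : ℂ) + 1 ∈ {s : ℂ | 0 < s.re} by
    change 0 < ((n : ℂ) + 1).re
    simp
    positivity)
  rw [this, hf]
  simp only
  rw [← Nat.cast_succ, Complex.cpow_natCast]

/-- The diameter of `Ω_η(γ)` is `O(1 / η)`. For `z ∈ Ω_η(γ)` the `n`-th moment of `t ↦ K(t / z)`
is `γ_{n+1} * z ^ (n + 1)`, and it is bounded by a multiple of `D ^ n * γ_{n+1} / η ^ (n + 1)` because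
`|K(t / z)| ≤ b / E(t η)`; let `n` tend to infinity. -/
theorem exists_norm_le_of_mem_domainOmega (H : IsHalfPlaneWeight γ c B l) :
    ∃ D : ℝ, 0 < D ∧ ∀ η : ℝ, 0 < η → ∀ z ∈ domainOmega γ η, ‖z‖ ≤ D / η := by
  obtain ⟨D, hD, hle⟩ := H.weightSeq_add_three_le
  refine ⟨D, by linarith, fun η hη z hz => ?_⟩
  obtain ⟨b, hb⟩ := hz.2.2
  have hb0 : 0 ≤ b := le_trans (mul_nonneg (H.weightE_nonneg (by positivity)) (norm_nonneg _))
    (hb 1 one_pos)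
  have hpi := Real.pi_pos
  have hz0 : 0 < ‖z‖ := norm_pos_iff.2 hz.1
  have key : ∀ n : ℕ, (‖z‖ * η / D) ^ (n + 1) ≤ b * Real.pi := by
    intro n
    have hs1 := H.weightSeq_pos (n + 1)
    have hs3 := H.weightSeq_pos (n + 3)
    have hmel := H.mellin_weightK hη hz n
    have hnorm : ‖mellin (fun t : ℝ => weightK γ (t / z)) ((n : ℂ) + 1)‖ ≤
        b * (weightSeq γ (n + 1) + weightSeq γ (n + 3)) * (η ^ n)⁻¹ *
          (η⁻¹ * (Real.pi / 2)) := by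
      have hI : ∫ t in Ioi (0 : ℝ), (1 + (η * t) ^ 2)⁻¹ = η⁻¹ * (Real.pi / 2) := by
        rw [MeasureTheory.integral_comp_mul_left_Ioi (fun x => (1 + x ^ 2)⁻¹) 0 hη, mul_zero,
          integral_Ioi_inv_one_add_sq]
        simp
      have hint : MeasureTheory.Integrable fun t : ℝ => (1 + (η * t) ^ 2)⁻¹ :=
        integrable_inv_one_add_sq.comp_mul_left' hη.ne'
      rw [← hI, ← MeasureTheory.integral_const_mul]
      refine MeasureTheory.norm_integral_le_of_norm_le (hint.integrableOn.const_mul _) ?_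
      filter_upwards [MeasureTheory.ae_restrict_mem measurableSet_Ioi] with t ht
      have ht' : 0 < t := ht
      rw [add_sub_cancel_right, Complex.cpow_natCast, norm_smul, norm_pow, Complex.norm_real,
        Real.norm_of_nonneg ht'.le, ← div_eq_mul_inv, ← div_eq_mul_inv, div_div,
        le_div_iff₀ (by positivity)]
      have h1 := H.pow_le_mul_weightE (mul_pos ht' hη).le n
      have h2 := H.pow_le_mul_weightE (mul_pos ht' hη).le (n + 2)
      calc t ^ n * ‖weightK γ (t / z)‖ * (η ^ n * (1 + (η * t) ^ 2))
          = ((t * η) ^ n + (t * η) ^ (n + 2)) * ‖weightK γ (t / z)‖ := by ring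
        _ ≤ (weightSeq γ (n + 1) * weightE γ (t * η) +
            weightSeq γ (n + 3) * weightE γ (t * η)) * ‖weightK γ (t / z)‖ := by gcongr
        _ = (weightSeq γ (n + 1) + weightSeq γ (n + 3)) *
            (weightE γ (t * η) * ‖weightK γ (t / z)‖) := by ring
        _ ≤ (weightSeq γ (n + 1) + weightSeq γ (n + 3)) * b := by gcongr; exact hb t ht'
        _ = _ := by ring
    have hγn : ‖γ ((n : ℂ) + 1)‖ = weightSeq γ (n + 1) := by
      have h1 := H.real ((n : ℝ) + 1) (by
        have := (Nat.cast_nonneg n : (0 : ℝ) ≤ n); linarith [H.pos])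
      push_cast at h1
      have h2 : γ ((n : ℂ) + 1) = ((γ ((n : ℂ) + 1)).re : ℝ) :=
        Complex.ext rfl (by simpa using h1.2)
      rw [h2, Complex.norm_real, Real.norm_of_nonneg h1.1.le]
      simp [weightSeq]
    rw [hmel, norm_mul, norm_pow, hγn] at hnorm
    have h3 : weightSeq γ (n + 1) + weightSeq γ (n + 3) ≤
        2 * D ^ (n + 1) * weightSeq γ (n + 1) := by
      have h4 : 1 ≤ D ^ (n + 1) := one_le_pow₀ hD
      nlinarith [hle n]
    have h5 : weightSeq γ (n + 1) * ‖z‖ ^ (n + 1) ≤ b * (2 * D ^ (n + 1) * weightSeq γ (n + 1)) *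
        (η ^ n)⁻¹ * (η⁻¹ * (Real.pi / 2)) := hnorm.trans (by gcongr)
    have h6 : weightSeq γ (n + 1) * ‖z‖ ^ (n + 1) ≤ weightSeq γ (n + 1) *
        (b * Real.pi * (D ^ (n + 1) / η ^ (n + 1))) := by
      refine h5.trans (le_of_eq ?_)
      rw [pow_succ η]
      field_simp
    have h7 := le_of_mul_le_mul_left h6 hs1
    rw [div_pow, mul_pow, div_le_iff₀ (by positivity)]
    rwa [← mul_div_assoc, le_div_iff₀ (by positivity)] at h7
  rw [le_div_iff₀ hη, ← div_le_one (by linarith)]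
  by_contra! hgt
  obtain ⟨n, hn⟩ := ((tendsto_pow_atTop_atTop_of_one_lt hgt).comp
    (tendsto_add_atTop_nat 1)).eventually_gt_atTop (b * Real.pi) |>.exists
  exact absurd (key n) (not_le.2 hn)

end IsHalfPlaneWeight

/-! ### Iterated derivatives: sectors, Cauchy's estimates and restriction to the real axis -/

theorem Complex.abs_arg_mul_norm_le {z : ℂ} (hz : 0 ≤ z.re) :
    |Complex.arg z| * ‖z‖ ≤ Real.pi / 2 * |z.im| := by
  have h1 := Real.mul_abs_le_abs_sin (Complex.abs_arg_le_pi_div_two_iff.2 hz)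
  have h2 : |z.im| = ‖z‖ * |Real.sin (Complex.arg z)| := by
    rw [← Complex.norm_mul_sin_arg, abs_mul, abs_of_nonneg (norm_nonneg z)]
  have hpi := Real.pi_pos
  calc |Complex.arg z| * ‖z‖ = Real.pi / 2 * (‖z‖ * (2 / Real.pi * |Complex.arg z|)) := by
        field_simp
    _ ≤ Real.pi / 2 * (‖z‖ * |Real.sin (Complex.arg z)|) := by gcongr
    _ = _ := by rw [h2]

/-- A disc about `z` of radius comparable to `|z|` lies in a slightly larger sector. -/
theorem Complex.mem_sector_of_norm_sub_le {z w : ℂ} {q : ℝ} (hz : z ≠ 0) (hq : q ≤ 1 / 2)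
    (hqz : |Complex.arg z| + Real.pi * q < Real.pi) (hw : ‖w - z‖ ≤ q * ‖z‖) :
    w ≠ 0 ∧ |Complex.arg w| ≤ |Complex.arg z| + Real.pi * q ∧ ‖w‖ ≤ 2 * ‖z‖ := by
  have hpi := Real.pi_pos
  have hzn : 0 < ‖z‖ := norm_pos_iff.2 hz
  set v := w / z with hv
  have hwv : w = z * v := by rw [hv]; field_simp
  have hv1 : ‖v - 1‖ ≤ q := by
    have : v - 1 = (w - z) / z := by rw [hv]; field_simp
    rw [this, norm_div, div_le_iff₀ hzn]
    exact hw
  have hre : 1 / 2 ≤ v.re := by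
    have := (abs_le.1 ((Complex.abs_re_le_norm (v - 1)).trans hv1)).1
    simp at this
    linarith
  have him : |v.im| ≤ q := by
    have := (Complex.abs_im_le_norm (v - 1)).trans hv1
    simpa using this
  have hv0 : v ≠ 0 := fun h => by rw [h] at hre; norm_num at hre
  have harg : |Complex.arg v| ≤ Real.pi * q := by
    have h1 := Complex.abs_arg_mul_norm_le (z := v) (by linarith)
    have h2 : 1 / 2 ≤ ‖v‖ := hre.trans (Complex.re_le_norm v)
    have h3 : |Complex.arg v| * (1 / 2) ≤ |Complex.arg v| * ‖v‖ := by gcongr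
    have h4 : Real.pi / 2 * |v.im| ≤ Real.pi / 2 * q := by gcongr
    linarith
  refine ⟨by rw [hwv]; exact mul_ne_zero hz hv0, ?_, ?_⟩
  · have h5 := abs_add_le (Complex.arg z) (Complex.arg v)
    have h6 : |Complex.arg z + Complex.arg v| ≤ |Complex.arg z| + Real.pi * q := by linarith
    have h7 := abs_le.1 h6
    rw [hwv, Complex.arg_mul hz hv0 ⟨by linarith, by linarith⟩]
    exact h6
  · have h1 : ‖w‖ ≤ ‖w - z‖ + ‖z‖ := by simpa using norm_add_le (w - z) z
    nlinarith

theorem iteratedDeriv_sum_mul_pow (a : ℕ → ℂ) (n N : ℕ) (z : ℂ) :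
    iteratedDeriv n (fun w : ℂ => ∑ k ∈ Finset.range N, a k * w ^ k) z =
      ∑ k ∈ Finset.range N, a k * (k.descFactorial n * z ^ (k - n)) := by
  rw [iteratedDeriv_fun_sum fun k _ => by fun_prop]
  refine Finset.sum_congr rfl fun k _ => ?_
  rw [iteratedDeriv_const_mul (f := fun w : ℂ => w ^ k) (a k) (by fun_prop), iteratedDeriv_pow]

theorem iteratedDeriv_sum_mul_pow_self (a : ℕ → ℂ) (n : ℕ) (z : ℂ) :
    iteratedDeriv n (fun w : ℂ => ∑ k ∈ Finset.range n, a k * w ^ k) z = 0 := by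
  rw [iteratedDeriv_sum_mul_pow]
  refine Finset.sum_eq_zero fun k hk => ?_
  rw [Nat.descFactorial_eq_zero_iff_lt.2 (Finset.mem_range.1 hk)]
  simp

theorem iteratedDeriv_sum_mul_pow_succ (a : ℕ → ℂ) (n : ℕ) (z : ℂ) :
    iteratedDeriv n (fun w : ℂ => ∑ k ∈ Finset.range (n + 1), a k * w ^ k) z = a n * n ! := by
  rw [iteratedDeriv_sum_mul_pow, Finset.sum_range_succ, ← iteratedDeriv_sum_mul_pow,
    iteratedDeriv_sum_mul_pow_self]
  simp [Nat.descFactorial_self]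

/-- Cauchy's estimate for the difference of a function and a Taylor polynomial. -/
theorem norm_iteratedDeriv_sub_le {F : ℂ → ℂ} {z : ℂ} {R S : ℝ} (hR : 0 < R) (a : ℕ → ℂ)
    (n N : ℕ) (hF : ∀ w, ‖w - z‖ ≤ R → AnalyticAt ℂ F w)
    (hb : ∀ w, ‖w - z‖ ≤ R → ‖F w - ∑ k ∈ Finset.range N, a k * w ^ k‖ ≤ S) :
    ‖iteratedDeriv n F z - iteratedDeriv n (fun w : ℂ => ∑ k ∈ Finset.range N, a k * w ^ k) z‖ ≤
      n ! * S / R ^ n := by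
  have h1 : ContDiffAt ℂ n F z := (hF z (by simpa using hR.le)).contDiffAt
  have h2 : ContDiffAt ℂ n (fun w : ℂ => ∑ k ∈ Finset.range N, a k * w ^ k) z := by fun_prop
  rw [← iteratedDeriv_sub h1 h2]
  refine Complex.norm_iteratedDeriv_le_of_forall_mem_sphere_norm_le n hR ?_ fun w hw => ?_
  · refine DifferentiableOn.diffContOnCl fun w hw => ?_
    rw [closure_ball z hR.ne', mem_closedBall_iff_norm] at hw
    exact ((hF w hw).differentiableAt.sub (by fun_prop)).differentiableWithinAt
  · exact hb w (mem_sphere_iff_norm.1 hw).le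

theorem hasDerivAt_iteratedDeriv {F : ℂ → ℂ} {z : ℂ} (hF : AnalyticAt ℂ F z) (n : ℕ) :
    HasDerivAt (iteratedDeriv n F) (iteratedDeriv (n + 1) F z) z := by
  have h : AnalyticAt ℂ (iteratedDeriv n F) z := by
    rw [iteratedDeriv_eq_iterate]
    exact hF.iterated_deriv n
  rw [iteratedDeriv_succ]
  exact h.differentiableAt.hasDerivAt

theorem iteratedDerivWithin_eq_of_hasDerivWithinAt {s : Set ℝ} (hs : UniqueDiffOn ℝ s)
    {p : ℕ → ℝ → ℂ} (hp : ∀ n, ∀ x ∈ s, HasDerivWithinAt (p n) (p (n + 1) x) s x) (n : ℕ) :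
    ∀ x ∈ s, iteratedDerivWithin n (p 0) s x = p n x := by
  induction n with
  | zero => intro x _; simp
  | succ n ih =>
    intro x hx
    rw [iteratedDerivWithin_succ, derivWithin_congr ih (ih x hx)]
    exact (hp n x hx).derivWithin (hs x hx)

theorem contDiffOn_of_hasDerivWithinAt {s : Set ℝ} (hs : UniqueDiffOn ℝ s)
    {p : ℕ → ℝ → ℂ} (hp : ∀ n, ∀ x ∈ s, HasDerivWithinAt (p n) (p (n + 1) x) s x) :
    ContDiffOn ℝ ∞ (p 0) s := by
  refine contDiffOn_of_differentiableOn_deriv (n := ⊤) fun m _ x hx => ?_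
  exact (hp m x hx).differentiableWithinAt.congr
    (fun y hy => iteratedDerivWithin_eq_of_hasDerivWithinAt hs hp m y hy)
    (iteratedDerivWithin_eq_of_hasDerivWithinAt hs hp m x hx)

/-- If all derivatives of a holomorphic function have limits at the origin along the positive ray,
then its restriction to `[0, a)` is smooth and the limits are its derivatives at `0`. -/
theorem hasDerivWithinAt_Ico_of_tendsto {F : ℂ → ℂ} {a : ℝ} (ha : 0 < a) {c : ℕ → ℂ}
    (hF : ∀ x : ℝ, 0 < x → x < a → AnalyticAt ℂ F x)
    (hc : ∀ n, Tendsto (fun x : ℝ => iteratedDeriv n F x) (𝓝[>] 0) (𝓝 (c n)))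
    (n : ℕ) : ∀ x ∈ Ico 0 a, HasDerivWithinAt
      (fun x : ℝ => if x = 0 then c n else iteratedDeriv n F x)
      (if x = 0 then c (n + 1) else iteratedDeriv (n + 1) F x) (Ico 0 a) x := by
  have hpos : ∀ x ∈ Ioo 0 a, HasDerivAt
      (fun x : ℝ => if x = 0 then c n else iteratedDeriv n F x) (iteratedDeriv (n + 1) F x) x := by
    intro x hx
    refine (hasDerivAt_iteratedDeriv (hF x hx.1 hx.2) n).comp_ofReal.congr_of_eventuallyEq ?_
    filter_upwards [isOpen_Ioi.mem_nhds hx.1] with y hy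
    rw [if_neg (ne_of_gt hy)]
  intro x hx
  rcases hx.1.eq_or_lt with h | h
  · subst h
    rw [if_pos rfl]
    have hmem : Ioo 0 a ∈ 𝓝[>] (0 : ℝ) := Ioo_mem_nhdsGT ha
    refine (hasDerivWithinAt_Ici_of_tendsto_deriv (s := Ioo 0 a)
      (fun x hx => (hpos x hx).differentiableAt.differentiableWithinAt) ?_ hmem ?_).mono
      Ico_subset_Ici_self
    · rw [ContinuousWithinAt, if_pos rfl]
      refine ((hc n).congr' ?_).mono_left (nhdsWithin_mono _ Ioo_subset_Ioi_self)
      filter_upwards [self_mem_nhdsWithin] with y hy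
      rw [if_neg (ne_of_gt hy)]
    · refine (hc (n + 1)).congr' ?_
      filter_upwards [hmem] with y hy
      rw [(hpos y hy).deriv]
  · rw [if_neg h.ne']
    exact (hpos x ⟨h, hx.2⟩).hasDerivWithinAt

/-! ### From functions on `Ω_η(γ)` to germs on the half-line -/

namespace IsHalfPlaneWeight

variable {γ : ℂ → ℂ} {c B l : ℝ}

/-- Cauchy's estimates, in discs about `x` of radius proportional to `x` for the derivatives of `F`
and in discs of fixed radius `θ < π l / 2` for those of `F ∘ exp`. The second radius loses a factor
less than `η` against `π l / 2`, which `gammaHat` compensates. -/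
theorem germsD_subset_germsB (H : IsHalfPlaneWeight γ c B l) (hl : 0 < l) {M : ℕ → ℝ}
    (hM : ∀ n, 0 < M n) {η δ : ℝ} (hη : 1 < η) (hδ : 0 < δ) :
    germsD M γ δ ⊆ germsB η (weightedSeq M γ) (gammaHat γ) := by
  rintro _ ⟨F, hF, rfl⟩
  have hpi := Real.pi_pos
  set b := Real.pi / 2 * l with hb
  have hb0 : 0 < b := by positivity
  have hbpi : b < Real.pi := by
    have := H.lt_two
    rw [hb]
    nlinarith
  obtain ⟨β, hβ1, hβ2⟩ := exists_between (show b < η * b by nlinarith)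
  have hη0 : 0 < η := by linarith
  set θ := β / η with hθ
  have hθ0 : 0 < θ := div_pos (hb0.trans hβ1) hη0
  have hθb : θ < b := by rw [hθ, div_lt_iff₀ hη0]; linarith
  have hηθ : η * θ = β := by rw [hθ]; field_simp
  -- `F` is holomorphic in a sector of opening `2 θ`
  obtain ⟨r, hr, hsec⟩ := H.exists_sector_subset_domainOmega hθ0.le hθb
    (show 0 < 2 / δ by positivity)
  obtain ⟨han, cf, ⟨hc0, hjet⟩, C, hC, hrem⟩ := hF (2 / δ) (by gcongr; norm_num)
  have hW : ∀ n, 0 < M n * weightSeq γ (n + 1) := fun n =>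
    mul_pos (hM n) (H.weightSeq_pos _)
  set q := min (1 / 2) (θ / Real.pi) with hq
  have hq0 : 0 < q := by positivity
  have hq1 : q ≤ 1 / 2 := min_le_left _ _
  have hq2 : Real.pi * q ≤ θ := by
    calc Real.pi * q ≤ Real.pi * (θ / Real.pi) := by gcongr; exact min_le_right _ _
      _ = θ := by field_simp
  set a := min (r / 2) (r * Real.exp (-θ)) with ha
  have ha0 : 0 < a := by positivity
  have har : a ≤ r / 2 := min_le_left _ _
  have hare : a * Real.exp θ ≤ r := by
    calc a * Real.exp θ ≤ r * Real.exp (-θ) * Real.exp θ := by gcongr; exact min_le_right _ _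
      _ = r := by rw [mul_assoc, ← Real.exp_add]; simp
  have hray : ∀ x : ℝ, 0 < x → x < a → (x : ℂ) ∈ domainOmega γ (2 / δ) := fun x hx hxa => by
    refine hsec x (by exact_mod_cast hx.ne') ?_ ?_
    · rw [Complex.arg_ofReal_of_nonneg hx.le, abs_zero]; exact hθ0.le
    · rw [Complex.norm_real, Real.norm_of_nonneg hx.le]; linarith
  have hdisc : ∀ x : ℝ, 0 < x → x < a → ∀ w : ℂ, ‖w - x‖ ≤ q * x →
      w ∈ domainOmega γ (2 / δ) ∧ ‖w‖ ≤ 2 * x := by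
    intro x hx hxa w hw
    have hx0 : (x : ℂ) ≠ 0 := by exact_mod_cast hx.ne'
    have hnx : ‖(x : ℂ)‖ = x := by rw [Complex.norm_real, Real.norm_of_nonneg hx.le]
    have hax : Complex.arg (x : ℂ) = 0 := Complex.arg_ofReal_of_nonneg hx.le
    obtain ⟨h1, h2, h3⟩ := Complex.mem_sector_of_norm_sub_le (w := w) hx0 hq1
      (by rw [hax]; simp; linarith) (by rwa [hnx])
    rw [hax, abs_zero, zero_add] at h2
    rw [hnx] at h3
    exact ⟨hsec w h1 (h2.trans hq2) (by linarith), h3⟩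
  have hlim : ∀ n, Tendsto (fun x : ℝ => iteratedDeriv n F x) (𝓝[>] 0) (𝓝 (cf n)) := by
    intro n
    refine (hjet n).comp (tendsto_nhdsWithin_iff.2 ⟨?_, ?_⟩)
    · exact (Complex.continuous_ofReal.tendsto' 0 0 (by simp)).mono_left nhdsWithin_le_nhds
    · filter_upwards [Ioo_mem_nhdsGT ha0] with x hx using hray x hx.1 hx.2
  -- the restriction of `F` and its derivatives
  set p : ℕ → ℝ → ℂ := fun n x => if x = 0 then cf n else iteratedDeriv n F x with hp
  have hp0 : p 0 = fun x : ℝ => F x := by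
    ext x
    by_cases hx : x = 0
    · simp [hp, hx, hc0]
    · simp [hp, hx]
  have hpd : ∀ n, ∀ x ∈ Ico 0 a, HasDerivWithinAt (p n) (p (n + 1) x) (Ico 0 a) x := fun n =>
    hasDerivWithinAt_Ico_of_tendsto ha0 (fun x hx hxa => han x (hray x hx hxa)) hlim n
  have hu : UniqueDiffOn ℝ (Ico 0 a) := uniqueDiffOn_Ico 0 a
  -- Cauchy's estimates in discs of radius `q x`
  have hbound : ∀ n : ℕ, ∀ x : ℝ, 0 < x → x < a →
      ‖iteratedDeriv n F x‖ ≤ C * (C * (2 / q)) ^ n * (M n * weightSeq γ (n + 1)) := by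
    intro n x hx hxa
    have h1 := norm_iteratedDeriv_sub_le (F := F) (z := x) (R := q * x)
      (S := C ^ (n + 1) * (M n * weightSeq γ (n + 1) / (n ! : ℝ)) * (2 * x) ^ n)
      (by positivity) (fun k => cf k / (k ! : ℂ)) n n
      (fun w hw => han w (hdisc x hx hxa w hw).1) (fun w hw => by
        obtain ⟨h2, h3⟩ := hdisc x hx hxa w hw
        refine (hrem n w h2).trans ?_
        have := hW n
        gcongr)
    rw [iteratedDeriv_sum_mul_pow_self, sub_zero] at h1
    refine h1.trans (le_of_eq ?_)
    simp only [mul_pow, div_pow, pow_succ]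
    field_simp
  have hboundp : ∀ n : ℕ, ∀ x ∈ Ico 0 a,
      ‖p n x‖ ≤ C * (C * (2 / q)) ^ n * (M n * weightSeq γ (n + 1)) := by
    intro n x hx
    rcases hx.1.eq_or_lt with h | h
    · subst h
      simp only [hp, if_pos]
      refine le_of_tendsto (hlim n).norm ?_
      filter_upwards [Ioo_mem_nhdsGT ha0] with x hx using hbound n x hx.1 hx.2
    · simp only [hp, if_neg h.ne']
      exact hbound n x h hx.2
  -- estimates in the logarithmic variable, in discs of radius `θ`
  have hexp : ∀ ξ : ℝ, Real.exp ξ < a → ∀ ζ : ℂ, ‖ζ - ξ‖ ≤ θ →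
      Complex.exp ζ ∈ domainOmega γ (2 / δ) := by
    intro ξ hξ ζ hζ
    have him : |ζ.im| ≤ θ := by
      have := (Complex.abs_im_le_norm (ζ - ξ)).trans hζ
      simpa using this
    have hre : ζ.re ≤ ξ + θ := by
      have := (abs_le.1 ((Complex.abs_re_le_norm (ζ - ξ)).trans hζ)).2
      simp at this
      linarith
    refine hsec _ (Complex.exp_ne_zero _) ?_ ?_
    · have h3 := abs_le.1 him
      rw [Complex.arg_exp, toIocMod_eq_self _ |>.2]
      · exact him
      · constructor <;> linarith
    · rw [Complex.norm_exp]
      calc Real.exp ζ.re ≤ Real.exp (ξ + θ) := Real.exp_le_exp.2 hre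
        _ = Real.exp ξ * Real.exp θ := Real.exp_add _ _
        _ ≤ a * Real.exp θ := by gcongr
        _ ≤ r := hare
  have hGan : ∀ ξ : ℝ, Real.exp ξ < a → ∀ ζ : ℂ, ‖ζ - ξ‖ ≤ θ →
      AnalyticAt ℂ (fun ζ => F (Complex.exp ζ)) ζ := fun ξ hξ ζ hζ =>
    AnalyticAt.comp (han _ (hexp ξ hξ ζ hζ)) analyticAt_cexp
  set I : Set ℝ := Real.exp ⁻¹' Ico 0 a with hI
  have hIopen : IsOpen I := by
    have : I = Real.exp ⁻¹' Iio a := by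
      ext x
      simp [hI, Real.exp_nonneg]
    rw [this]
    exact isOpen_Iio.preimage Real.continuous_exp
  have hGder : ∀ n : ℕ, ∀ ξ ∈ I, iteratedDerivWithin n (fun v : ℝ => F (Real.exp v : ℝ)) I ξ =
      iteratedDeriv n (fun ζ => F (Complex.exp ζ)) ξ := by
    intro n ξ hξ
    have := iteratedDerivWithin_eq_of_hasDerivWithinAt hIopen.uniqueDiffOn
      (p := fun n (ξ : ℝ) => iteratedDeriv n (fun ζ => F (Complex.exp ζ)) ξ)
      (fun n x hx => ((hasDerivAt_iteratedDeriv
        (hGan x hx.2 x (by simpa using hθ0.le)) n).comp_ofReal).hasDerivWithinAt) n ξ hξ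
    simpa using this
  obtain ⟨C₂, hC₂, hhat⟩ := H.exists_le_gammaHat hβ1
  have hGb : ∀ n : ℕ, ∀ ξ ∈ I, ‖iteratedDeriv n (fun ζ => F (Complex.exp ζ)) ξ‖ ≤
      C * (M 0 * weightSeq γ 1) * C₂ * η ^ n * gammaHat γ n := by
    intro n ξ hξ
    have h1 := norm_iteratedDeriv_sub_le (F := fun ζ => F (Complex.exp ζ)) (z := ξ) (R := θ)
      (S := C * (M 0 * weightSeq γ 1)) hθ0 0 n 0 (fun w hw => hGan ξ hξ.2 w hw)
      (fun w hw => by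
        have := hrem 0 _ (hexp ξ hξ.2 w hw)
        simpa using this)
    have h0 : iteratedDeriv n (fun w : ℂ => ∑ k ∈ Finset.range 0, (0 : ℕ → ℂ) k * w ^ k) ξ = 0 := by
      rw [iteratedDeriv_sum_mul_pow]; simp
    rw [h0, sub_zero] at h1
    have hM0 := hW 0
    calc _ ≤ (n ! : ℝ) * (C * (M 0 * weightSeq γ 1)) / θ ^ n := h1
      _ = C * (M 0 * weightSeq γ 1) * η ^ n * (n ! / β ^ n) := by
        rw [← hηθ, mul_pow]
        field_simp
      _ ≤ C * (M 0 * weightSeq γ 1) * η ^ n * (C₂ * gammaHat γ n) := by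
        gcongr
        exact hhat n
      _ = _ := by ring
  refine mem_iUnion₂.2 ⟨a, ha0, fun x : ℝ => F x, ⟨?_, fun J _ hJ => ?_⟩, rfl⟩
  · rw [← hp0]
    exact contDiffOn_of_hasDerivWithinAt hu hpd
  · have hM0 := hW 0
    set C₃ := max (max C (C * (2 / q))) (C * (M 0 * weightSeq γ 1) * C₂) with hC₃
    have hC₃0 : 0 < C₃ := lt_max_of_lt_left (lt_max_of_lt_left hC)
    refine ⟨C₃, hC₃0, fun n x hx => ?_, fun n ξ hξ => ?_⟩
    · rw [← hp0, iteratedDerivWithin_eq_of_hasDerivWithinAt hu hpd n x (hJ hx)]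
      refine (hboundp n x (hJ hx)).trans ?_
      rw [weightedSeq, pow_succ']
      have := hW n
      gcongr
      · exact (le_max_left _ _).trans (le_max_left _ _)
      · exact (le_max_right _ _).trans (le_max_left _ _)
    · rw [hGder n ξ (hJ hξ)]
      refine (hGb n ξ (hJ hξ)).trans ?_
      have : 0 ≤ gammaHat γ n := le_trans (by positivity) (H.le_gammaHat n one_pos)
      gcongr
      exact le_max_right _ _

end IsHalfPlaneWeight

/-! ### Growth of regular sequences -/

/-- A sequence whose increments at `n` are at most `D / (n + 1)`, and which is eventually monotone,
is quasi-increasing up to bounded dilations of the index. -/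
theorem exists_le_add_of_step {v : ℕ → ℝ} {D : ℝ} (hD : 0 ≤ D)
    (hstep : ∀ n : ℕ, 1 ≤ n → v (n + 1) ≤ v n + D / (n + 1))
    (hmono : ∀ᶠ n : ℕ in atTop, v n ≤ v (n + 1)) (lam : ℕ) :
    ∃ C : ℝ, 0 ≤ C ∧ ∀ k n : ℕ, 1 ≤ k → k ≤ lam * n → v k ≤ v n + C := by
  obtain ⟨n₀, hn₀⟩ := eventually_atTop.1 hmono
  have hup : ∀ n : ℕ, 1 ≤ n → ∀ N : ℕ, n ≤ N → v N ≤ v n + D * (Real.log N - Real.log n) := by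
    intro n hn N hN
    induction N, hN using Nat.le_induction with
    | base => simp
    | succ N hN ih =>
      have hN0 : (0 : ℝ) < N := by exact_mod_cast (hn.trans hN)
      have h1 := hstep N (hn.trans hN)
      have h2 : 1 / ((N : ℝ) + 1) ≤ Real.log (N + 1 : ℝ) - Real.log N := by
        have := Real.one_sub_inv_le_log_of_pos (show 0 < ((N : ℝ) + 1) / N by positivity)
        rw [Real.log_div (by positivity) (by positivity)] at this
        refine le_trans (le_of_eq ?_) this
        field_simp
        ring
      have h3 : D / ((N : ℝ) + 1) ≤ D * (Real.log (N + 1 : ℝ) - Real.log N) := by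
        rw [div_eq_mul_one_div]; gcongr
      push_cast
      linarith
  have hmon : ∀ n : ℕ, n₀ ≤ n → ∀ N : ℕ, n ≤ N → v n ≤ v N := by
    intro n hn N hN
    induction N, hN using Nat.le_induction with
    | base => exact le_rfl
    | succ N hN ih => exact ih.trans (hn₀ N (hn.trans hN))
  set S := ∑ j ∈ Finset.range (n₀ + 1), |v j| with hS
  have hSj : ∀ j ≤ n₀, |v j| ≤ S := fun j hj =>
    Finset.single_le_sum (f := fun j => |v j|) (fun i _ => abs_nonneg _)
      (Finset.mem_range.2 (by lia))
  have hS0 : 0 ≤ S := Finset.sum_nonneg fun i _ => abs_nonneg _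
  have hL0 : 0 ≤ Real.log lam := Real.log_natCast_nonneg lam
  refine ⟨2 * S + D * Real.log lam, by positivity, fun k n hk hkn => ?_⟩
  have hDL : 0 ≤ D * Real.log lam := by positivity
  have hn1 : 1 ≤ n := by
    rcases Nat.eq_zero_or_pos n with h | h
    · subst h; lia
    · exact h
  rcases le_total n k with h | h
  · have h1 := hup n hn1 k h
    have h2 : Real.log k - Real.log n ≤ Real.log lam := by
      have hn0 : (0 : ℝ) < n := by exact_mod_cast hn1
      have hk0 : (0 : ℝ) < k := by exact_mod_cast hk
      have hl0 : (0 : ℝ) < lam := by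
        rcases Nat.eq_zero_or_pos lam with h | h
        · subst h; lia
        · exact_mod_cast h
      have h3 := Real.log_le_log hk0 (show (k : ℝ) ≤ lam * n by exact_mod_cast hkn)
      rw [Real.log_mul hl0.ne' hn0.ne'] at h3
      linarith
    have h3 := mul_le_mul_of_nonneg_left h2 hD
    linarith
  · rcases le_total n₀ k with h1 | h1
    · linarith [hmon k h1 n h]
    · have h2 := (abs_le.1 (hSj k h1)).2
      rcases le_total n₀ n with h3 | h3
      · have h4 := hmon n₀ le_rfl n h3
        have h5 := (abs_le.1 (hSj n₀ le_rfl)).1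
        linarith
      · have h5 := (abs_le.1 (hSj n h3)).1
        linarith

theorem IsRegularSeq.exists_log_root {M : ℕ → ℝ} (hM : IsRegularSeq M) :
    ∃ v : ℕ → ℝ, (∀ n : ℕ, 1 ≤ n → M n / n ! = Real.exp (v n) ^ n) ∧
      ∀ lam : ℕ, ∃ C : ℝ, 0 ≤ C ∧ ∀ k n : ℕ, 1 ≤ k → k ≤ lam * n → v k ≤ v n + C := by
  obtain ⟨hpos, m, hm, -, hmono, C, hC, hstep⟩ := hM
  have hm' : ∀ n, m n = M n / n ! := fun n => by rw [hm n]; field_simp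
  have hmpos : ∀ n, 0 < m n := fun n => by rw [hm' n]; exact div_pos (hpos n) (by positivity)
  refine ⟨fun n => Real.log (m n) / n, fun n hn => ?_, ?_⟩
  · have hn0 : (n : ℝ) ≠ 0 := by positivity
    rw [← hm', ← Real.exp_nat_mul, mul_div_cancel₀ _ hn0, Real.exp_log (hmpos n)]
  · refine exists_le_add_of_step (D := |Real.log C|) (abs_nonneg _) (fun n hn => ?_) ?_
    · have hn0 : (0 : ℝ) < n := by exact_mod_cast hn
      have h1 := Real.log_le_log (hmpos (n + 1)) (hstep n hn)
      rw [Real.log_mul hC.ne' (Real.rpow_pos_of_pos (hmpos n) _).ne',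
        Real.log_rpow (hmpos n)] at h1
      have h2 := le_abs_self (Real.log C)
      push_cast
      rw [div_le_iff₀ (by positivity)]
      calc Real.log (m (n + 1)) ≤ |Real.log C| + (1 + 1 / (n : ℝ)) * Real.log (m n) := by linarith
        _ = _ := by field_simp; ring
    · filter_upwards [hmono] with n hn
      have h1 := Real.log_le_log (Real.rpow_pos_of_pos (hmpos n) _) hn
      rw [Real.log_rpow (hmpos n), Real.log_rpow (hmpos (n + 1)), one_div_mul_eq_div,
        one_div_mul_eq_div] at h1
      exact_mod_cast h1

namespace IsHalfPlaneWeight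

variable {γ : ℂ → ℂ} {c B l : ℝ}

theorem exists_log_root (H : IsHalfPlaneWeight γ c B l) :
    ∃ v : ℕ → ℝ, (∀ n : ℕ, 1 ≤ n → weightSeq γ (n + 1) = Real.exp (v n) ^ n) ∧
      ∀ lam : ℕ, ∃ C : ℝ, 0 ≤ C ∧ ∀ k n : ℕ, 1 ≤ k → k ≤ lam * n → v k ≤ v n + C := by
  have hB := H.B_pos
  refine ⟨fun n => logRatio γ (n + 1) + logRatio γ (n + 1) / n, fun n hn => ?_, fun lam => ?_⟩
  · have hn0 : (n : ℝ) ≠ 0 := by positivity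
    rw [H.weightSeq_succ_eq_exp, ← Real.exp_nat_mul]
    congr 1
    field_simp
  · set q := |logRatio γ 1| with hq
    have hq0 : 0 ≤ q := abs_nonneg _
    have hL0 : 0 ≤ Real.log lam := Real.log_natCast_nonneg lam
    refine ⟨B * Real.log lam + (q + B) + q, by positivity, fun k n hk hkn => ?_⟩
    have hn1 : 1 ≤ n := by
      rcases Nat.eq_zero_or_pos n with h | h
      · subst h; lia
      · exact h
    have hl1 : 1 ≤ lam := by
      rcases Nat.eq_zero_or_pos lam with h | h
      · subst h; lia
      · exact h
    have hk0 : (1 : ℝ) ≤ k := by exact_mod_cast hk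
    have hn0 : (1 : ℝ) ≤ n := by exact_mod_cast hn1
    have hl0 : (1 : ℝ) ≤ lam := by exact_mod_cast hl1
    have h1 : logRatio γ (k + 1) ≤ logRatio γ (n + 1) + B * Real.log lam := by
      rcases le_total (k : ℝ) n with h | h
      · have := H.logRatio_mono (show (0 : ℝ) < k + 1 by positivity)
          (show (k : ℝ) + 1 ≤ n + 1 by linarith)
        have : 0 ≤ B * Real.log lam := by positivity
        linarith
      · have h2 := H.logRatio_sub_le (show (0 : ℝ) < n + 1 by positivity)
          (show (n : ℝ) + 1 ≤ k + 1 by linarith)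
        have h3 : (k : ℝ) + 1 ≤ lam * (n + 1) := by
          have : (k : ℝ) ≤ lam * n := by exact_mod_cast hkn
          linarith
        have h4 := Real.log_le_log (by positivity) h3
        rw [Real.log_mul (by positivity) (by positivity)] at h4
        have h5 : B * (Real.log (k + 1) - Real.log (n + 1)) ≤ B * Real.log lam := by
          gcongr; linarith
        linarith
    have h2 : logRatio γ (k + 1) / k ≤ q + B := by
      have h3 := H.logRatio_sub_le one_pos (show 1 ≤ (k : ℝ) + 1 by linarith)
      rw [Real.log_one, sub_zero] at h3
      have h4 := Real.log_le_sub_one_of_pos (show (0 : ℝ) < k + 1 by positivity)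
      have h5 : B * Real.log (k + 1) ≤ B * k := by gcongr; linarith
      have h6 := le_abs_self (logRatio γ 1)
      rw [div_le_iff₀ (by positivity)]
      nlinarith
    have h3 : -q ≤ logRatio γ (n + 1) / n := by
      have h4 := H.logRatio_mono one_pos (show 1 ≤ (n : ℝ) + 1 by linarith)
      have h5 := neg_abs_le (logRatio γ 1)
      rw [le_div_iff₀ (by positivity)]
      nlinarith
    linarith

/-- The roots `u_n = (M_n γ_{n+1} / n!) ^ (1 / n)` are quasi-increasing, up to bounded dilations of
the index. -/
theorem exists_root (H : IsHalfPlaneWeight γ c B l) {M : ℕ → ℝ} (hM : IsRegularSeq M) :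
    ∃ u : ℕ → ℝ, (∀ n, 0 < u n) ∧
      (∀ n : ℕ, 1 ≤ n → M n * weightSeq γ (n + 1) / n ! = u n ^ n) ∧
      ∀ lam : ℕ, ∃ C : ℝ, 1 ≤ C ∧ ∀ k n : ℕ, 1 ≤ k → k ≤ lam * n → u k ≤ C * u n := by
  obtain ⟨v, hv, hv'⟩ := hM.exists_log_root
  obtain ⟨w, hw, hw'⟩ := H.exists_log_root
  refine ⟨fun n => Real.exp (v n) * Real.exp (w n), fun n => by positivity, fun n hn => ?_,
    fun lam => ?_⟩
  · rw [mul_pow, ← hv n hn, ← hw n hn]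
    ring
  · obtain ⟨C₁, h1, h1'⟩ := hv' lam
    obtain ⟨C₂, h2, h2'⟩ := hw' lam
    refine ⟨Real.exp (C₁ + C₂), Real.one_le_exp (by positivity), fun k n hk hkn => ?_⟩
    change Real.exp (v k) * Real.exp (w k) ≤
      Real.exp (C₁ + C₂) * (Real.exp (v n) * Real.exp (w n))
    rw [← Real.exp_add, ← Real.exp_add, ← Real.exp_add]
    refine Real.exp_le_exp.2 ?_
    linarith [h1' k n hk hkn, h2' k n hk hkn]

end IsHalfPlaneWeight

/-! ### An interpolation inequality in a half-strip -/

/-- Two-constants estimate in the upper half of a half-strip: a bounded function that decays like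
`exp (N * Re ζ)` on the real axis decays at a proportionally slower rate inside the half-strip. -/
theorem norm_le_of_halfStrip_upper {h : ℂ → ℂ} {θ K N u₀ : ℝ} (hθ : 0 < θ) (hN : 0 ≤ N)
    (hK : 0 ≤ K)
    (hd : ∀ ζ : ℂ, ζ.re ≤ u₀ → 0 ≤ ζ.im → ζ.im ≤ θ → DifferentiableAt ℂ h ζ)
    (hb : ∀ ζ : ℂ, ζ.re ≤ u₀ → 0 ≤ ζ.im → ζ.im ≤ θ → ‖h ζ‖ ≤ K)
    (hreal : ∀ u : ℝ, u ≤ u₀ → ‖h u‖ ≤ K * Real.exp (N * (u - u₀)))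
    {ζ : ℂ} (h1 : ζ.re ≤ u₀) (h2 : 0 ≤ ζ.im) (h3 : ζ.im ≤ θ) :
    ‖h ζ‖ ≤ K * Real.exp (N * (ζ.re - u₀) * (1 - ζ.im / θ)) := by
  -- `Re q = N (Re ζ - u₀) (1 - Im ζ / θ)`
  set q : ℂ → ℂ := fun ζ => N * ((ζ - u₀) + Complex.I * (ζ - u₀) ^ 2 / (2 * θ)) with hq
  have hqre : ∀ ζ : ℂ, (q ζ).re = N * (ζ.re - u₀) * (1 - ζ.im / θ) := by
    intro ζ
    have e1 : Complex.I * (ζ - u₀) ^ 2 / (2 * θ) =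
        ((1 / (2 * θ) : ℝ) : ℂ) * (Complex.I * (ζ - u₀) ^ 2) := by
      push_cast; field_simp
    rw [hq]
    simp only [e1]
    rw [Complex.re_ofReal_mul, Complex.add_re, Complex.re_ofReal_mul]
    simp only [sq, Complex.sub_re, Complex.ofReal_re, Complex.mul_re, Complex.I_re, Complex.I_im,
      Complex.mul_im, Complex.sub_im, Complex.ofReal_im]
    field_simp
    ring
  have hsq : ∀ (ε : ℝ) (ζ : ℂ), (-(ε * (ζ - u₀) ^ 2) : ℂ).re =
      -(ε * ((ζ.re - u₀) ^ 2 - ζ.im ^ 2)) := by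
    intro ε ζ
    rw [Complex.neg_re, Complex.re_ofReal_mul]
    simp only [sq, Complex.mul_re, Complex.sub_re, Complex.ofReal_re, Complex.sub_im,
      Complex.ofReal_im]
    ring
  -- the damping factor `exp (-ε (ζ - u₀)²)` makes the maximum principle applicable
  have key : ∀ ε : ℝ, 0 < ε → ‖h ζ‖ * Real.exp (-(q ζ).re) *
      Real.exp (-(ε * ((ζ.re - u₀) ^ 2 - ζ.im ^ 2))) ≤ K * Real.exp (ε * θ ^ 2) := by
    intro ε hε
    set T := max (N / ε) (u₀ - ζ.re) + 1 with hT
    have hTN : N ≤ ε * T := by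
      have : N / ε ≤ T := (le_max_left _ _).trans (lt_add_one _).le
      rw [div_le_iff₀ hε] at this
      linarith
    have hTζ : u₀ - T < ζ.re := by
      have : u₀ - ζ.re < T := lt_of_le_of_lt (le_max_right _ _) (lt_add_one _)
      linarith
    have hT0 : 0 < T :=
      lt_of_le_of_lt (le_max_of_le_left (div_nonneg hN hε.le)) (lt_add_one _)
    set H : ℂ → ℂ := fun ζ => h ζ * Complex.exp (-q ζ) * Complex.exp (-(ε * (ζ - u₀) ^ 2)) with hH
    have hHn : ∀ ζ : ℂ, ‖H ζ‖ = ‖h ζ‖ * Real.exp (-(q ζ).re) *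
        Real.exp (-(ε * ((ζ.re - u₀) ^ 2 - ζ.im ^ 2))) := by
      intro ζ
      rw [hH]
      simp only [norm_mul, Complex.norm_exp, hsq, Complex.neg_re (q ζ)]
    set U : Set ℂ := Ioo (u₀ - T) u₀ ×ℂ Ioo 0 θ with hU
    have hcl : closure U = Icc (u₀ - T) u₀ ×ℂ Icc 0 θ := by
      rw [hU, Complex.closure_reProdIm, closure_Ioo (by linarith), closure_Ioo hθ.ne]
    have hUo : IsOpen U := isOpen_Ioo.reProdIm isOpen_Ioo
    have hbd : Bornology.IsBounded U :=
      (Metric.isBounded_Ioo _ _).reProdIm (Metric.isBounded_Ioo _ _)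
    rw [← hHn]
    refine Complex.norm_le_of_forall_mem_frontier_norm_le hbd (f := H) ?_ ?_
      (show ζ ∈ closure U by rw [hcl]; exact ⟨⟨hTζ.le, h1⟩, h2, h3⟩)
    · refine DifferentiableOn.diffContOnCl fun z hz => ?_
      rw [hcl] at hz
      have hz1 : z.re ∈ Icc (u₀ - T) u₀ := hz.1
      have hz2 : z.im ∈ Icc 0 θ := hz.2
      refine DifferentiableAt.differentiableWithinAt ?_
      have := hd z hz1.2 hz2.1 hz2.2
      have hqd : DifferentiableAt ℂ q z := by fun_prop
      fun_prop
    · intro z hz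
      rw [frontier, hUo.interior_eq, hcl] at hz
      have hz1 : z.re ∈ Icc (u₀ - T) u₀ := hz.1.1
      have hz2 : z.im ∈ Icc 0 θ := hz.1.2
      have hnot : ¬ (z.re ∈ Ioo (u₀ - T) u₀ ∧ z.im ∈ Ioo 0 θ) := hz.2
      have hsqle : z.im ^ 2 ≤ θ ^ 2 := pow_le_pow_left₀ hz2.1 hz2.2 2
      have hdamp : Real.exp (-(ε * ((z.re - u₀) ^ 2 - z.im ^ 2))) ≤ Real.exp (ε * θ ^ 2) := by
        refine Real.exp_le_exp.2 ?_
        nlinarith [sq_nonneg (z.re - u₀)]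
      have hhz := hb z hz1.2 hz2.1 hz2.2
      rw [hHn]
      have hmain : ‖h z‖ * Real.exp (-(q z).re) ≤ K →
          ‖h z‖ * Real.exp (-(q z).re) * Real.exp (-(ε * ((z.re - u₀) ^ 2 - z.im ^ 2))) ≤
            K * Real.exp (ε * θ ^ 2) := fun h => by gcongr
      by_cases hre0 : z.re = u₀
      · apply hmain
        rw [hqre, hre0]
        simpa using hhz
      by_cases him0 : z.im = 0
      · apply hmain
        have hzr : z = (z.re : ℂ) := Complex.ext rfl (by simpa using him0)
        have h4 := hreal z.re hz1.2
        rw [← hzr] at h4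
        rw [hqre, him0, zero_div, sub_zero, mul_one]
        calc _ ≤ K * Real.exp (N * (z.re - u₀)) * Real.exp (-(N * (z.re - u₀))) := by gcongr
          _ = K := by rw [mul_assoc, ← Real.exp_add]; simp
      by_cases himθ : z.im = θ
      · apply hmain
        rw [hqre, himθ, div_self hθ.ne']
        simpa using hhz
      have hreT : z.re = u₀ - T := by
        by_contra hne
        exact hnot ⟨⟨lt_of_le_of_ne hz1.1 (Ne.symm hne), lt_of_le_of_ne hz1.2 hre0⟩,
          lt_of_le_of_ne hz2.1 (Ne.symm him0), lt_of_le_of_ne hz2.2 himθ⟩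
      rw [mul_assoc, ← Real.exp_add, hqre, hreT]
      gcongr
      have h5 : N * T * (1 - z.im / θ) ≤ N * T := by
        have : 0 ≤ z.im / θ := div_nonneg hz2.1 hθ.le
        have : 0 ≤ N * T := by positivity
        nlinarith
      have h6 : N * T ≤ ε * T ^ 2 := by nlinarith
      have h7 : ε * z.im ^ 2 ≤ ε * θ ^ 2 := by gcongr
      linarith
  have hlim : ‖h ζ‖ * Real.exp (-(q ζ).re) ≤ K := by
    have t1 : Tendsto (fun ε : ℝ => ‖h ζ‖ * Real.exp (-(q ζ).re) *
        Real.exp (-(ε * ((ζ.re - u₀) ^ 2 - ζ.im ^ 2)))) (𝓝[>] 0)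
        (𝓝 (‖h ζ‖ * Real.exp (-(q ζ).re))) := by
      refine Tendsto.mono_left (Continuous.tendsto' (by fun_prop) _ _ (by simp)) nhdsWithin_le_nhds
    have t2 : Tendsto (fun ε : ℝ => K * Real.exp (ε * θ ^ 2)) (𝓝[>] 0) (𝓝 K) := by
      refine Tendsto.mono_left (Continuous.tendsto' (by fun_prop) _ _ (by simp)) nhdsWithin_le_nhds
    refine le_of_tendsto_of_tendsto t1 t2 ?_
    filter_upwards [self_mem_nhdsWithin] with ε hε using key ε hε
  rw [Real.exp_neg, ← div_eq_mul_inv, div_le_iff₀ (Real.exp_pos _), hqre] at hlim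
  exact hlim

/-- The two-constants estimate in a half-strip symmetric about the real axis. -/
theorem norm_le_of_halfStrip {h : ℂ → ℂ} {θ K N u₀ : ℝ} (hθ : 0 < θ) (hN : 0 ≤ N)
    (hK : 0 ≤ K)
    (hd : ∀ ζ : ℂ, ζ.re ≤ u₀ → |ζ.im| ≤ θ → DifferentiableAt ℂ h ζ)
    (hb : ∀ ζ : ℂ, ζ.re ≤ u₀ → |ζ.im| ≤ θ → ‖h ζ‖ ≤ K)
    (hreal : ∀ u : ℝ, u ≤ u₀ → ‖h u‖ ≤ K * Real.exp (N * (u - u₀)))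
    {ζ : ℂ} (h1 : ζ.re ≤ u₀) (h2 : |ζ.im| ≤ θ) :
    ‖h ζ‖ ≤ K * Real.exp (N * (ζ.re - u₀) * (1 - |ζ.im| / θ)) := by
  rcases le_total 0 ζ.im with h3 | h3
  · rw [abs_of_nonneg h3] at h2 ⊢
    exact norm_le_of_halfStrip_upper hθ hN hK
      (fun z hz1 hz2 hz3 => hd z hz1 (by rwa [abs_of_nonneg hz2]))
      (fun z hz1 hz2 hz3 => hb z hz1 (by rwa [abs_of_nonneg hz2])) hreal h1 h3 h2
  · rw [abs_of_nonpos h3] at h2 ⊢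
    have := norm_le_of_halfStrip_upper (h := fun z => starRingEnd ℂ (h (starRingEnd ℂ z)))
      (u₀ := u₀) (ζ := starRingEnd ℂ ζ) hθ hN hK (fun z hz1 hz2 hz3 => by
        have := hd (starRingEnd ℂ z) (by simpa using hz1) (by simpa [abs_of_nonneg hz2] using hz3)
        simpa [Function.comp_def] using this.conj_conj)
      (fun z hz1 hz2 hz3 => by
        have := hb (starRingEnd ℂ z) (by simpa using hz1) (by simpa [abs_of_nonneg hz2] using hz3)
        simpa using this)
      (fun u hu => by simpa using hreal u hu)
      (by simpa using h1) (by simpa using h3) (by simpa using h2)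
    simpa using this

/-! ### Taylor's formula and holomorphic extension to a strip -/

theorem hasDerivWithinAt_taylor_sum {s : Set ℝ} {D : ℕ → ℝ → ℂ}
    (hD : ∀ n, ∀ t ∈ s, HasDerivWithinAt (D n) (D (n + 1) t) s t) (x : ℝ) (N : ℕ) {t : ℝ}
    (ht : t ∈ s) :
    HasDerivWithinAt (fun t : ℝ => ∑ k ∈ Finset.range (N + 1), ((x - t : ℝ) : ℂ) ^ k / k ! * D k t)
      (((x - t : ℝ) : ℂ) ^ N / N ! * D (N + 1) t) s t := by
  have hlin : HasDerivWithinAt (fun t : ℝ => ((x - t : ℝ) : ℂ)) (-1) s t := by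
    have h1 : HasDerivAt (fun t : ℝ => x - t) (-1) t := by
      simpa using (hasDerivAt_id t).const_sub x
    simpa using h1.ofReal_comp.hasDerivWithinAt
  induction N with
  | zero => simpa using hD 0 t ht
  | succ N ih =>
    simp only [Finset.sum_range_succ _ (N + 1)]
    have h2 := ((hlin.pow (N + 1)).div_const ((N + 1)! : ℂ)).mul (hD (N + 1) t ht)
    refine (ih.add h2).congr_deriv ?_
    have hf : ((N + 1)! : ℂ) = (N + 1) * (N ! : ℂ) := by push_cast [Nat.factorial_succ]; ring
    have hN : (N ! : ℂ) ≠ 0 := by exact_mod_cast Nat.factorial_ne_zero N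
    have hN1 : (N : ℂ) + 1 ≠ 0 := by exact_mod_cast Nat.succ_ne_zero N
    simp only [hf, Nat.add_sub_cancel, Pi.pow_apply]
    push_cast
    field_simp
    ring

/-- Taylor's formula with a crude bound for the remainder, in terms of a sequence `D` of successive
derivatives. -/
theorem norm_sub_taylor_sum_le {s : Set ℝ} (hs : OrdConnected s) {D : ℕ → ℝ → ℂ}
    (hD : ∀ n, ∀ t ∈ s, HasDerivWithinAt (D n) (D (n + 1) t) s t) {x t₀ K : ℝ} (hx : x ∈ s)
    (ht₀ : t₀ ∈ s) (N : ℕ) (hK : ∀ t ∈ uIcc t₀ x, ‖D (N + 1) t‖ ≤ K) :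
    ‖D 0 x - ∑ k ∈ Finset.range (N + 1), ((x - t₀ : ℝ) : ℂ) ^ k / k ! * D k t₀‖ ≤
      K * |x - t₀| ^ (N + 1) / N ! := by
  have hsub : uIcc t₀ x ⊆ s := hs.uIcc_subset ht₀ hx
  have hK0 : 0 ≤ K := (norm_nonneg _).trans (hK x right_mem_uIcc)
  have h := (convex_uIcc t₀ x).norm_image_sub_le_of_norm_hasDerivWithin_le
    (C := K * |x - t₀| ^ N / N !)
    (fun t ht => (hasDerivWithinAt_taylor_sum hD x N (hsub ht)).mono hsub) (fun t ht => ?_)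
    left_mem_uIcc right_mem_uIcc
  · have e1 : ∑ k ∈ Finset.range (N + 1), ((x - x : ℝ) : ℂ) ^ k / k ! * D k x = D 0 x := by
      rw [Finset.sum_range_succ', Finset.sum_eq_zero fun k _ => by simp]
      simp
    rw [e1] at h
    refine h.trans (le_of_eq ?_)
    rw [Real.norm_eq_abs, pow_succ]
    ring
  · have h1 : |x - t| ≤ |x - t₀| := abs_sub_right_of_mem_uIcc ht
    rw [norm_mul, norm_div, norm_pow, Complex.norm_real, Complex.norm_natCast, Real.norm_eq_abs]
    have := hK t ht
    calc |x - t| ^ N / N ! * ‖D (N + 1) t‖ ≤ |x - t₀| ^ N / N ! * K := by gcongr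
      _ = _ := by ring

/-- A smooth function on a half-line whose `n`-th derivatives are `O(n! / R ^ n)` extends to a
holomorphic function in a half-strip of half-width `R`, bounded in smaller half-strips. -/
theorem exists_holomorphic_extension {x₀ C R : ℝ} (hR : 0 < R) {D : ℕ → ℝ → ℂ}
    (hD : ∀ n, ∀ t ∈ Iio x₀, HasDerivWithinAt (D n) (D (n + 1) t) (Iio x₀) t)
    (hb : ∀ n, ∀ t ∈ Iio x₀, ‖D n t‖ ≤ C * (n ! / R ^ n)) :
    ∃ G : ℂ → ℂ, (∀ ζ : ℂ, ζ.re < x₀ → |ζ.im| < R → DifferentiableAt ℂ G ζ) ∧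
      (∀ x : ℝ, x < x₀ → G x = D 0 x) ∧
      ∀ ζ : ℂ, ζ.re < x₀ → |ζ.im| < R → ‖G ζ‖ ≤ C * (1 - |ζ.im| / R)⁻¹ := by
  -- the Taylor series at `ξ`
  set F : ℝ → ℂ → ℂ := fun ξ ζ => ∑' n : ℕ, D n ξ / n ! * (ζ - ξ) ^ n with hF
  have hterm : ∀ (ξ : ℝ), ξ < x₀ → ∀ (ζ : ℂ) (r : ℝ), ‖ζ - ξ‖ ≤ r → ∀ n : ℕ,
      ‖D n ξ / n ! * (ζ - ξ) ^ n‖ ≤ C * (r / R) ^ n := by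
    intro ξ hξ ζ r hr n
    rw [norm_mul, norm_div, norm_pow, Complex.norm_natCast]
    have h1 := hb n ξ hξ
    have hC : 0 ≤ C * (n ! / R ^ n) := (norm_nonneg _).trans h1
    calc ‖D n ξ‖ / n ! * ‖ζ - ξ‖ ^ n ≤ C * (n ! / R ^ n) / n ! * r ^ n := by gcongr
      _ = _ := by rw [div_pow]; field_simp
  have hsumm : ∀ r : ℝ, 0 ≤ r → r < R → Summable fun n : ℕ => C * (r / R) ^ n := fun r hr hrR =>
    (summable_geometric_of_lt_one (by positivity) ((div_lt_one hR).2 hrR)).mul_left C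
  have hFd : ∀ ξ : ℝ, ξ < x₀ → DifferentiableOn ℂ (F ξ) (Metric.ball (ξ : ℂ) R) := by
    intro ξ hξ ζ hζ
    rw [mem_ball_iff_norm] at hζ
    obtain ⟨r, hr1, hr2⟩ := exists_between hζ
    have hr0 : 0 ≤ r := (norm_nonneg _).trans hr1.le
    have h1 : DifferentiableOn ℂ (F ξ) (Metric.ball (ξ : ℂ) r) :=
      Complex.differentiableOn_tsum_of_summable_norm (hsumm r hr0 hr2)
        (fun n => by fun_prop) Metric.isOpen_ball
        (fun n w hw => hterm ξ hξ w r (mem_ball_iff_norm.1 hw).le n)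
    exact (h1.differentiableAt
      (Metric.isOpen_ball.mem_nhds (mem_ball_iff_norm.2 hr1))).differentiableWithinAt
  have hFreal : ∀ ξ : ℝ, ξ < x₀ → ∀ x : ℝ, x < x₀ → |x - ξ| < R → F ξ x = D 0 x := by
    intro ξ hξ x hx hxξ
    have hnorm : ‖(x : ℂ) - ξ‖ = |x - ξ| := by
      rw [← Complex.ofReal_sub, Complex.norm_real, Real.norm_eq_abs]
    have hS : Summable fun n : ℕ => D n ξ / n ! * ((x : ℂ) - ξ) ^ n :=
      Summable.of_norm_bounded (hsumm _ (abs_nonneg _) hxξ) (hterm ξ hξ x _ hnorm.le)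
    have h1 := (hS.hasSum.tendsto_sum_nat).comp (tendsto_add_atTop_nat 1)
    refine tendsto_nhds_unique h1 ?_
    rw [tendsto_iff_norm_sub_tendsto_zero]
    have hlt : |x - ξ| / R < 1 := (div_lt_one hR).2 hxξ
    have hz : Tendsto (fun N : ℕ => C * (((N + 1 : ℕ) : ℝ) * (|x - ξ| / R) ^ (N + 1))) atTop
        (𝓝 0) := by
      have := (tendsto_self_mul_const_pow_of_lt_one (by positivity) hlt).comp
        (tendsto_add_atTop_nat 1)
      simpa using this.const_mul C
    refine squeeze_zero (fun _ => norm_nonneg _) (fun N => ?_) hz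
    have h2 := norm_sub_taylor_sum_le ordConnected_Iio hD (x := x) (t₀ := ξ)
      (K := C * ((N + 1)! / R ^ (N + 1))) hx hξ N (fun t ht => hb _ t
        (ordConnected_Iio.uIcc_subset hξ hx ht))
    rw [norm_sub_rev]
    simp only [Function.comp_apply]
    have e1 : ∑ k ∈ Finset.range (N + 1), D k ξ / k ! * ((x : ℂ) - ξ) ^ k =
        ∑ k ∈ Finset.range (N + 1), ((x - ξ : ℝ) : ℂ) ^ k / k ! * D k ξ := by
      refine Finset.sum_congr rfl fun k _ => ?_
      push_cast
      ring
    rw [e1]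
    refine h2.trans (le_of_eq ?_)
    rw [Nat.factorial_succ, div_pow]
    push_cast
    field_simp
  -- Taylor series at nearby points agree where both converge
  have hagree : ∀ ξ₀ ξ₁ : ℝ, ξ₀ < x₀ → ξ₁ < x₀ → |ξ₀ - ξ₁| < R → ∀ ζ : ℂ, ‖ζ - ξ₀‖ < R →
      ‖ζ - ξ₁‖ < R → F ξ₀ ζ = F ξ₁ ζ := by
    intro ξ₀ ξ₁ h0 h1 h01 ζ hζ0 hζ1
    set U := Metric.ball (ξ₀ : ℂ) R ∩ Metric.ball (ξ₁ : ℂ) R with hU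
    have hUo : IsOpen U := Metric.isOpen_ball.inter Metric.isOpen_ball
    have hUc : IsPreconnected U := ((convex_ball _ _).inter (convex_ball _ _)).isPreconnected
    have hmem : (ξ₀ : ℂ) ∈ U := by
      refine ⟨Metric.mem_ball_self hR, ?_⟩
      rw [mem_ball_iff_norm, ← Complex.ofReal_sub, Complex.norm_real]
      exact h01
    refine ((hFd ξ₀ h0).mono inter_subset_left).analyticOnNhd hUo
      |>.eqOn_of_preconnected_of_frequently_eq
      (((hFd ξ₁ h1).mono inter_subset_right).analyticOnNhd hUo) hUc hmem ?_
      ⟨mem_ball_iff_norm.2 hζ0, mem_ball_iff_norm.2 hζ1⟩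
    have ht : Tendsto (fun x : ℝ => (x : ℂ)) (𝓝[≠] ξ₀) (𝓝[≠] (ξ₀ : ℂ)) := by
      refine tendsto_nhdsWithin_iff.2 ⟨?_, ?_⟩
      · exact (Complex.continuous_ofReal.tendsto ξ₀).mono_left nhdsWithin_le_nhds
      · filter_upwards [self_mem_nhdsWithin] with y hy
        simpa using hy
    refine ht.frequently (Eventually.frequently ?_)
    have e1 : ∀ᶠ x : ℝ in 𝓝[≠] ξ₀, x < x₀ :=
      (eventually_lt_nhds h0).filter_mono nhdsWithin_le_nhds
    have e2 : ∀ᶠ x : ℝ in 𝓝[≠] ξ₀, |x - ξ₀| < R := by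
      refine Eventually.filter_mono nhdsWithin_le_nhds ?_
      exact (Continuous.tendsto' (by fun_prop) ξ₀ 0 (by simp)).eventually (gt_mem_nhds hR)
    have e3 : ∀ᶠ x : ℝ in 𝓝[≠] ξ₀, |x - ξ₁| < R := by
      refine Eventually.filter_mono nhdsWithin_le_nhds ?_
      exact (Continuous.tendsto (by fun_prop : Continuous fun x : ℝ => |x - ξ₁|) ξ₀).eventually
        (gt_mem_nhds h01)
    filter_upwards [e1, e2, e3] with x h3 h4 h5
    rw [hFreal ξ₀ h0 x h3 h4, hFreal ξ₁ h1 x h3 h5]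
  have hnim : ∀ ζ : ℂ, ‖ζ - (ζ.re : ℂ)‖ = |ζ.im| := by
    intro ζ
    have : ζ - (ζ.re : ℂ) = (ζ.im : ℂ) * Complex.I := by
      apply Complex.ext <;> simp
    rw [this, norm_mul, Complex.norm_I, mul_one, Complex.norm_real, Real.norm_eq_abs]
  refine ⟨fun ζ => F ζ.re ζ, fun ζ₀ h1 h2 => ?_, fun x hx => ?_, fun ζ h1 h2 => ?_⟩
  · have h3 : DifferentiableAt ℂ (F ζ₀.re) ζ₀ := by
      refine (hFd ζ₀.re h1).differentiableAt (Metric.isOpen_ball.mem_nhds ?_)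
      rw [mem_ball_iff_norm, hnim]
      exact h2
    refine h3.congr_of_eventuallyEq ?_
    have e1 : ∀ᶠ ζ : ℂ in 𝓝 ζ₀, ζ.re < x₀ :=
      (Complex.continuous_re.tendsto ζ₀).eventually (gt_mem_nhds h1)
    have e2 : ∀ᶠ ζ : ℂ in 𝓝 ζ₀, |ζ.im| < R :=
      (Complex.continuous_im.abs.tendsto ζ₀).eventually (gt_mem_nhds h2)
    have e3 : ∀ᶠ ζ : ℂ in 𝓝 ζ₀, ‖ζ - (ζ₀.re : ℂ)‖ < R :=
      (Continuous.tendsto (by fun_prop : Continuous fun ζ : ℂ => ‖ζ - (ζ₀.re : ℂ)‖) ζ₀).eventually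
        (gt_mem_nhds (by rw [hnim]; exact h2))
    have e4 : ∀ᶠ ζ : ℂ in 𝓝 ζ₀, |ζ.re - ζ₀.re| < R :=
      (Continuous.tendsto' (by fun_prop : Continuous fun ζ : ℂ => |ζ.re - ζ₀.re|) ζ₀ 0
        (by simp)).eventually (gt_mem_nhds hR)
    filter_upwards [e1, e2, e3, e4] with ζ h4 h5 h6 h7
    exact hagree _ _ h4 h1 h7 ζ (by rw [hnim]; exact h5) h6
  · simpa using hFreal x hx x hx (by simpa using hR)
  · have h3 := tsum_of_norm_bounded
      ((hasSum_geometric_of_lt_one (by positivity) ((div_lt_one hR).2 h2)).mul_left C)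
      (hterm ζ.re h1 ζ |ζ.im| (hnim ζ).le)
    exact h3

/-! ### Taylor remainders in sectors -/

theorem Finset.sum_range_eq_head_add_Ico {a : ℕ → ℂ} {N : ℕ} (hN : 1 ≤ N) :
    ∑ k ∈ Finset.range N, a k = a 0 + ∑ k ∈ Finset.Ico 1 N, a k := by
  rw [Finset.range_eq_Ico, Finset.sum_eq_sum_Ico_succ_bot (by lia)]

theorem norm_sum_Ico_mul_pow_le {b : ℕ → ℂ} {w : ℕ → ℝ} (hw : ∀ n, 0 < w n)
    (hb : ∀ k : ℕ, 1 ≤ k → ‖b k‖ ≤ w k ^ k) {N : ℕ} {C : ℝ} (hC : 1 ≤ C)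
    (hqm : ∀ k : ℕ, 1 ≤ k → k ≤ N → w k ≤ C * w N) (z : ℂ) :
    ‖∑ k ∈ Finset.Ico 1 N, b k * z ^ k‖ ≤ (2 * C) ^ N * max 1 (w N * ‖z‖) ^ N := by
  have hmax : 1 ≤ max 1 (w N * ‖z‖) := le_max_left _ _
  have hterm : ∀ k ∈ Finset.Ico 1 N, ‖b k * z ^ k‖ ≤ C ^ N * max 1 (w N * ‖z‖) ^ N := by
    intro k hk
    rw [Finset.mem_Ico] at hk
    have hwN := hw N
    have hwk := hw k
    rw [norm_mul, norm_pow]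
    calc ‖b k‖ * ‖z‖ ^ k ≤ w k ^ k * ‖z‖ ^ k := by gcongr; exact hb k hk.1
      _ ≤ (C * w N) ^ k * ‖z‖ ^ k := by gcongr; exact hqm k hk.1 hk.2.le
      _ = C ^ k * (w N * ‖z‖) ^ k := by rw [mul_pow, mul_pow]; ring
      _ ≤ C ^ k * max 1 (w N * ‖z‖) ^ k := by gcongr; exact le_max_right _ _
      _ ≤ C ^ N * max 1 (w N * ‖z‖) ^ N := by gcongr <;> first | assumption | exact hk.2.le
  refine (norm_sum_le_of_le _ hterm).trans ?_
  rw [Finset.sum_const, nsmul_eq_mul, Nat.card_Ico, mul_pow, mul_assoc]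
  gcongr
  have h1 : N - 1 ≤ 2 ^ N := (Nat.sub_le _ _).trans Nat.lt_two_pow_self.le
  exact_mod_cast h1

/-- Taylor remainder estimates on the positive ray propagate to sectors. If `F` is bounded and
holomorphic in a sector `|arg z| ≤ θ₂` and its Taylor remainders on the positive ray are at most
`(w_n x) ^ n`, where `w` is quasi-increasing up to bounded dilations of the index, then they are
`O((C w_n |z|) ^ n)` in smaller sectors.

For `|z| ≥ c / w_n` the estimate is trivial. For smaller `|z|` the remainder of order `N` is
interpolated between the positive ray and the boundary of the sector, which costs a factor
`1 - θ₁ / θ₂` in the exponent; this is compensated by taking `N ≥ n / (1 - θ₁ / θ₂)`. -/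
theorem exists_norm_sub_sum_le_of_sector {F : ℂ → ℂ} {b : ℕ → ℂ} {w : ℕ → ℝ} {r θ₁ θ₂ K₀ : ℝ}
    (hθ₁ : 0 ≤ θ₁) (hθ₂ : θ₁ < θ₂) (hpi : θ₂ < Real.pi) (hK₀ : 1 ≤ K₀)
    (hd : ∀ z : ℂ, z ≠ 0 → ‖z‖ < r → |Complex.arg z| ≤ θ₂ → DifferentiableAt ℂ F z)
    (hF : ∀ z : ℂ, z ≠ 0 → ‖z‖ < r → |Complex.arg z| ≤ θ₂ → ‖F z‖ ≤ K₀)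
    (hb0 : ‖b 0‖ ≤ K₀) (hb : ∀ k : ℕ, 1 ≤ k → ‖b k‖ ≤ w k ^ k)
    (hreal : ∀ n : ℕ, 1 ≤ n → ∀ x : ℝ, 0 < x → x < r →
      ‖F x - ∑ k ∈ Finset.range n, b k * (x : ℂ) ^ k‖ ≤ (w n * x) ^ n)
    (hw : ∀ n, 0 < w n) (hwr : ∀ n : ℕ, 1 ≤ n → 1 / w n < r)
    (hqm : ∀ lam : ℕ, ∃ C : ℝ, 1 ≤ C ∧ ∀ k n : ℕ, 1 ≤ k → k ≤ lam * n → w k ≤ C * w n) :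
    ∃ C : ℝ, 1 ≤ C ∧ ∀ n : ℕ, 1 ≤ n → ∀ z : ℂ, z ≠ 0 → ‖z‖ < r → |Complex.arg z| ≤ θ₁ →
      ‖F z - ∑ k ∈ Finset.range n, b k * z ^ k‖ ≤ C ^ (n + 1) * w n ^ n * ‖z‖ ^ n := by
  have hθ20 : 0 < θ₂ := hθ₁.trans_lt hθ₂
  set t := θ₁ / θ₂ with ht
  have ht1 : t < 1 := (div_lt_one hθ20).2 hθ₂
  obtain ⟨lam, hlam⟩ := exists_nat_ge (1 / (1 - t))
  have hlam' : 1 ≤ lam * (1 - t) := by rwa [div_le_iff₀ (by linarith)] at hlam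
  have hlam1 : 1 ≤ lam := by
    rcases Nat.eq_zero_or_pos lam with h | h
    · subst h; norm_num at hlam'
    · exact h
  obtain ⟨C, hC, hqm⟩ := hqm lam
  have hC0 : 0 < C := by linarith
  -- the crude estimate
  have hcrude : ∀ N : ℕ, 1 ≤ N → ∀ z : ℂ, z ≠ 0 → ‖z‖ < r → |Complex.arg z| ≤ θ₂ →
      ‖F z - ∑ k ∈ Finset.range N, b k * z ^ k‖ ≤
        3 * K₀ * (2 * C) ^ N * max 1 (w N * ‖z‖) ^ N := by
    intro N hN z hz hzr harg
    have h1 := norm_sum_Ico_mul_pow_le hw hb hC (fun k hk1 hk2 => hqm k N hk1 (by nlinarith)) z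
    have h2 := hF z hz hzr harg
    rw [Finset.sum_range_eq_head_add_Ico (a := fun k => b k * z ^ k) hN]
    have h3 : ‖F z - (b 0 * z ^ 0 + ∑ k ∈ Finset.Ico 1 N, b k * z ^ k)‖ ≤
        ‖F z‖ + (‖b 0‖ + ‖∑ k ∈ Finset.Ico 1 N, b k * z ^ k‖) := by
      refine (norm_sub_le _ _).trans ?_
      gcongr
      refine (norm_add_le _ _).trans ?_
      simp
    have h4 : 1 ≤ (2 * C) ^ N * max 1 (w N * ‖z‖) ^ N :=
      one_le_mul_of_one_le_of_one_le (one_le_pow₀ (by linarith)) (one_le_pow₀ (le_max_left _ _))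
    set X := (2 * C) ^ N * max 1 (w N * ‖z‖) ^ N
    have h5 : 3 * K₀ * (2 * C) ^ N * max 1 (w N * ‖z‖) ^ N = 3 * K₀ * X := by ring
    rw [h5]
    nlinarith
  -- the interpolated estimate
  have hinter : ∀ N : ℕ, 1 ≤ N → ∀ z : ℂ, z ≠ 0 → w N * ‖z‖ ≤ 1 → |Complex.arg z| ≤ θ₁ →
      ‖F z - ∑ k ∈ Finset.range N, b k * z ^ k‖ ≤
        3 * K₀ * (2 * C) ^ N * Real.exp (N * Real.log (w N * ‖z‖) * (1 - t)) := by
    intro N hN z hz hzw harg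
    have hwN := hw N
    have hz0 : 0 < ‖z‖ := norm_pos_iff.2 hz
    set u₀ := Real.log (1 / w N) with hu₀
    have heu : Real.exp u₀ = 1 / w N := Real.exp_log (by positivity)
    have hexp : ∀ ζ : ℂ, ζ.re ≤ u₀ → |ζ.im| ≤ θ₂ → Complex.exp ζ ≠ 0 ∧
        ‖Complex.exp ζ‖ < r ∧ |Complex.arg (Complex.exp ζ)| ≤ θ₂ ∧
          w N * ‖Complex.exp ζ‖ ≤ 1 := by
      intro ζ h1 h2
      have h3 : ‖Complex.exp ζ‖ ≤ 1 / w N := by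
        rw [Complex.norm_exp, ← heu]
        exact Real.exp_le_exp.2 h1
      have h4 := abs_le.1 h2
      refine ⟨Complex.exp_ne_zero _, h3.trans_lt (hwr N hN), ?_, ?_⟩
      · rw [Complex.arg_exp, toIocMod_eq_self _ |>.2]
        · exact h2
        · constructor <;> linarith
      · rw [le_div_iff₀ hwN] at h3
        linarith
    set h : ℂ → ℂ := fun ζ =>
      F (Complex.exp ζ) - ∑ k ∈ Finset.range N, b k * Complex.exp ζ ^ k with hh
    have hmain := norm_le_of_halfStrip (h := h) (θ := θ₂) (K := 3 * K₀ * (2 * C) ^ N) (N := N)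
      (u₀ := u₀) (ζ := Complex.log z) hθ20 (Nat.cast_nonneg N) (by positivity)
      (fun ζ h1 h2 => by
        obtain ⟨e1, e2, e3, -⟩ := hexp ζ h1 h2
        have := (hd _ e1 e2 e3).comp ζ Complex.differentiableAt_exp
        refine this.sub ?_
        fun_prop)
      (fun ζ h1 h2 => by
        obtain ⟨e1, e2, e3, e4⟩ := hexp ζ h1 h2
        have := hcrude N hN _ e1 e2 e3
        rwa [max_eq_left e4, one_pow, mul_one] at this)
      (fun u hu => by
        have hupos := Real.exp_pos u
        have hur : Real.exp u < r :=
          lt_of_le_of_lt (by rw [← heu]; exact Real.exp_le_exp.2 hu) (hwr N hN)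
        have h1 := hreal N hN _ hupos hur
        have h2 : (w N * Real.exp u) ^ N = Real.exp (N * (u - u₀)) := by
          rw [Real.exp_nat_mul, Real.exp_sub, heu]
          congr 1
          field_simp
        rw [h2] at h1
        have h3 : 1 ≤ 3 * K₀ * (2 * C) ^ N :=
          one_le_mul_of_one_le_of_one_le (by linarith) (one_le_pow₀ (by linarith))
        rw [Complex.ofReal_exp] at h1
        refine h1.trans ?_
        exact le_mul_of_one_le_left (Real.exp_pos _).le h3)
      (by
        rw [Complex.log_re, hu₀]
        refine Real.log_le_log hz0 ?_
        rw [le_div_iff₀ hwN]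
        linarith)
      (by rw [Complex.log_im]; linarith)
    simp only [hh, Complex.exp_log hz, Complex.log_re, Complex.log_im] at hmain
    refine hmain.trans ?_
    have e1 : Real.log ‖z‖ - u₀ = Real.log (w N * ‖z‖) := by
      rw [hu₀, one_div, Real.log_inv, Real.log_mul hwN.ne' hz0.ne']
      ring
    rw [e1]
    have hlog : Real.log (w N * ‖z‖) ≤ 0 := Real.log_nonpos (by positivity) hzw
    have h5 : |Complex.arg z| / θ₂ ≤ t := by rw [ht]; gcongr
    gcongr ?_ * Real.exp ?_
    refine mul_le_mul_of_nonpos_left (by linarith) ?_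
    exact mul_nonpos_of_nonneg_of_nonpos (Nat.cast_nonneg N) hlog
  have hlamR : (1 : ℝ) ≤ lam := by exact_mod_cast hlam1
  have hbig : 1 ≤ (2 * C) ^ lam := one_le_pow₀ (by linarith)
  refine ⟨(3 * K₀ + lam) * (2 * C) ^ lam * (2 * C), ?_, fun n hn z hz hzr harg => ?_⟩
  · have h1 : 1 ≤ (3 * K₀ + lam) * (2 * C) ^ lam :=
      one_le_mul_of_one_le_of_one_le (by linarith) hbig
    exact one_le_mul_of_one_le_of_one_le h1 (by linarith)
  have hwn := hw n
  have hz0 : 0 < ‖z‖ := norm_pos_iff.2 hz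
  set P := (3 * K₀ + lam) * (2 * C) ^ lam with hP
  have hP1 : 1 ≤ P := one_le_mul_of_one_le_of_one_le (by linarith) hbig
  have hPn : (P * (2 * C)) ^ (n + 1) * w n ^ n * ‖z‖ ^ n =
      P * (2 * C) * P ^ n * 2 ^ n * (C * (w n * ‖z‖)) ^ n := by
    simp only [mul_pow, pow_succ]; ring
  rw [hPn]
  rcases le_total 1 (C * (w n * ‖z‖)) with hcase | hcase
  · have h1 := hcrude n hn z hz hzr (harg.trans hθ₂.le)
    have h2 : max 1 (w n * ‖z‖) ≤ C * (w n * ‖z‖) :=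
      max_le hcase (le_mul_of_one_le_left (by positivity) hC)
    have h3 : (2 * C) ^ n ≤ P ^ n * 2 ^ n := by
      rw [← mul_pow]
      refine pow_le_pow_left₀ (by positivity) ?_ n
      have h4 : C ≤ (2 * C) ^ lam := by
        calc C ≤ (2 * C) ^ 1 := by linarith
          _ ≤ _ := pow_le_pow_right₀ (by linarith) hlam1
      have h5 : (2 * C) ^ lam ≤ P := le_mul_of_one_le_left (by positivity) (by linarith)
      linarith
    have h4 : 3 * K₀ ≤ P * (2 * C) := by
      have h5 : 3 * K₀ + lam ≤ P := le_mul_of_one_le_right (by positivity) hbig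
      nlinarith
    calc _ ≤ 3 * K₀ * (2 * C) ^ n * max 1 (w n * ‖z‖) ^ n := h1
      _ ≤ P * (2 * C) * (P ^ n * 2 ^ n) * (C * (w n * ‖z‖)) ^ n := by gcongr
      _ = _ := by ring
  · set N := lam * n with hN
    have hnN : n ≤ N := Nat.le_mul_of_pos_left n hlam1
    have hN1 : 1 ≤ N := hn.trans hnN
    have hwN := hw N
    have hwNle : w N * ‖z‖ ≤ C * (w n * ‖z‖) := by
      rw [← mul_assoc]
      gcongr
      exact hqm N n hN1 le_rfl
    have h1 := hinter N hN1 z hz (hwNle.trans hcase) harg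
    have h2 : Real.exp (N * Real.log (w N * ‖z‖) * (1 - t)) ≤ (C * (w n * ‖z‖)) ^ n := by
      have hlog : Real.log (w N * ‖z‖) ≤ 0 := Real.log_nonpos (by positivity) (hwNle.trans hcase)
      calc _ ≤ Real.exp (n * Real.log (w N * ‖z‖)) := by
            refine Real.exp_le_exp.2 ?_
            have h3 : (n : ℝ) ≤ N * (1 - t) := by
              rw [hN]; push_cast
              have : (0 : ℝ) ≤ n := Nat.cast_nonneg n
              nlinarith
            have := mul_le_mul_of_nonpos_right h3 hlog
            linarith
        _ = (w N * ‖z‖) ^ n := by rw [Real.exp_nat_mul, Real.exp_log (by positivity)]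
        _ ≤ _ := by gcongr
    have h3 : ‖∑ k ∈ Finset.Ico n N, b k * z ^ k‖ ≤ lam * 2 ^ n * (C * (w n * ‖z‖)) ^ n := by
      have hterm : ∀ k ∈ Finset.Ico n N, ‖b k * z ^ k‖ ≤ (C * (w n * ‖z‖)) ^ n := by
        intro k hk
        rw [Finset.mem_Ico] at hk
        have hwk := hw k
        have hk1 : 1 ≤ k := hn.trans hk.1
        rw [norm_mul, norm_pow]
        calc ‖b k‖ * ‖z‖ ^ k ≤ w k ^ k * ‖z‖ ^ k := by gcongr; exact hb k hk1
          _ ≤ (C * w n) ^ k * ‖z‖ ^ k := by gcongr; exact hqm k n hk1 hk.2.le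
          _ = (C * (w n * ‖z‖)) ^ k := by rw [← mul_pow]; ring
          _ ≤ _ := pow_le_pow_of_le_one (by positivity) hcase hk.1
      refine (norm_sum_le_of_le _ hterm).trans ?_
      rw [Finset.sum_const, nsmul_eq_mul, Nat.card_Ico]
      gcongr
      have h4 : N - n ≤ lam * 2 ^ n :=
        (Nat.sub_le _ _).trans (Nat.mul_le_mul_left _ Nat.lt_two_pow_self.le)
      exact_mod_cast h4
    have h4 : F z - ∑ k ∈ Finset.range n, b k * z ^ k =
        (F z - ∑ k ∈ Finset.range N, b k * z ^ k) + ∑ k ∈ Finset.Ico n N, b k * z ^ k := by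
      rw [← Finset.sum_range_add_sum_Ico _ hnN]
      ring
    rw [h4]
    set Y := (C * (w n * ‖z‖)) ^ n with hY
    have hY0 : 0 ≤ Y := by positivity
    have h5 : (2 * C) ^ N = ((2 * C) ^ lam) ^ n := by rw [hN, pow_mul]
    have hlamP : (2 * C) ^ lam ≤ P := le_mul_of_one_le_left (by positivity) (by linarith)
    have h6 : (2 * C) ^ N ≤ P ^ n * 2 ^ n := by
      rw [h5]
      calc ((2 * C) ^ lam) ^ n ≤ P ^ n := by gcongr
        _ ≤ _ := le_mul_of_one_le_right (by positivity) (one_le_pow₀ (by norm_num))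
    have h7 : (2 : ℝ) ^ n ≤ P ^ n * 2 ^ n := le_mul_of_one_le_left (by positivity)
      (one_le_pow₀ hP1)
    have h8 : 3 * K₀ + lam ≤ P * (2 * C) := by
      have h9 : 3 * K₀ + lam ≤ P := le_mul_of_one_le_right (by positivity) hbig
      nlinarith
    calc _ ≤ 3 * K₀ * (2 * C) ^ N * Y + lam * 2 ^ n * Y := by
          refine (norm_add_le _ _).trans (add_le_add (h1.trans ?_) h3)
          gcongr
      _ ≤ 3 * K₀ * (P ^ n * 2 ^ n) * Y + lam * (P ^ n * 2 ^ n) * Y := by gcongr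
      _ = (3 * K₀ + lam) * (P ^ n * 2 ^ n) * Y := by ring
      _ ≤ P * (2 * C) * (P ^ n * 2 ^ n) * Y := by gcongr
      _ = _ := by ring

/-! ### From germs on the half-line to functions on `Ω_η(γ)` -/

theorem ContDiffOn.hasDerivWithinAt_iteratedDerivWithin {f : ℝ → ℂ} {s : Set ℝ}
    (hf : ContDiffOn ℝ ∞ f s) (hs : UniqueDiffOn ℝ s) (n : ℕ) {x : ℝ} (hx : x ∈ s) :
    HasDerivWithinAt (iteratedDerivWithin n f s) (iteratedDerivWithin (n + 1) f s x) s x := by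
  rw [iteratedDerivWithin_succ]
  exact (hf.differentiableOn_iteratedDerivWithin (by exact_mod_cast WithTop.coe_lt_top n) hs x
    hx).hasDerivWithinAt

/-- If the derivatives of `f (exp ξ)` are bounded by `C * n! / R ^ n` for `exp ξ < r`, then `f`
extends to a holomorphic function in a sector of opening `2 * min R π`. -/
theorem exists_sector_extension {f : ℝ → ℂ} {a r C R : ℝ} (hr : 0 < r) (hra : r ≤ a) (hR : 0 < R)
    (hf : ContDiffOn ℝ ∞ f (Ico 0 a))
    (hb : ∀ n : ℕ, ∀ ξ : ℝ, Real.exp ξ < r →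
      ‖iteratedDerivWithin n (fun v : ℝ => f (Real.exp v)) (Real.exp ⁻¹' Ico 0 a) ξ‖ ≤
        C * (n ! / R ^ n)) :
    ∃ F : ℂ → ℂ, (∀ x ∈ Ico 0 r, F (x : ℝ) = f x) ∧
      ∀ z : ℂ, z ≠ 0 → ‖z‖ < r → |Complex.arg z| < R → |Complex.arg z| < Real.pi →
        AnalyticAt ℂ F z ∧ ‖F z‖ ≤ C * (1 - |Complex.arg z| / R)⁻¹ := by
  set I : Set ℝ := Real.exp ⁻¹' Ico 0 a with hI
  have hIopen : IsOpen I := by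
    have : I = Real.exp ⁻¹' Iio a := by
      ext x
      simp [hI, Real.exp_nonneg]
    rw [this]
    exact isOpen_Iio.preimage Real.continuous_exp
  have hg : ContDiffOn ℝ ∞ (fun v : ℝ => f (Real.exp v)) I :=
    hf.comp Real.contDiff_exp.contDiffOn fun v hv => hv
  have hlt : ∀ t : ℝ, t < Real.log r ↔ Real.exp t < r := fun t => Real.lt_log_iff_exp_lt hr
  have hsub : Iio (Real.log r) ⊆ I := fun t ht =>
    ⟨(Real.exp_pos t).le, ((hlt t).1 ht).trans_le hra⟩
  obtain ⟨G, hG1, hG2, hG3⟩ := exists_holomorphic_extension (x₀ := Real.log r) hR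
    (D := fun n => iteratedDerivWithin n (fun v : ℝ => f (Real.exp v)) I)
    (fun n t ht => (hg.hasDerivWithinAt_iteratedDerivWithin hIopen.uniqueDiffOn n
      (hsub ht)).mono hsub)
    (fun n t ht => hb n t ((hlt t).1 ht))
  have hGan : ∀ ζ : ℂ, ζ.re < Real.log r → |ζ.im| < R → AnalyticAt ℂ G ζ := by
    intro ζ h1 h2
    have hopen : IsOpen {ζ : ℂ | ζ.re < Real.log r ∧ |ζ.im| < R} :=
      (isOpen_lt Complex.continuous_re continuous_const).inter
        (isOpen_lt Complex.continuous_im.abs continuous_const)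
    exact DifferentiableOn.analyticAt (s := {ζ : ℂ | ζ.re < Real.log r ∧ |ζ.im| < R})
      (fun w hw => (hG1 w hw.1 hw.2).differentiableWithinAt) (hopen.mem_nhds ⟨h1, h2⟩)
  refine ⟨fun z => if z = 0 then f 0 else G (Complex.log z), fun x hx => ?_,
    fun z hz hzr hargR hargpi => ?_⟩
  · rcases hx.1.eq_or_lt with h | h
    · subst h; simp
    · have hx0 : (x : ℂ) ≠ 0 := by exact_mod_cast h.ne'
      simp only [if_neg hx0]
      rw [← Complex.ofReal_log hx.1, hG2 _ (Real.log_lt_log h hx.2)]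
      simp [Real.exp_log h]
  · have h1 : (Complex.log z).re < Real.log r := by
      rw [Complex.log_re]
      exact Real.log_lt_log (norm_pos_iff.2 hz) hzr
    have h2 : |(Complex.log z).im| < R := by rwa [Complex.log_im]
    have hslit : z ∈ Complex.slitPlane :=
      Complex.mem_slitPlane_iff_arg.2 ⟨(lt_of_abs_lt hargpi).ne, hz⟩
    constructor
    · refine ((hGan _ h1 h2).comp (analyticAt_clog hslit)).congr ?_
      filter_upwards [isOpen_ne.mem_nhds hz] with w hw
      simp [if_neg hw]
    · have := hG3 _ h1 h2
      rw [Complex.log_im] at this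
      simpa only [if_neg hz] using this

/-- Taylor remainder estimates in a sector determine the limits at the origin of the derivatives in
smaller sectors, by Cauchy's estimates in discs about `z` of radius proportional to `|z|`. -/
theorem tendsto_iteratedDeriv_of_norm_sub_sum_le {F : ℂ → ℂ} {S : Set ℂ} {b : ℕ → ℂ}
    {K r θ₀ θ₁ : ℝ} (n : ℕ) (hr : 0 < r) (hθ : θ₀ < θ₁) (hθ₁ : θ₁ < Real.pi)
    (hF : ∀ z : ℂ, z ≠ 0 → ‖z‖ < r → |Complex.arg z| ≤ θ₁ → AnalyticAt ℂ F z)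
    (hrem : ∀ z : ℂ, z ≠ 0 → ‖z‖ < r → |Complex.arg z| ≤ θ₁ →
      ‖F z - ∑ k ∈ Finset.range (n + 1), b k * z ^ k‖ ≤ K * ‖z‖ ^ (n + 1))
    (hS : ∀ z ∈ S, z ≠ 0 ∧ |Complex.arg z| ≤ θ₀) :
    Tendsto (iteratedDeriv n F) (𝓝[S] 0) (𝓝 (b n * n !)) := by
  have hpi := Real.pi_pos
  set q := min (1 / 2) ((θ₁ - θ₀) / Real.pi) with hq
  have hq0 : 0 < q := lt_min (by norm_num) (div_pos (by linarith) hpi)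
  have hq1 : q ≤ 1 / 2 := min_le_left _ _
  have hq2 : Real.pi * q ≤ θ₁ - θ₀ := by
    calc Real.pi * q ≤ Real.pi * ((θ₁ - θ₀) / Real.pi) := by gcongr; exact min_le_right _ _
      _ = θ₁ - θ₀ := by field_simp
  have hK : ∀ z : ℂ, z ≠ 0 → ‖z‖ < r → |Complex.arg z| ≤ θ₁ → 0 ≤ K := fun z hz hzr harg =>
    nonneg_of_mul_nonneg_left ((norm_nonneg _).trans (hrem z hz hzr harg))
      (pow_pos (norm_pos_iff.2 hz) _)
  have hbound : ∀ z ∈ S, ‖z‖ < r / 2 →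
      ‖iteratedDeriv n F z - b n * (n ! : ℂ)‖ ≤ n ! * K * 2 ^ (n + 1) / q ^ n * ‖z‖ := by
    intro z hzS hzr
    obtain ⟨hz, harg⟩ := hS z hzS
    have hz0 : 0 < ‖z‖ := norm_pos_iff.2 hz
    have hK0 := hK z hz (by linarith) (by linarith)
    have hdisc : ∀ w, ‖w - z‖ ≤ q * ‖z‖ → w ≠ 0 ∧ ‖w‖ < r ∧ |Complex.arg w| ≤ θ₁ ∧
        ‖w‖ ≤ 2 * ‖z‖ := by
      intro w hw
      obtain ⟨h1, h2, h3⟩ := Complex.mem_sector_of_norm_sub_le hz hq1 (by linarith) hw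
      exact ⟨h1, by linarith, by linarith, h3⟩
    have h1 := norm_iteratedDeriv_sub_le (F := F) (z := z) (R := q * ‖z‖)
      (S := K * (2 * ‖z‖) ^ (n + 1)) (by positivity) b n (n + 1)
      (fun w hw => by
        obtain ⟨e1, e2, e3, -⟩ := hdisc w hw
        exact hF w e1 e2 e3)
      (fun w hw => by
        obtain ⟨e1, e2, e3, e4⟩ := hdisc w hw
        refine (hrem w e1 e2 e3).trans ?_
        gcongr)
    rw [iteratedDeriv_sum_mul_pow_succ] at h1
    refine h1.trans (le_of_eq ?_)
    rw [mul_pow, mul_pow, pow_succ ‖z‖]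
    field_simp
  rw [tendsto_iff_norm_sub_tendsto_zero]
  have hlim : Tendsto (fun z : ℂ => n ! * K * 2 ^ (n + 1) / q ^ n * ‖z‖) (𝓝[S] 0) (𝓝 0) := by
    refine Tendsto.mono_left ?_ nhdsWithin_le_nhds
    exact (continuous_const.mul continuous_norm).tendsto' _ _ (by simp)
  refine squeeze_zero' (Eventually.of_forall fun _ => norm_nonneg _) ?_ hlim
  have hball : ∀ᶠ z : ℂ in 𝓝[S] 0, ‖z‖ < r / 2 := by
    refine nhdsWithin_le_nhds ?_
    exact (continuous_norm.tendsto' (0 : ℂ) 0 norm_zero).eventually (gt_mem_nhds (by positivity))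
  filter_upwards [self_mem_nhdsWithin, hball] with z hz hzr using hbound z hz hzr

namespace IsHalfPlaneWeight

variable {γ : ℂ → ℂ} {c B l : ℝ}

/-- The bounds of the derivatives of `f (exp ξ)` extend `f` to a sector wider than those that contain
the sets `Ω_η(γ)`; the Taylor estimates on the half-line propagate to this sector, and `δ` is chosen
so small that the sets `Ω_η(γ)` with `η > 1 / δ` lie in the disc where they hold. -/
theorem germsB_subset_iUnion_germsD (H : IsHalfPlaneWeight γ c B l) (hl : 0 < l) {M : ℕ → ℝ}
    (hM : IsRegularSeq M) {η : ℝ} (hη : 1 < η) :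
    germsB (1 / η) (weightedSeq M γ) (gammaHat γ) ⊆ ⋃ δ > (0 : ℝ), germsD M γ δ := by
  intro g hg
  obtain ⟨a, ha, f, ⟨hf, hfJ⟩, rfl⟩ := mem_iUnion₂.1 hg
  have hpi := Real.pi_pos
  have ha : 0 < a := ha
  have hη0 : 0 < η := by linarith
  set b := Real.pi / 2 * l with hb
  have hb0 : 0 < b := by positivity
  have hbpi : b < Real.pi := by
    have := H.lt_two
    rw [hb]
    nlinarith
  -- angles `b < θ₁ < θ₂ < min R π`, where `f (exp ξ)` extends to the strip `|Im ξ| < R`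
  obtain ⟨θ, hθ1, hθ2⟩ := exists_between (show b / η < b from div_lt_self hb0 hη)
  have hθ0 : 0 < θ := (by positivity : 0 < b / η).trans hθ1
  set R := η * θ with hR
  have hbR : b < R := by rw [div_lt_iff₀ hη0] at hθ1; linarith
  have hR0 : 0 < R := hb0.trans hbR
  obtain ⟨θ₁, hbθ₁, hθ₁⟩ := exists_between (lt_min hbR hbpi)
  obtain ⟨θ₂, hθ₁₂, hθ₂⟩ := exists_between hθ₁
  have hθ₂R : θ₂ < R := hθ₂.trans_le (min_le_left _ _)
  have hθ₂pi : θ₂ < Real.pi := hθ₂.trans_le (min_le_right _ _)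
  set r := a / 2 with hr
  have hr0 : 0 < r := by positivity
  have hra : r < a := by rw [hr]; linarith
  obtain ⟨C₁', hC₁', hfM', hfN⟩ := hfJ (Icc 0 r) isCompact_Icc
    fun x hx => ⟨hx.1, hx.2.trans_lt hra⟩
  obtain ⟨C₂, hC₂, hhat⟩ := H.exists_gammaHat_le hθ0 hθ2
  have hW : ∀ n, 0 < weightedSeq M γ n := fun n => mul_pos (hM.1 n) (H.weightSeq_pos _)
  set C₁ := max C₁' 1 with hC₁
  have hC₁1 : 1 ≤ C₁ := le_max_right _ _
  have hfM : ∀ n : ℕ, ∀ x ∈ Icc 0 r,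
      ‖iteratedDerivWithin n f (Ico 0 a) x‖ ≤ C₁ ^ (n + 1) * weightedSeq M γ n := by
    intro n x hx
    refine (hfM' n x hx).trans ?_
    have := hW n
    gcongr
    exact le_max_left _ _
  obtain ⟨F, hFf, hF⟩ := exists_sector_extension (C := C₁' * C₂) hr0 hra.le hR0 hf
    fun n ξ hξ => by
      refine (hfN n ξ ⟨(Real.exp_pos ξ).le, hξ.le⟩).trans ?_
      calc C₁' * (1 / η) ^ n * gammaHat γ n ≤ C₁' * (1 / η) ^ n * (C₂ * (n ! / θ ^ n)) := by
            gcongr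
            exact hhat n
        _ = _ := by
            rw [hR, mul_pow, one_div, inv_pow]
            field_simp
  set cf : ℕ → ℂ := fun k => iteratedDerivWithin k f (Ico 0 a) 0 with hcf
  have h0r : (0 : ℝ) ∈ Icc 0 r := ⟨le_rfl, hr0.le⟩
  have h0a : (0 : ℝ) ∈ Ico 0 a := ⟨le_rfl, ha⟩
  have hF0 : F 0 = cf 0 := by
    have := hFf 0 ⟨le_rfl, hr0⟩
    simpa [hcf] using this
  obtain ⟨u, hu, huM, huq⟩ := H.exists_root hM
  obtain ⟨Cq, hCq, hCq'⟩ := huq 1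
  -- the first two lower bounds for `A` absorb the constants in the bounds of the derivatives of
  -- `f`, the last one makes `1 / (A * u n) < r`
  set A := max (2 * C₁ ^ 2) (2 * Cq / (r * u 1)) with hA
  have hA1 : 2 * C₁ ^ 2 ≤ A := le_max_left _ _
  have hA0 : 0 < A := lt_of_lt_of_le (by positivity) hA1
  have hWu : ∀ n : ℕ, 1 ≤ n → weightedSeq M γ n = n ! * u n ^ n := by
    intro n hn
    rw [← huM n hn, weightedSeq]
    field_simp
  have hCpow : ∀ n : ℕ, 1 ≤ n → C₁ ^ (n + 1) ≤ (C₁ ^ 2) ^ n := by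
    intro n hn
    rw [← pow_mul]
    exact pow_le_pow_right₀ hC₁1 (by lia)
  have hcoef : ∀ k : ℕ, 1 ≤ k → ‖cf k / (k ! : ℂ)‖ ≤ (A * u k) ^ k := by
    intro k hk
    have huk := hu k
    rw [norm_div, Complex.norm_natCast, div_le_iff₀ (by positivity)]
    calc ‖cf k‖ ≤ C₁ ^ (k + 1) * weightedSeq M γ k := hfM k 0 h0r
      _ ≤ (C₁ ^ 2) ^ k * (k ! * u k ^ k) := by
          rw [hWu k hk]
          gcongr ?_ * _
          exact hCpow k hk
      _ ≤ A ^ k * (k ! * u k ^ k) := by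
          gcongr
          nlinarith [sq_nonneg C₁]
      _ = _ := by rw [mul_pow]; ring
  have hreal : ∀ n : ℕ, 1 ≤ n → ∀ x : ℝ, 0 < x → x < r →
      ‖F x - ∑ k ∈ Finset.range n, cf k / (k ! : ℂ) * (x : ℂ) ^ k‖ ≤ (A * u n * x) ^ n := by
    intro n hn x hx hxr
    obtain ⟨N, rfl⟩ : ∃ N, n = N + 1 := ⟨n - 1, by lia⟩
    have hun := hu (N + 1)
    have h1 := norm_sub_taylor_sum_le (s := Ico 0 a) ordConnected_Ico
      (D := fun n => iteratedDerivWithin n f (Ico 0 a))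
      (fun n t ht => hf.hasDerivWithinAt_iteratedDerivWithin (uniqueDiffOn_Ico 0 a) n ht)
      (x := x) (t₀ := 0) ⟨hx.le, hxr.trans hra⟩ h0a N
      (K := C₁ ^ (N + 1 + 1) * weightedSeq M γ (N + 1)) (fun t ht => by
        rw [uIcc_of_le hx.le] at ht
        exact hfM (N + 1) t ⟨ht.1, ht.2.trans hxr.le⟩)
    rw [sub_zero, abs_of_pos hx] at h1
    have h2 : ∑ k ∈ Finset.range (N + 1), cf k / (k ! : ℂ) * (x : ℂ) ^ k =
        ∑ k ∈ Finset.range (N + 1), (x : ℂ) ^ k / k ! *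
          iteratedDerivWithin k f (Ico 0 a) 0 := by
      refine Finset.sum_congr rfl fun k _ => ?_
      rw [hcf]
      ring
    rw [h2, hFf x ⟨hx.le, hxr⟩]
    simp only [iteratedDerivWithin_zero] at h1
    refine h1.trans ?_
    rw [hWu _ hn, Nat.factorial_succ]
    have h3 : ((N + 1 : ℕ) : ℝ) ≤ 2 ^ (N + 1) := by exact_mod_cast Nat.lt_two_pow_self.le
    calc C₁ ^ (N + 1 + 1) * (((N + 1) * N ! : ℕ) * u (N + 1) ^ (N + 1)) * x ^ (N + 1) / N !
        = C₁ ^ (N + 1 + 1) * ((N + 1 : ℕ) : ℝ) * u (N + 1) ^ (N + 1) * x ^ (N + 1) := by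
          push_cast
          field_simp
      _ ≤ (C₁ ^ 2) ^ (N + 1) * 2 ^ (N + 1) * u (N + 1) ^ (N + 1) * x ^ (N + 1) := by
          gcongr
          exact hCpow _ hn
      _ = (2 * C₁ ^ 2) ^ (N + 1) * (u (N + 1) * x) ^ (N + 1) := by
          simp only [mul_pow]; ring
      _ ≤ A ^ (N + 1) * (u (N + 1) * x) ^ (N + 1) := by gcongr
      _ = _ := by simp only [mul_pow]; ring
  set K₀ := max (max 1 ‖cf 0‖) (C₁' * C₂ * (1 - θ₂ / R)⁻¹) with hK₀
  have hK₀1 : 1 ≤ K₀ := (le_max_left _ _).trans (le_max_left _ _)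
  have hFK : ∀ z : ℂ, z ≠ 0 → ‖z‖ < r → |Complex.arg z| ≤ θ₂ → ‖F z‖ ≤ K₀ := by
    intro z hz hzr harg
    have h1 : 0 < 1 - θ₂ / R := by
      have : θ₂ / R < 1 := (div_lt_one hR0).2 hθ₂R
      linarith
    refine ((hF z hz hzr (harg.trans_lt hθ₂R) (harg.trans_lt hθ₂pi)).2.trans ?_).trans
      (le_max_right _ _)
    gcongr
  have hFan : ∀ z : ℂ, z ≠ 0 → ‖z‖ < r → |Complex.arg z| ≤ θ₂ → AnalyticAt ℂ F z :=
    fun z hz hzr harg => (hF z hz hzr (harg.trans_lt hθ₂R) (harg.trans_lt hθ₂pi)).1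
  obtain ⟨C, hC1, hC⟩ := exists_norm_sub_sum_le_of_sector (F := F)
    (b := fun k => cf k / (k ! : ℂ)) (w := fun n => A * u n) (r := r) (θ₁ := θ₁) (θ₂ := θ₂)
    (K₀ := K₀) (by linarith) hθ₁₂ hθ₂pi hK₀1
    (fun z hz hzr harg => (hFan z hz hzr harg).differentiableAt) hFK
    (by
      have h1 : ‖cf 0‖ ≤ K₀ := (le_max_right _ _).trans (le_max_left _ _)
      simpa using h1) hcoef hreal
    (fun n => mul_pos hA0 (hu n))
    (fun n hn => by
      have hun := hu n
      have hu1 := hu 1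
      rw [div_lt_iff₀ (by positivity)]
      have h1 : 2 * Cq / (r * u 1) ≤ A := le_max_right _ _
      rw [div_le_iff₀ (by positivity)] at h1
      have h2 := hCq' 1 n le_rfl (by lia)
      have h3 : A * (r * u 1) ≤ Cq * (r * (A * u n)) := by
        calc A * (r * u 1) ≤ A * (r * (Cq * u n)) := by gcongr
          _ = _ := by ring
      have h4 : Cq * 2 ≤ Cq * (r * (A * u n)) := by linarith
      have h5 := le_of_mul_le_mul_left h4 (by linarith)
      linarith)
    (fun lam => by
      obtain ⟨C, hC, h⟩ := huq lam
      refine ⟨C, hC, fun k n h1 h2 => ?_⟩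
      have := h k n h1 h2
      calc A * u k ≤ A * (C * u n) := by gcongr
        _ = _ := by ring)
  obtain ⟨D, hD, hDΩ⟩ := H.exists_norm_le_of_mem_domainOmega
  refine mem_iUnion₂.2 ⟨r / D, (by positivity : 0 < r / D), F, fun η' hη' => ?_, ?_⟩
  · have hη'0 : 0 < η' := lt_trans (by positivity) hη'
    have hΩ : ∀ z ∈ domainOmega γ η', z ≠ 0 ∧ ‖z‖ < r ∧ |Complex.arg z| ≤ b := by
      intro z hz
      refine ⟨hz.1, (hDΩ η' hη'0 z hz).trans_lt ?_, H.abs_arg_le_of_mem_domainOmega hz⟩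
      rw [one_div_div, div_lt_iff₀ hr0] at hη'
      rw [div_lt_iff₀ hη'0]
      linarith
    refine ⟨fun z hz => ?_, cf, ⟨hF0, fun n => ?_⟩, ?_⟩
    · obtain ⟨h1, h2, h3⟩ := hΩ z hz
      exact hFan z h1 h2 (by linarith)
    · have h := tendsto_iteratedDeriv_of_norm_sub_sum_le (F := F) (S := domainOmega γ η')
        (b := fun k => cf k / (k ! : ℂ)) (K := C ^ (n + 1 + 1) * (A * u (n + 1)) ^ (n + 1)) n hr0
        hbθ₁ (hθ₁₂.trans hθ₂pi) (fun z hz hzr harg => hFan z hz hzr (by linarith))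
        (fun z hz hzr harg => hC (n + 1) (by lia) z hz hzr harg)
        (fun z hz => ⟨(hΩ z hz).1, (hΩ z hz).2.2⟩)
      have h1 : cf n / (n ! : ℂ) * n ! = cf n :=
        div_mul_cancel₀ _ (by exact_mod_cast n.factorial_ne_zero)
      simpa only [h1] using h
    · have hW0 : 0 < M 0 * weightSeq γ 1 := hW 0
      set C' := max (C * A) (max C (K₀ / (M 0 * weightSeq γ 1))) with hC'
      have hC'0 : 0 < C' := lt_of_lt_of_le (by positivity) (le_max_left _ _)
      refine ⟨C', hC'0, fun n z hz => ?_⟩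
      obtain ⟨h1, h2, h3⟩ := hΩ z hz
      rcases Nat.eq_zero_or_pos n with hn | hn
      · subst hn
        have h4 : K₀ / (M 0 * weightSeq γ 1) ≤ C' := (le_max_right _ _).trans (le_max_right _ _)
        rw [div_le_iff₀ hW0] at h4
        simpa using (hFK z h1 h2 (by linarith)).trans h4
      · refine (hC n hn z h1 h2 (by linarith)).trans ?_
        rw [huM n hn]
        have hun := hu n
        gcongr ?_ * ‖z‖ ^ n
        calc C ^ (n + 1) * (A * u n) ^ n = C * (C * A) ^ n * u n ^ n := by
              simp only [mul_pow, pow_succ]; ring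
          _ ≤ C' * C' ^ n * u n ^ n := by
              gcongr
              · exact (le_max_left _ _).trans (le_max_right _ _)
              · exact le_max_left _ _
          _ = _ := by rw [pow_succ']
  · refine Germ.coe_eq.2 ?_
    filter_upwards [Ico_mem_nhdsGE hr0] with x hx using hFf x hx

end IsHalfPlaneWeight

theorem lemma1p7 (γ : ℂ → ℂ) (hγ : IsAdmissible γ) (hγan : IsAnalyticSeq (gammaHat γ))
    (M : ℕ → ℝ) (hM : IsRegularSeq M) (η : ℝ) (hη : 1 < η) :
    germsB (1 / η) (weightedSeq M γ) (gammaHat γ) ⊆ (⋃ δ > (0 : ℝ), germsD M γ δ) ∧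
      (⋃ δ > (0 : ℝ), germsD M γ δ) ⊆ germsB η (weightedSeq M γ) (gammaHat γ) := by
  obtain ⟨c, B, l, H⟩ := hγ.exists_halfPlaneWeight
  have hl := H.lim_pos hγan
  exact ⟨H.germsB_subset_iUnion_germsD hl hM hη,
    iUnion₂_subset fun δ hδ => H.germsD_subset_germsB hl hM.1 hη hδ⟩
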